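/- \textbf{Setting.} Let $d\ge 1$ and let $A\in\mathbb R^{n\times d}$ have rank $d$, with rows $a_1^\top,\dots,a_n^\top$. For $w\in\mathbb R^n$ put $h_i(w)=a_i^\top\big(\sum_{j=1}^n w_ja_ja_j^\top\big)^{-1}a_i$. For $\xi>0$, a vector $w\in\mathbb R^n_{\ge 0}$ is called a $(1+\xi)$-approximation to the John ellipsoid of $\{x:|\langle a_i,x\rangle|\le 1\ \forall i\}$ if $\sum_j w_ja_ja_j^\top$ is positive definite, $\sum_i w_i=d$ and $h_i(w)\le 1+\xi$ for all $i$. \textbf{Algorithm} (parameters $T,s,N\in\mathbb N$, $\sigma>0$, $\kappa\ge 1$). Set $w_{1,i}=d/n$ for all $i$. For $k=1,\dots,T-1$, let $B_k=\sqrt{\mathrm{diag}(w_k)}\,A$ and 1. compute (possibly using fresh random bits) numbers $\tau_{k,i}$ which, whenever $w_k\ge 0$ and $B_k$ has full column rank, almost surely satisfy $\kappa^{-1}\ell_{k,i}\le\tau_{k,i}\le\kappa\,\ell_{k,i}$ for all $i$, where $\ell_{k,i}=\big(B_k(B_k^\top B_k)^{-1}B_k^\top\big)_{ii}$ are the leverage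 scores of $B_k$; 2. draw $N$ independent row indices, with replacement, from the distribution $p_{k,i}=\tau_{k,i}/\sum_j\tau_{k,j}$, and let $D_k$ be the diagonal matrix whose entry $(D_k)_{ii}$ is the number of times that $i$ was drawn divided by $Np_{k,i}$; 3. draw $S_k\in\mathbb R^{s\times d}$ with i.i.d. $\mathcal N(0,1)$ entries, and i.i.d. noise $z_{k+1,1},\dots,z_{k+1,n}$ from the Gaussian $\mathcal N(0,\sigma^2)$ conditioned on $[-0.5,0.5]$, and set $$w_{k+1,i}=\tfrac1s\big\|S_k(B_k^\top D_kB_k)^{-1/2}\sqrt{w_{k,i}}\,a_i\big\|_2^2\,(1+z_{k+1,i}),\qquad i=1,\dots,n.$$ All random choices, within an iteration and in different iterations, are independent (the indices in step 2 are generated from independent uniform variables by inverting the distribution function of $p_k$). Let $u=\frac1T\sum_{k=1}^T w_k$ be the unnormalized output and $v_i=\frac{d}{\sum_j u_j}u_i$ the normalized output. \textbf{Theorem.} For every $\kappa\ge 1$ there is a constant $C>0$, depending only on $\kappa$, such that the following holds for all $n$, $d\ge 1$, all $A\in\mathbb R^{n\times d}$ of rank $d$, all $\xi,\delta_0\in(0,1)$,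 all $0<\sigma\le\xi/32$, all $0<\delta\le\delta_0/n$ and all $0<\delta_1\le\delta_0/T$. If $$T\ge C\big(\xi^{-1}\log(n/d)+\xi^{-2}\log(1/\delta)\big),\qquad s\ge C\,\xi^{-1},\qquad N\ge C\,\xi^{-2}\,d\,\log(nd/\delta_1),$$ then with probability at least $1-\delta_0$ the matrix $\sum_j u_ja_ja_j^\top$ is positive definite, $h_i(u)\le 1+\xi$ for all $i\in[n]$, and $v$ is a $(1+\xi)$-approximation to the John ellipsoid. In addition, $\sum_{i=1}^n v_i=d$ almost surely. -/

import Mathlib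

open MeasureTheory ProbabilityTheory
open scoped Matrix

namespace DPJohn

noncomputable section

/-- The matrix `Aᵀ diag(w) A = ∑ⱼ wⱼ aⱼ aⱼᵀ`, where `aⱼᵀ` is the `j`-th row of `A`. -/
def gram {n d : ℕ} (A : Matrix (Fin n) (Fin d) ℝ) (w : Fin n → ℝ) :
    Matrix (Fin d) (Fin d) ℝ :=
  Aᵀ * Matrix.diagonal w * A

/-- `h_i(w) = a_iᵀ (∑ⱼ wⱼ aⱼ aⱼᵀ)⁻¹ a_i`. -/
def h {n d : ℕ} (A : Matrix (Fin n) (Fin d) ℝ) (w : Fin n → ℝ) (i : Fin n) : ℝ :=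
  A i ⬝ᵥ ((gram A w)⁻¹ *ᵥ A i)

/-- `w` is a `(1 + ξ)`-approximate solution of the John ellipsoid program of `A`. Invertibility
of `∑ⱼ wⱼ aⱼ aⱼᵀ`, implicit in writing its inverse, is made explicit. -/
structure IsApproxJohn {n d : ℕ} (A : Matrix (Fin n) (Fin d) ℝ) (ξ : ℝ) (w : Fin n → ℝ) :
    Prop where
  nonneg : ∀ i, 0 ≤ w i
  posDef : (gram A w).PosDef
  sum_eq : ∑ i, w i = d
  h_le : ∀ i, h A w i ≤ 1 + ξ

/-- `B = √W A` with `W = diag(w)`. -/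
def scaledRows {n d : ℕ} (A : Matrix (Fin n) (Fin d) ℝ) (w : Fin n → ℝ) :
    Matrix (Fin n) (Fin d) ℝ :=
  Matrix.diagonal (fun i => √(w i)) * A

/-- The `i`-th leverage score of `B`: the `i`-th diagonal entry of `B (Bᵀ B)⁻¹ Bᵀ`. -/
def leverageScore {n d : ℕ} (B : Matrix (Fin n) (Fin d) ℝ) (i : Fin n) : ℝ :=
  (B * (Bᵀ * B)⁻¹ * Bᵀ) i i

/-- The sampling distribution proportional to the scores `τ`. -/
def samplingProb {n : ℕ} (τ : Fin n → ℝ) (i : Fin n) : ℝ :=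
  τ i / ∑ j, τ j

/-- The number of `t` for which the sample drawn from the distribution `p` on `Fin n` by inverting
its distribution function at `U t` is equal to `i`. If the `U t` are independent and uniform on
`[0, 1]`, these are the multiplicities of `N` independent draws from `p`, with replacement. -/
def sampleCount {n N : ℕ} (p : Fin n → ℝ) (U : Fin N → ℝ) (i : Fin n) : ℕ :=
  Nat.card {t : Fin N // ∑ j ∈ Finset.Iio i, p j ≤ U t ∧ U t < ∑ j ∈ Finset.Iic i, p j}

/-- The diagonal sampling-and-rescaling matrix: each of the `N` draws adds `1 / (N pᵢ)` to the
`i`-th diagonal entry when the row drawn is `i`. -/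
def samplingMatrix {n N : ℕ} (p : Fin n → ℝ) (U : Fin N → ℝ) : Matrix (Fin n) (Fin n) ℝ :=
  Matrix.diagonal fun i => (sampleCount p U i : ℝ) / (N * p i)

/-- `M ^ (-1/2)` for a symmetric positive definite matrix `M`. -/
def invSqrt {d : ℕ} (M : Matrix (Fin d) (Fin d) ℝ) : Matrix (Fin d) (Fin d) ℝ :=
  cfc (fun x : ℝ => (√x)⁻¹) M

/-- The Gaussian distribution with mean `μ` and variance `σ²`, truncated to `[-0.5, 0.5]`
(that is, conditioned on this interval). -/
def truncGaussian (μ σ : ℝ) : Measure ℝ :=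
  (gaussianReal μ (Real.toNNReal (σ ^ 2)))[|Set.Icc (-1 / 2 : ℝ) (1 / 2)]

/-- The randomness used in one iteration: a random seed for the leverage score approximation,
the uniform variables behind the row sampling, the sketching matrix, and the noise. -/
abbrev Draw (R : Type*) (n d s N : ℕ) : Type _ :=
  R × (Fin N → ℝ) × (Fin s → Fin d → ℝ) × (Fin n → ℝ)

/-- The law of the randomness of one iteration: an arbitrary law `ν` of the seed, independent
uniform variables on `[0, 1]`, a matrix with independent standard Gaussian entries, and independent
centred truncated Gaussian noise, all independent of each other. -/
def drawLaw {R : Type*} [MeasurableSpace R] (ν : Measure R) (n d s N : ℕ) (σ : ℝ) :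
    Measure (Draw R n d s N) :=
  ν.prod
    ((Measure.pi fun _ : Fin N => (volume : Measure ℝ).restrict (Set.Icc 0 1)).prod
      ((Measure.pi fun _ : Fin s => Measure.pi fun _ : Fin d => gaussianReal 0 1).prod
        (Measure.pi fun _ : Fin n => truncGaussian 0 σ)))

/-- The sketched weight `(1/s) ‖S (Bᵀ D B)^(-1/2) √(w_i) a_i‖₂²`, with `B = √W A`. -/
def sketchedWeight {n d s : ℕ} (A : Matrix (Fin n) (Fin d) ℝ) (D : Matrix (Fin n) (Fin n) ℝ)
    (S : Matrix (Fin s) (Fin d) ℝ) (w : Fin n → ℝ) (i : Fin n) : ℝ :=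
  1 / (s : ℝ) * ∑ j, ((S * invSqrt ((scaledRows A w)ᵀ * D * scaledRows A w)) *ᵥ
    (√(w i) • A i)) j ^ 2

/-- One iteration of the algorithm. Here `τ r w` is the approximation to the leverage scores of
`√W A` computed with seed `r`. -/
def step {R : Type*} {n d s N : ℕ} (A : Matrix (Fin n) (Fin d) ℝ)
    (τ : R → (Fin n → ℝ) → Fin n → ℝ) (x : Draw R n d s N) (w : Fin n → ℝ) : Fin n → ℝ :=
  fun i =>
    sketchedWeight A (samplingMatrix (samplingProb (τ x.1 w)) x.2.1) (Matrix.of x.2.2.1) w i *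
      (1 + x.2.2.2 i)

/-- The iterates: `weights A τ x k` is `w_{k+1}`, so the initial point has index `0`. -/
def weights {R : Type*} {n d s N : ℕ} (A : Matrix (Fin n) (Fin d) ℝ)
    (τ : ℕ → R → (Fin n → ℝ) → Fin n → ℝ) (x : ℕ → Draw R n d s N) : ℕ → Fin n → ℝ
  | 0 => fun _ => (d : ℝ) / n
  | k + 1 => step A (τ k) (x k) (weights A τ x k)

/-- The unnormalized output `u = (1/T) ∑_{k=1}^T w_k`. -/
def average {R : Type*} {n d s N : ℕ} (A : Matrix (Fin n) (Fin d) ℝ)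
    (τ : ℕ → R → (Fin n → ℝ) → Fin n → ℝ) (x : ℕ → Draw R n d s N) (T : ℕ) : Fin n → ℝ :=
  fun i => 1 / (T : ℝ) * ∑ k ∈ Finset.range T, weights A τ x k i

/-- The normalized output `v_i = (d / ∑ⱼ uⱼ) u_i`. -/
def output {R : Type*} {n d s N : ℕ} (A : Matrix (Fin n) (Fin d) ℝ)
    (τ : ℕ → R → (Fin n → ℝ) → Fin n → ℝ) (x : ℕ → Draw R n d s N) (T : ℕ) : Fin n → ℝ :=
  fun i => (d : ℝ) / (∑ j, average A τ x T j) * average A τ x T i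

/-- `τ` computes a `κ`-approximation to the leverage scores of `√W A`, almost surely in the seed,
for every weight vector `w ≥ 0` for which `√W A` has full column rank. -/
structure IsLeverageApprox {R : Type*} [MeasurableSpace R] (ν : Measure R) {n d : ℕ}
    (A : Matrix (Fin n) (Fin d) ℝ) (κ : ℝ) (τ : R → (Fin n → ℝ) → Fin n → ℝ) : Prop where
  measurable : Measurable fun q : R × (Fin n → ℝ) => τ q.1 q.2
  bounds : ∀ w : Fin n → ℝ, (∀ i, 0 ≤ w i) → (gram A w).PosDef → ∀ᵐ r ∂ν, ∀ i,
    κ⁻¹ * leverageScore (scaledRows A w) i ≤ τ r w i ∧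
      τ r w i ≤ κ * leverageScore (scaledRows A w) i

end

end DPJohn

namespace DPJohn

/-! ### Traces of powers of products of symmetric matrices. -/

section TraceInequalities

variable {m : Type*} [Fintype m]

/-! The function w ↦ log h_i(w) is convex, so h_i(u)^T is at most the product of the h_i(w_k)
(`h_average_pow_le`). A noiseless iteration would set w_{k+1,i} = w_{k,i} h_i(w_k). Hence write
h_i(w_k) = ρ_k w_{k+1,i} / w_{k,i}, where ρ_k = w_{k,i} h_i(w_k) / w_{k+1,i} is the error of the
step. The weights telescope, the last factor is absorbed by w_{T,i} h_i(w_T) ≤ 1, and h_i(u)^T ≤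
(n/d) ∏ ρ_k remains (`h_average_pow_le_mul`). Once ξT is large compared with log(n/d), the T-th root
of n/d is harmless.

No single ρ_k has to be concentrated. It suffices that its conditional mean given the past is at
most e^{ξ/32}: the bounds then multiply (`lintegral_prod_recursion_le`), and Markov's inequality
keeps ∏ ρ_k below e^{ξT/8} outside an event of probability e^{-ξT/16}. Three errors enter this mean
(`lintegral_ratioFn_le`): a factor 1 + ε from the row sampling; a factor s/(s-2), because an inverse
chi-square variable with s degrees of freedom has mean 1/(s-2); and a factor 1 + O(σ²) from the
noise, whose mean is zero. This is why s of order 1/ξ is enough.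

Normalizing multiplies h_i by ∑u/d. The total mass is controlled by the same multiplicative Markov
argument, applied to the exponential of the total weight (`lintegral_massFn_le`). All rows share one
sketch, so Jensen's inequality over the rows replaces independence.

Accuracy of the sampling is a matrix Bernstein inequality (`sum_prod_exists_quadForm_gt_le`),
obtained from Golden–Thompson in the manner of Ahlswede and Winter. The moment bounds must hold for
every possible past, so `ratioFn` and `massFn` are cut off to admissible weights and accurate
samples; a union bound over the iterations controls the complement (`drawLaw_badSet_le`).

For n = 1 the union bound is too weak when δ₀ is close to 1. There the sampling is exact, and
normalization alone forces h = 1. -/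

theorem trace_mul_pow_comm [DecidableEq m] (A B : Matrix m m ℝ) (k : ℕ) :
    ((A * B) ^ k).trace = ((B * A) ^ k).trace := by
  cases k with
  | zero => simp
  | succ k =>
    have h : (A * B) ^ k * A = A * (B * A) ^ k := by
      induction k with
      | zero => simp
      | succ k ih => rw [pow_succ', mul_assoc, ih, pow_succ' (B * A)]; simp only [mul_assoc]
    rw [pow_succ, ← mul_assoc, h, mul_assoc, Matrix.trace_mul_comm, mul_assoc, ← pow_succ]

/-- Cauchy–Schwarz for the Frobenius inner product. -/
theorem sq_trace_mul_le (A B : Matrix m m ℝ) :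
    (A * B).trace ^ 2 ≤ (A * Aᵀ).trace * (Bᵀ * B).trace := by
  have h := Finset.sum_mul_sq_le_sq_mul_sq (Finset.univ : Finset (m × m))
    (fun q => A q.1 q.2) (fun q => B q.2 q.1)
  have e1 : (A * B).trace = ∑ q : m × m, A q.1 q.2 * B q.2 q.1 := by
    simp [Matrix.trace, Matrix.mul_apply, Fintype.sum_prod_type]
  have e2 : (A * Aᵀ).trace = ∑ q : m × m, A q.1 q.2 ^ 2 := by
    simp [Matrix.trace, Matrix.mul_apply, Fintype.sum_prod_type, sq]
  have e3 : (Bᵀ * B).trace = ∑ q : m × m, B q.2 q.1 ^ 2 := by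
    simp [Matrix.trace, Matrix.mul_apply, Fintype.sum_prod_type, sq]
  rw [e1, e2, e3]; exact h

theorem trace_mul_transpose_self_nonneg (A : Matrix m m ℝ) : 0 ≤ (A * Aᵀ).trace := by
  have e2 : (A * Aᵀ).trace = ∑ q : m × m, A q.1 q.2 ^ 2 := by
    simp [Matrix.trace, Matrix.mul_apply, Fintype.sum_prod_type, sq]
  rw [e2]; positivity

theorem abs_trace_le_of_sq_le {a b c : ℝ} (hc : 0 ≤ c) (h : a ^ 2 ≤ b * c) (hbc : b = c) :
    |a| ≤ c := by
  subst hbc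
  exact abs_le_of_sq_le_sq (by nlinarith) hc

/-- The two inequalities feed each other. For the first at k + 1, apply it at k to X², rotate the
trace to that of ((XᵀX)(XXᵀ))^(2^k), split by the second inequality, and finish with Cauchy–Schwarz,
since XᵀX and XXᵀ have the same traces of powers. For the second at k + 1, apply the first to AB,
rotate to (A²B²)^(2^k), and use the second at k for A² and B². -/
theorem trace_pow_two_pow_le [DecidableEq m] (k : ℕ) :
    (∀ X : Matrix m m ℝ, |(X ^ 2 ^ (k + 1)).trace| ≤ ((X * Xᵀ) ^ 2 ^ k).trace) ∧
    (∀ A B : Matrix m m ℝ, Aᵀ = A → Bᵀ = B →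
      ((A * B) ^ 2 ^ k).trace ≤ (A ^ 2 ^ k * B ^ 2 ^ k).trace) := by
  induction k with
  | zero =>
    refine ⟨fun X => ?_, fun A B _ _ => by simp⟩
    have h := sq_trace_mul_le X X
    simp only [zero_add, pow_one, pow_zero, pow_two X]
    refine abs_trace_le_of_sq_le (trace_mul_transpose_self_nonneg X) ?_ rfl
    rwa [Matrix.trace_mul_comm Xᵀ X] at h
  | succ k ih =>
    obtain ⟨hP, hQ⟩ := ih
    constructor
    · intro X
      have h1 := hP (X ^ 2)
      rw [← pow_mul, ← pow_succ'] at h1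
      have e1 : ((X ^ 2 * (X ^ 2)ᵀ) ^ 2 ^ k).trace = (((Xᵀ * X) * (X * Xᵀ)) ^ 2 ^ k).trace := by
        rw [Matrix.transpose_pow, pow_two, pow_two,
          show X * X * (Xᵀ * Xᵀ) = (X * X * Xᵀ) * Xᵀ by simp only [mul_assoc],
          trace_mul_pow_comm]
        simp only [mul_assoc]
      have h2 := hQ (Xᵀ * X) (X * Xᵀ) (by simp) (by simp)
      have h3 := sq_trace_mul_le ((Xᵀ * X) ^ 2 ^ k) ((X * Xᵀ) ^ 2 ^ k)
      have s1 : ((Xᵀ * X) ^ 2 ^ k)ᵀ = (Xᵀ * X) ^ 2 ^ k := by simp [Matrix.transpose_pow]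
      have s2 : ((X * Xᵀ) ^ 2 ^ k)ᵀ = (X * Xᵀ) ^ 2 ^ k := by simp [Matrix.transpose_pow]
      have n1 := trace_mul_transpose_self_nonneg ((X * Xᵀ) ^ 2 ^ k)
      rw [s1, s2, ← pow_add, ← pow_add, ← two_mul, ← pow_succ', trace_mul_pow_comm Xᵀ X] at h3
      rw [s2, ← pow_add, ← two_mul, ← pow_succ'] at n1
      have h4 := abs_trace_le_of_sq_le n1 h3 rfl
      calc _ ≤ _ := h1
        _ = _ := e1
        _ ≤ _ := h2
        _ ≤ _ := le_abs_self _
        _ ≤ _ := h4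
    · intro A B hA hB
      have h1 := (le_abs_self _).trans (hP (A * B))
      have e1 : ((A * B * (A * B)ᵀ) ^ 2 ^ k).trace = ((A ^ 2 * B ^ 2) ^ 2 ^ k).trace := by
        rw [Matrix.transpose_mul, hA, hB,
          show A * B * (B * A) = (A * B ^ 2) * A by simp only [mul_assoc, pow_two],
          trace_mul_pow_comm]
        simp only [mul_assoc, pow_two]
      have h2 := hQ (A ^ 2) (B ^ 2) (by rw [Matrix.transpose_pow, hA])
        (by rw [Matrix.transpose_pow, hB])
      rw [← pow_mul, ← pow_mul, ← pow_succ'] at h2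
      exact h1.trans (e1.trans_le h2)

end TraceInequalities

/-! ### The Lie–Trotter product formula along powers of two. -/

section LieTrotter

open Filter Topology NormedSpace

theorem norm_pow_sub_pow_le {𝔸 : Type*} [NormedRing 𝔸] [NormOneClass 𝔸] (a b : 𝔸) {r : ℝ}
    (ha : ‖a‖ ≤ r) (hb : ‖b‖ ≤ r) (hr : 1 ≤ r) (n : ℕ) : ‖a ^ n - b ^ n‖ ≤ n * r ^ n * ‖a - b‖ := by
  induction n with
  | zero => simp
  | succ n ih =>
    have h0 : (0 : ℝ) ≤ r := by linarith
    have e : a ^ (n + 1) - b ^ (n + 1) = (a ^ n - b ^ n) * a + b ^ n * (a - b) := by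
      rw [pow_succ, pow_succ]; noncomm_ring
    have hbn : ‖b ^ n‖ ≤ r ^ n := (norm_pow_le b n).trans (by gcongr)
    calc ‖a ^ (n + 1) - b ^ (n + 1)‖ ≤ ‖a ^ n - b ^ n‖ * ‖a‖ + ‖b ^ n‖ * ‖a - b‖ := by
          rw [e]; exact (norm_add_le _ _).trans (add_le_add (norm_mul_le _ _) (norm_mul_le _ _))
      _ ≤ (n * r ^ n * ‖a - b‖) * r + r ^ (n + 1) * ‖a - b‖ := by
          have : r ^ n ≤ r ^ (n + 1) := pow_le_pow_right₀ hr (Nat.le_succ n)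
          gcongr
          exact hbn.trans this
      _ = (n + 1 : ℕ) * r ^ (n + 1) * ‖a - b‖ := by push_cast; ring

theorem norm_exp_le_exp_norm {𝔸 : Type*} [NormedRing 𝔸] [NormedAlgebra ℝ 𝔸] [NormOneClass 𝔸]
    [CompleteSpace 𝔸] (a : 𝔸) : ‖exp a‖ ≤ Real.exp ‖a‖ := by
  rw [exp_eq_tsum ℝ, Real.exp_eq_exp_ℝ, exp_eq_tsum ℝ]
  have hs := NormedSpace.norm_expSeries_summable' (𝕂 := ℝ) a
  have hs' := NormedSpace.expSeries_summable' (𝕂 := ℝ) (‖a‖)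
  refine (norm_tsum_le_tsum_norm hs).trans (hs.tsum_le_tsum (fun n => ?_) hs')
  rw [norm_smul, smul_eq_mul, Real.norm_of_nonneg (by positivity)]
  gcongr
  exact norm_pow_le a n

/-- The curve exp(ta)exp(tb) - exp(t(a+b)) has derivative zero at t = 0, so at t = 2^{-k} it is
o(2^{-k}). Passing to 2^k-th powers multiplies the difference by at most a constant times 2^k. -/
theorem tendsto_exp_mul_exp_pow {𝔸 : Type*} [NormedRing 𝔸] [NormedAlgebra ℝ 𝔸] [NormOneClass 𝔸]
    [CompleteSpace 𝔸] (a b : 𝔸) :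
    Tendsto (fun k : ℕ => (exp (((2 : ℝ) ^ k)⁻¹ • a) * exp (((2 : ℝ) ^ k)⁻¹ • b)) ^ 2 ^ k) atTop
      (𝓝 (exp (a + b))) := by
  have hd : HasDerivAt (fun t : ℝ => exp (t • a) * exp (t • b) - exp (t • (a + b))) 0 0 := by
    have h1 := hasDerivAt_exp_smul_const (𝕂 := ℝ) a (0 : ℝ)
    have h2 := hasDerivAt_exp_smul_const (𝕂 := ℝ) b (0 : ℝ)
    have h3 := hasDerivAt_exp_smul_const (𝕂 := ℝ) (a + b) (0 : ℝ)
    exact ((h1.mul h2).sub h3).congr_deriv (by simp)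
  have hlim := hd.tendsto_slope_zero
  have hk : Tendsto (fun k : ℕ => ((2 : ℝ) ^ k)⁻¹) atTop (𝓝[≠] 0) := by
    rw [tendsto_nhdsWithin_iff]
    refine ⟨tendsto_inv_atTop_zero.comp (tendsto_pow_atTop_atTop_of_one_lt one_lt_two),
      Eventually.of_forall fun k => ?_⟩
    simp
  have h1 := (hlim.comp hk).norm
  simp only [Function.comp_def, zero_add, inv_inv, zero_smul, exp_zero, mul_one, sub_self,
    sub_zero, norm_zero, norm_smul, norm_pow, Real.norm_two] at h1
  set R := Real.exp (‖a‖ + ‖b‖) with hR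
  have h2 := h1.mul_const R
  rw [zero_mul] at h2
  rw [tendsto_iff_norm_sub_tendsto_zero]
  refine squeeze_zero (fun _ => norm_nonneg _) (fun k => ?_) h2
  set t : ℝ := ((2 : ℝ) ^ k)⁻¹ with ht
  have htpos : 0 < t := by positivity
  have e : exp (a + b) = exp (t • (a + b)) ^ 2 ^ k := by
    let : NormedAlgebra ℚ 𝔸 := NormedAlgebra.restrictScalars ℚ ℝ 𝔸
    rw [← exp_nsmul, ← Nat.cast_smul_eq_nsmul ℝ, smul_smul, ht]
    simp
  have n1 : ‖exp (t • a) * exp (t • b)‖ ≤ Real.exp (t * (‖a‖ + ‖b‖)) := by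
    refine (norm_mul_le _ _).trans ?_
    rw [mul_add, Real.exp_add]
    gcongr <;> refine (norm_exp_le_exp_norm _).trans_eq ?_ <;>
      rw [norm_smul, Real.norm_of_nonneg htpos.le]
  have n2 : ‖exp (t • (a + b))‖ ≤ Real.exp (t * (‖a‖ + ‖b‖)) := by
    refine (norm_exp_le_exp_norm _).trans ?_
    rw [norm_smul, Real.norm_of_nonneg htpos.le]
    gcongr
    exact norm_add_le _ _
  -- The growth factor r^(2^k) with r = exp(t(‖a‖ + ‖b‖)) is the constant R, whatever k is.
  have h := norm_pow_sub_pow_le _ _ n1 n2 (Real.one_le_exp (by positivity)) (2 ^ k)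
  rw [← e, ← Real.exp_nat_mul] at h
  refine h.trans_eq ?_
  have : ((2 ^ k : ℕ) : ℝ) * (t * (‖a‖ + ‖b‖)) = ‖a‖ + ‖b‖ := by
    rw [ht]; push_cast; field_simp
  rw [this, hR]; push_cast; ring

end LieTrotter

/-! ### The Golden–Thompson inequality. -/

section GoldenThompson

open Filter Topology NormedSpace
attribute [local instance] Matrix.linftyOpNormedRing Matrix.linftyOpNormedAlgebra

/-- The Golden–Thompson inequality for real symmetric matrices. -/
theorem trace_exp_add_le {m : Type*} [Fintype m] [DecidableEq m] [Nonempty m]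
    (H K : Matrix m m ℝ) (hH : Hᵀ = H) (hK : Kᵀ = K) :
    (exp (H + K)).trace ≤ (exp H * exp K).trace := by
  -- The norm only serves to take the limit; nonemptiness of `m` gives the identity norm one.
  have : NormOneClass (Matrix m m ℝ) := Matrix.linfty_opNormOneClass
  have hlim := tendsto_exp_mul_exp_pow H K
  have htr : Continuous (Matrix.trace : Matrix m m ℝ → ℝ) := by fun_prop
  refine le_of_tendsto (htr.continuousAt.tendsto.comp hlim) (Eventually.of_forall fun k => ?_)
  have hs : ∀ M : Matrix m m ℝ, Mᵀ = M → (exp (((2 : ℝ) ^ k)⁻¹ • M))ᵀ = exp (((2 : ℝ) ^ k)⁻¹ • M) :=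
    fun M hM => by rw [← Matrix.exp_transpose, Matrix.transpose_smul, hM]
  have hp : ∀ M : Matrix m m ℝ, exp (((2 : ℝ) ^ k)⁻¹ • M) ^ 2 ^ k = exp M := fun M => by
    rw [← Matrix.exp_nsmul, ← Nat.cast_smul_eq_nsmul ℝ, smul_smul]
    simp
  refine ((trace_pow_two_pow_le k).2 _ _ (hs H hH) (hs K hK)).trans_eq ?_
  rw [hp, hp]

end GoldenThompson

end DPJohn

namespace DPJohn

/-! ### Spectral inequalities and a matrix Bernstein bound. -/

section MatrixBernstein

open NormedSpace

variable {m : Type*} [Fintype m] [DecidableEq m]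

theorem exists_orthogonal_diagonalization (A : Matrix m m ℝ) (hA : A.IsHermitian) :
    ∃ (U : Matrix m m ℝ) (l : m → ℝ), Uᵀ * U = 1 ∧ U * Uᵀ = 1 ∧ A = U * Matrix.diagonal l * Uᵀ ∧
      ∀ f : ℝ → ℝ, cfc f A = U * Matrix.diagonal (f ∘ l) * Uᵀ := by
  refine ⟨hA.eigenvectorUnitary, hA.eigenvalues, ?_, ?_, ?_, fun f => ?_⟩
  · exact Unitary.coe_star_mul_self hA.eigenvectorUnitary
  · exact Unitary.coe_mul_star_self hA.eigenvectorUnitary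
  · exact hA.spectral_theorem
  · rw [hA.cfc_eq f]; rfl

theorem exp_diagonalization {A U : Matrix m m ℝ} {l : m → ℝ} (hU' : U * Uᵀ = 1)
    (hA : A = U * Matrix.diagonal l * Uᵀ) :
    exp A = U * Matrix.diagonal (fun i => Real.exp (l i)) * Uᵀ := by
  have hinv : U⁻¹ = Uᵀ := Matrix.inv_eq_right_inv hU'
  have hunit : IsUnit U := IsUnit.of_mul_eq_one _ hU'
  rw [hA, ← hinv, Matrix.exp_conj U _ hunit, Matrix.exp_diagonal]
  congr 3
  ext i
  rw [Pi.coe_exp, Real.exp_eq_exp_ℝ]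

theorem posSemidef_conj_diagonal (U : Matrix m m ℝ) {l : m → ℝ} (hl : ∀ i, 0 ≤ l i) :
    (U * Matrix.diagonal l * Uᵀ).PosSemidef := by
  have := (Matrix.PosSemidef.diagonal (d := l) hl).mul_mul_conjTranspose_same U
  rwa [Matrix.conjTranspose_eq_transpose_of_trivial] at this

theorem posSemidef_exp {A : Matrix m m ℝ} (hA : A.IsHermitian) : (exp A).PosSemidef := by
  obtain ⟨U, l, -, hU', h, -⟩ := exists_orthogonal_diagonalization A hA
  rw [exp_diagonalization hU' h]
  exact posSemidef_conj_diagonal U fun i => (Real.exp_pos _).le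

/-- In an eigenbasis of A, the trace is a sum of eigenvalues of A times diagonal entries of the
rotated B, all nonnegative. -/
theorem trace_mul_nonneg {A B : Matrix m m ℝ} (hA : A.PosSemidef) (hB : B.PosSemidef) :
    0 ≤ (A * B).trace := by
  obtain ⟨U, l, hU, hU', h, -⟩ := exists_orthogonal_diagonalization A hA.1
  have hl : ∀ i, 0 ≤ l i := fun i => by
    have := (hA.conjTranspose_mul_mul_same U).diag_nonneg (i := i)
    rwa [Matrix.conjTranspose_eq_transpose_of_trivial, h,
      show Uᵀ * (U * Matrix.diagonal l * Uᵀ) * U = (Uᵀ * U) * Matrix.diagonal l * (Uᵀ * U) by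
        simp only [mul_assoc], hU, one_mul, mul_one, Matrix.diagonal_apply_eq] at this
  have e : (A * B).trace = ∑ i, l i * (Uᵀ * B * U) i i := by
    rw [h, show U * Matrix.diagonal l * Uᵀ * B = U * (Matrix.diagonal l * (Uᵀ * B)) by
      simp only [mul_assoc], Matrix.trace_mul_comm, mul_assoc]
    simp only [Matrix.trace, Matrix.diag_apply, Matrix.diagonal_mul]
  rw [e]
  refine Finset.sum_nonneg fun i _ => mul_nonneg (hl i) ?_
  have := (hB.conjTranspose_mul_mul_same U).diag_nonneg (i := i)
  rwa [Matrix.conjTranspose_eq_transpose_of_trivial] at this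

theorem real_exp_le_one_add_add_sq {x : ℝ} (hx : x ≤ 1) : Real.exp x ≤ 1 + x + x ^ 2 := by
  rcases le_or_gt (-1) x with h | h
  · have := Real.abs_exp_sub_one_sub_id_le (x := x) (abs_le.2 ⟨h, hx⟩)
    linarith [le_abs_self (Real.exp x - 1 - x)]
  · have : Real.exp x ≤ 1 := Real.exp_le_one_iff.2 (by linarith)
    nlinarith

/-- The scalar inequality e^x ≤ 1 + x + x² is applied to each eigenvalue. It holds for all x ≤ 1, so
no lower bound on Y is required. -/
theorem posSemidef_one_add_add_sq_sub_exp {Y : Matrix m m ℝ} (hY : Y.IsHermitian)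
    (h1 : (1 - Y).PosSemidef) : (1 + Y + Y ^ 2 - exp Y).PosSemidef := by
  obtain ⟨U, l, hU, hU', h, -⟩ := exists_orthogonal_diagonalization Y hY
  have hl : ∀ i, l i ≤ 1 := fun i => by
    have := (h1.conjTranspose_mul_mul_same U).diag_nonneg (i := i)
    rw [Matrix.conjTranspose_eq_transpose_of_trivial, h,
      show Uᵀ * (1 - U * Matrix.diagonal l * Uᵀ) * U
          = Uᵀ * U - (Uᵀ * U) * Matrix.diagonal l * (Uᵀ * U) by noncomm_ring, hU, one_mul, mul_one,
      Matrix.sub_apply, Matrix.one_apply_eq, Matrix.diagonal_apply_eq] at this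
    linarith
  have e : 1 + Y + Y ^ 2 - exp Y
      = U * Matrix.diagonal (fun i => 1 + l i + l i ^ 2 - Real.exp (l i)) * Uᵀ := by
    have e1 : Y ^ 2 = U * (Matrix.diagonal l * Matrix.diagonal l) * Uᵀ := by
      rw [h, pow_two, show U * Matrix.diagonal l * Uᵀ * (U * Matrix.diagonal l * Uᵀ)
        = U * Matrix.diagonal l * (Uᵀ * U) * Matrix.diagonal l * Uᵀ by simp only [mul_assoc], hU]
      simp only [mul_assoc, mul_one]
    have e2 : Matrix.diagonal (fun i => 1 + l i + l i ^ 2 - Real.exp (l i))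
        = 1 + Matrix.diagonal l + Matrix.diagonal l * Matrix.diagonal l
          - Matrix.diagonal (fun i => Real.exp (l i)) := by
      rw [Matrix.diagonal_mul_diagonal, ← Matrix.diagonal_one, Matrix.diagonal_add,
        Matrix.diagonal_add, Matrix.diagonal_sub]
      simp only [pow_two]
    rw [e1, exp_diagonalization hU' h, e2, h]
    simp only [mul_add, mul_sub, add_mul, sub_mul, mul_one, hU']
  rw [e]
  exact posSemidef_conj_diagonal U fun i => by linarith [real_exp_le_one_add_add_sq (hl i)]

/-- If all eigenvalues were at most c, then c - H would be positive semidefinite, against the choice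
of x. So some eigenvalue exceeds c, and its exponential is one term of the trace. -/
theorem exp_le_trace_exp {H : Matrix m m ℝ} (hH : H.IsHermitian) {c : ℝ} {x : m → ℝ}
    (hx : c * (x ⬝ᵥ x) < x ⬝ᵥ (H *ᵥ x)) : Real.exp c ≤ (exp H).trace := by
  obtain ⟨U, l, hU, hU', h, -⟩ := exists_orthogonal_diagonalization H hH
  have hex : ∃ i, c < l i := by
    by_contra! hcon
    have e : c • (1 : Matrix m m ℝ) - H = U * Matrix.diagonal (fun i => c - l i) * Uᵀ := by
      have : Matrix.diagonal (fun i => c - l i) = c • (1 : Matrix m m ℝ) - Matrix.diagonal l := by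
        rw [Matrix.smul_one_eq_diagonal, Matrix.diagonal_sub]
      rw [this, h]
      simp only [mul_sub, sub_mul, mul_smul_comm, smul_mul_assoc, mul_one, hU']
    have hp : (c • (1 : Matrix m m ℝ) - H).PosSemidef :=
      e ▸ posSemidef_conj_diagonal U fun i => by linarith [hcon i]
    have := hp.dotProduct_mulVec_nonneg x
    simp only [star_trivial, Matrix.sub_mulVec, Matrix.smul_mulVec, Matrix.one_mulVec,
      dotProduct_sub, dotProduct_smul, smul_eq_mul] at this
    linarith
  obtain ⟨i, hi⟩ := hex
  have e : (exp H).trace = ∑ i, Real.exp (l i) := by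
    rw [exp_diagonalization hU' h, mul_assoc, Matrix.trace_mul_comm, mul_assoc, hU, mul_one,
      Matrix.trace_diagonal]
  rw [e]
  exact (Real.exp_le_exp.2 hi.le).trans
    (Finset.single_le_sum (f := fun i => Real.exp (l i)) (fun i _ => (Real.exp_pos _).le)
      (Finset.mem_univ i))

variable {α : Type*} [Fintype α]

theorem isHermitian_sum {k ι : Type*} (s : Finset ι) {Y : ι → Matrix k k ℝ}
    (hY : ∀ i, (Y i).IsHermitian) : (∑ i ∈ s, Y i).IsHermitian := by
  rw [Matrix.IsHermitian, Matrix.conjTranspose_sum]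
  exact Finset.sum_congr rfl fun i _ => hY i

theorem posSemidef_smul {k : Type*} {A : Matrix k k ℝ} (hA : A.PosSemidef) {c : ℝ} (hc : 0 ≤ c) :
    (c • A).PosSemidef := hA.smul hc

/-- The sum over f is an expectation over N independent draws. Golden–Thompson separates one draw
from the others, and the mean of its exponential is at most e^V times the identity, so each draw
costs a factor e^V. -/
theorem sum_prod_trace_exp_le [Nonempty m] (p : α → ℝ) (hp : ∀ i, 0 ≤ p i) (hp1 : ∑ i, p i = 1)
    (Y : α → Matrix m m ℝ) (hY : ∀ i, (Y i).IsHermitian) (hmean : ∑ i, p i • Y i = 0)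
    (hone : ∀ i, (1 - Y i).PosSemidef) (V : ℝ)
    (hV : (V • (1 : Matrix m m ℝ) - ∑ i, p i • Y i ^ 2).PosSemidef) (N : ℕ) :
    ∑ f : Fin N → α, (∏ t, p (f t)) * (exp (∑ t, Y (f t))).trace
      ≤ Fintype.card m * Real.exp (V * N) := by
  -- In the semidefinite order, E exp Y ≤ 1 + E Y + E Y² ≤ 1 + V ≤ e^V.
  have hcV : (Real.exp V • (1 : Matrix m m ℝ) - ∑ i, p i • exp (Y i)).PosSemidef := by
    have h1 : (∑ i, p i • (1 + Y i + Y i ^ 2 - exp (Y i))).PosSemidef :=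
      Matrix.posSemidef_sum _ fun i _ =>
        posSemidef_smul (posSemidef_one_add_add_sq_sub_exp (hY i) (hone i)) (hp i)
    have h2 : ((Real.exp V - (1 + V)) • (1 : Matrix m m ℝ)).PosSemidef :=
      posSemidef_smul Matrix.PosSemidef.one (by linarith [Real.add_one_le_exp V])
    have e : Real.exp V • (1 : Matrix m m ℝ) - ∑ i, p i • exp (Y i)
        = ∑ i, p i • (1 + Y i + Y i ^ 2 - exp (Y i)) + (V • (1 : Matrix m m ℝ)
          - ∑ i, p i • Y i ^ 2) + (Real.exp V - (1 + V)) • (1 : Matrix m m ℝ) := by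
      simp only [smul_add, smul_sub, Finset.sum_add_distrib, Finset.sum_sub_distrib, hmean,
        ← Finset.sum_smul, hp1, sub_smul, add_smul, one_smul]
      abel
    rw [e]
    exact (h1.add hV).add h2
  induction N with
  | zero => simp [exp_zero, Matrix.trace_one]
  | succ N ih =>
    have step : ∀ f : Fin N → α, ∑ a, p a * (exp (∑ t, Y (f t) + Y a)).trace
        ≤ Real.exp V * (exp (∑ t, Y (f t))).trace := fun f => by
      have hS : (∑ t, Y (f t)).IsHermitian := isHermitian_sum _ fun t => hY (f t)
      have h0 := trace_mul_nonneg (posSemidef_exp hS) hcV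
      have e0 : (exp (∑ t, Y (f t)) * (Real.exp V • (1 : Matrix m m ℝ) - ∑ i, p i • exp (Y i))).trace
          = Real.exp V * (exp (∑ t, Y (f t))).trace
            - ∑ i, p i * (exp (∑ t, Y (f t)) * exp (Y i)).trace := by
        simp only [mul_sub, Matrix.trace_sub, mul_smul_comm, mul_one, Matrix.trace_smul,
          smul_eq_mul, Finset.mul_sum, Matrix.trace_sum]
      rw [e0] at h0
      refine le_trans (Finset.sum_le_sum fun a _ => ?_) (sub_nonneg.1 h0)
      refine mul_le_mul_of_nonneg_left ?_ (hp a)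
      refine trace_exp_add_le _ _ ?_ ?_
      · rw [← Matrix.conjTranspose_eq_transpose_of_trivial]; exact hS
      · rw [← Matrix.conjTranspose_eq_transpose_of_trivial]; exact hY a
    rw [← (Fin.consEquiv fun _ => α).sum_comp, Fintype.sum_prod_type_right]
    calc _ = ∑ f : Fin N → α, (∏ t, p (f t)) * ∑ a, p a * (exp (∑ t, Y (f t) + Y a)).trace := by
          refine Finset.sum_congr rfl fun f _ => ?_
          rw [Finset.mul_sum]
          refine Finset.sum_congr rfl fun a _ => ?_
          simp only [Fin.consEquiv_apply, Fin.prod_univ_succ, Fin.sum_univ_succ, Fin.cons_zero,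
            Fin.cons_succ]
          rw [add_comm (Y a)]; ring
      _ ≤ ∑ f : Fin N → α, (∏ t, p (f t)) * (Real.exp V * (exp (∑ t, Y (f t))).trace) :=
          Finset.sum_le_sum fun f _ =>
            mul_le_mul_of_nonneg_left (step f) (Finset.prod_nonneg fun t _ => hp _)
      _ = Real.exp V * ∑ f : Fin N → α, (∏ t, p (f t)) * (exp (∑ t, Y (f t))).trace := by
          rw [Finset.mul_sum]; exact Finset.sum_congr rfl fun f _ => by ring
      _ ≤ Real.exp V * (Fintype.card m * Real.exp (V * N)) :=
          mul_le_mul_of_nonneg_left ih (Real.exp_pos _).le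
      _ = _ := by push_cast; rw [mul_add, Real.exp_add, mul_one]; ring

open Classical in
/-- A matrix Bernstein inequality for independent draws from a finite set. -/
theorem sum_prod_exists_quadForm_gt_le [Nonempty m] (p : α → ℝ) (hp : ∀ i, 0 ≤ p i)
    (hp1 : ∑ i, p i = 1) (Y : α → Matrix m m ℝ) (hY : ∀ i, (Y i).IsHermitian)
    (hmean : ∑ i, p i • Y i = 0) (θ : ℝ) (hθ : 0 < θ)
    (hone : ∀ i, (1 - θ • Y i).PosSemidef) (V : ℝ)
    (hV : (V • (1 : Matrix m m ℝ) - ∑ i, p i • Y i ^ 2).PosSemidef) (N : ℕ) (c : ℝ) :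
    ∑ f : Fin N → α, (if ∃ x : m → ℝ, c * (x ⬝ᵥ x) < x ⬝ᵥ ((∑ t, Y (f t)) *ᵥ x)
      then ∏ t, p (f t) else 0) ≤ Fintype.card m * Real.exp (θ ^ 2 * V * N - θ * c) := by
  have h := sum_prod_trace_exp_le p hp hp1 (fun i => θ • Y i)
    (fun i => by rw [Matrix.IsHermitian, Matrix.conjTranspose_smul, star_trivial, hY i])
    (by simp only [smul_comm _ θ, ← Finset.smul_sum, hmean, smul_zero]) hone (θ ^ 2 * V)
    (by
      have := posSemidef_smul hV (sq_nonneg θ)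
      rw [smul_sub, smul_smul, Finset.smul_sum] at this
      simpa only [smul_pow, smul_comm _ (θ ^ 2)] using this) N
  -- Markov's inequality: on the event, e^{θc} is at most the trace of the exponential of θ ∑ Y; off
  -- it, that trace is nonnegative.
  rw [sub_eq_add_neg, Real.exp_add, ← mul_assoc, Real.exp_neg, ← div_eq_mul_inv,
    le_div_iff₀ (Real.exp_pos _), Finset.sum_mul]
  refine le_trans (Finset.sum_le_sum fun f _ => ?_) h
  have hprod : 0 ≤ ∏ t, p (f t) := Finset.prod_nonneg fun t _ => hp _
  have hS : (∑ t, θ • Y (f t)).IsHermitian := isHermitian_sum _ fun t => by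
    rw [Matrix.IsHermitian, Matrix.conjTranspose_smul, star_trivial, hY]
  split_ifs with hx
  · obtain ⟨x, hx⟩ := hx
    refine mul_le_mul_of_nonneg_left (exp_le_trace_exp hS (x := x) ?_) hprod
    rw [← Finset.smul_sum, Matrix.smul_mulVec, dotProduct_smul, smul_eq_mul, mul_assoc]
    exact mul_lt_mul_of_pos_left hx hθ
  · rw [zero_mul]
    exact mul_nonneg hprod (posSemidef_exp hS).trace_nonneg

end MatrixBernstein

end DPJohn

namespace DPJohn

/-! ### Cauchy–Schwarz and inversion for quadratic forms. -/

section QuadraticForms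

variable {m : Type*} [Fintype m]

theorem dotProduct_mulVec_comm {P : Matrix m m ℝ} (hP : P.IsHermitian) (x y : m → ℝ) :
    x ⬝ᵥ (P *ᵥ y) = y ⬝ᵥ (P *ᵥ x) := by
  have hT : Pᵀ = P := by rw [← Matrix.conjTranspose_eq_transpose_of_trivial]; exact hP
  rw [Matrix.dotProduct_mulVec, ← Matrix.mulVec_transpose, hT, dotProduct_comm]

theorem mulVec_inv_mulVec [DecidableEq m] {P : Matrix m m ℝ} (hP : P.PosDef) (a : m → ℝ) :
    P *ᵥ (P⁻¹ *ᵥ a) = a := by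
  rw [Matrix.mulVec_mulVec, Matrix.mul_nonsing_inv _ hP.det_pos.ne'.isUnit, Matrix.one_mulVec]

/-- Cauchy–Schwarz between the norm of P and its dual norm, read off from the discriminant of the
nonnegative quadratic t ↦ ⟨x + ty, P(x + ty)⟩ with y = P⁻¹a. -/
theorem sq_dotProduct_le [DecidableEq m] {P : Matrix m m ℝ} (hP : P.PosDef) (a x : m → ℝ) :
    (a ⬝ᵥ x) ^ 2 ≤ (a ⬝ᵥ (P⁻¹ *ᵥ a)) * (x ⬝ᵥ (P *ᵥ x)) := by
  set y := P⁻¹ *ᵥ a with hy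
  have hPy : P *ᵥ y = a := mulVec_inv_mulVec hP a
  have h1 : a ⬝ᵥ x = x ⬝ᵥ (P *ᵥ y) := by rw [hPy, dotProduct_comm]
  have h2 : a ⬝ᵥ y = y ⬝ᵥ (P *ᵥ y) := by rw [hPy, dotProduct_comm]
  have h3 : y ⬝ᵥ (P *ᵥ x) = x ⬝ᵥ (P *ᵥ y) := dotProduct_mulVec_comm hP.1 y x
  have hd := discrim_le_zero (a := y ⬝ᵥ (P *ᵥ y)) (b := 2 * (x ⬝ᵥ (P *ᵥ y)))
    (c := x ⬝ᵥ (P *ᵥ x)) fun t => by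
      have := hP.posSemidef.dotProduct_mulVec_nonneg (x + t • y)
      simp only [star_trivial, Matrix.mulVec_add, Matrix.mulVec_smul, dotProduct_add,
        add_dotProduct, dotProduct_smul, smul_dotProduct, smul_eq_mul, h3] at this
      linarith
  rw [discrim] at hd
  rw [h1, h2]
  nlinarith

/-- Inversion reverses the semidefinite order. With x = Q⁻¹a one has a·x = ⟨x, Qx⟩, so
Cauchy–Schwarz gives (a·x)² ≤ ⟨a, P⁻¹a⟩ · c (a·x), and a·x cancels. -/
theorem dotProduct_inv_mulVec_le [DecidableEq m] {P Q : Matrix m m ℝ} (hP : P.PosDef) (hQ : Q.PosDef) {c : ℝ}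
    (h : ∀ x, x ⬝ᵥ (P *ᵥ x) ≤ c * (x ⬝ᵥ (Q *ᵥ x))) (a : m → ℝ) :
    a ⬝ᵥ (Q⁻¹ *ᵥ a) ≤ c * (a ⬝ᵥ (P⁻¹ *ᵥ a)) := by
  set x := Q⁻¹ *ᵥ a with hx
  have h1 := sq_dotProduct_le hP a x
  have h2 : a ⬝ᵥ x = x ⬝ᵥ (Q *ᵥ x) := by
    rw [hx, mulVec_inv_mulVec hQ, dotProduct_comm]
  have h3 : 0 ≤ a ⬝ᵥ (P⁻¹ *ᵥ a) := by simpa using hP.inv.posSemidef.dotProduct_mulVec_nonneg a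
  have h4 : 0 ≤ a ⬝ᵥ x := by rw [h2]; simpa using hQ.posSemidef.dotProduct_mulVec_nonneg x
  have h5 := mul_le_mul_of_nonneg_left (h x) h3
  rw [← h2] at h5
  rcases h4.eq_or_lt with h6 | h6
  -- The sign of c is not given; if a ≠ 0, evaluating the hypothesis at a itself rules out c < 0.
  · rw [← h6]
    by_contra! hc
    have h7 : c < 0 := by
      by_contra! h8; exact absurd (mul_nonneg h8 h3) (not_le.2 hc)
    by_cases ha : a = 0
    · subst ha; simp at hc
    · have h8 := h a
      have h9 : 0 ≤ a ⬝ᵥ (P *ᵥ a) := by simpa using hP.posSemidef.dotProduct_mulVec_nonneg a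
      have h10 : 0 < a ⬝ᵥ (Q *ᵥ a) := by simpa using hQ.dotProduct_mulVec_pos ha
      nlinarith
  · nlinarith

theorem invSqrt_mulVec_sq {d : ℕ} {M : Matrix (Fin d) (Fin d) ℝ} (hM : M.PosDef)
    (v : Fin d → ℝ) : (invSqrt M *ᵥ v) ⬝ᵥ (invSqrt M *ᵥ v) = v ⬝ᵥ (M⁻¹ *ᵥ v) := by
  obtain ⟨U, l, hU, hU', h, hf⟩ := exists_orthogonal_diagonalization M hM.1
  have hl : ∀ i, 0 < l i := fun i => by
    have hinj : Function.Injective U.mulVec := fun x y hxy => by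
      have := congrArg (Uᵀ *ᵥ ·) hxy
      simpa [Matrix.mulVec_mulVec, hU] using this
    have := (hM.conjTranspose_mul_mul_same (B := U) hinj).diag_pos (i := i)
    rwa [Matrix.conjTranspose_eq_transpose_of_trivial, h,
      show Uᵀ * (U * Matrix.diagonal l * Uᵀ) * U = (Uᵀ * U) * Matrix.diagonal l * (Uᵀ * U) by
        simp only [mul_assoc], hU, one_mul, mul_one, Matrix.diagonal_apply_eq] at this
  have hS : invSqrt M = U * Matrix.diagonal (fun i => (√(l i))⁻¹) * Uᵀ := hf _
  have hST : (invSqrt M)ᵀ = invSqrt M := by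
    rw [hS]; simp [Matrix.transpose_mul, mul_assoc]
  have hI : M⁻¹ = invSqrt M * invSqrt M := by
    refine Matrix.inv_eq_right_inv ?_
    have e : M * (invSqrt M * invSqrt M) = U * (Matrix.diagonal l *
        Matrix.diagonal (fun i => (√(l i))⁻¹) * Matrix.diagonal (fun i => (√(l i))⁻¹)) * Uᵀ := by
      rw [hS, h]
      calc _ = U * Matrix.diagonal l * (Uᵀ * U) * Matrix.diagonal (fun i => (√(l i))⁻¹) * (Uᵀ * U)
            * Matrix.diagonal (fun i => (√(l i))⁻¹) * Uᵀ := by simp only [mul_assoc]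
        _ = _ := by rw [hU]; simp only [mul_assoc, one_mul]
    rw [e, Matrix.diagonal_mul_diagonal, Matrix.diagonal_mul_diagonal]
    have : (fun i => l i * (√(l i))⁻¹ * (√(l i))⁻¹) = fun _ => 1 := by
      funext i
      have := Real.sqrt_pos.2 (hl i)
      field_simp
      rw [Real.sq_sqrt (hl i).le]
    rw [this, Matrix.diagonal_one, mul_one, hU']
  rw [hI, ← Matrix.mulVec_mulVec]
  conv_rhs => rw [Matrix.dotProduct_mulVec, ← Matrix.mulVec_transpose, hST]

end QuadraticForms

/-! ### Gram matrices, leverage scores and the averaging inequality. -/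

section Gram

variable {n d : ℕ} {A : Matrix (Fin n) (Fin d) ℝ}

theorem dotProduct_gram_mulVec (w : Fin n → ℝ) (x : Fin d → ℝ) :
    x ⬝ᵥ (gram A w *ᵥ x) = ∑ i, w i * (A i ⬝ᵥ x) ^ 2 := by
  rw [gram, Matrix.mul_assoc, ← Matrix.mulVec_mulVec, ← Matrix.mulVec_mulVec, Matrix.dotProduct_mulVec,
    Matrix.vecMul_transpose]
  simp only [dotProduct, Matrix.mulVec_diagonal]
  refine Finset.sum_congr rfl fun i _ => ?_
  simp only [Matrix.mulVec, dotProduct]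
  ring

theorem isHermitian_gram (w : Fin n → ℝ) : (gram A w).IsHermitian := by
  rw [Matrix.IsHermitian, Matrix.conjTranspose_eq_transpose_of_trivial, gram]
  simp [Matrix.transpose_mul, Matrix.mul_assoc]

/-- Nonnegative weights that vanish at most on zero rows. -/
def Admissible (A : Matrix (Fin n) (Fin d) ℝ) (w : Fin n → ℝ) : Prop :=
  ∀ i, 0 ≤ w i ∧ (A i ≠ 0 → 0 < w i)

theorem mulVec_injective_of_rank_eq (hA : A.rank = d) : Function.Injective A.mulVec := by
  rw [← Matrix.coe_mulVecLin, ← LinearMap.ker_eq_bot]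
  have h := LinearMap.finrank_range_add_finrank_ker A.mulVecLin
  rw [← Matrix.rank, hA, Module.finrank_fin_fun] at h
  exact Submodule.finrank_eq_zero.1 (by omega)

/-- Zero rows contribute nothing to the form, so their weights may vanish. This matters because the
iteration gives them weight zero after one step. -/
theorem Admissible.posDef_gram (hA : A.rank = d) {w : Fin n → ℝ} (hw : Admissible A w) :
    (gram A w).PosDef := by
  refine Matrix.PosDef.of_dotProduct_mulVec_pos (isHermitian_gram w) fun x hx => ?_
  rw [star_trivial, dotProduct_gram_mulVec]
  refine Finset.sum_pos' (fun i _ => mul_nonneg (hw i).1 (sq_nonneg _)) ?_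
  by_contra! hcon
  refine hx (mulVec_injective_of_rank_eq hA ?_)
  rw [Matrix.mulVec_zero]
  funext i
  by_contra h0
  have h0' : A i ⬝ᵥ x ≠ 0 := h0
  have hi : A i ≠ 0 := fun h => h0' (by rw [h, zero_dotProduct])
  have := mul_pos ((hw i).2 hi) (sq_pos_of_ne_zero h0')
  exact absurd (hcon i (Finset.mem_univ i)) (not_le.2 this)

theorem h_nonneg {w : Fin n → ℝ} (hG : (gram A w).PosDef) (i : Fin n) : 0 ≤ h A w i := by
  simpa [h] using hG.inv.posSemidef.dotProduct_mulVec_nonneg (A i)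

theorem h_pos {w : Fin n → ℝ} (hG : (gram A w).PosDef) {i : Fin n} (hi : A i ≠ 0) :
    0 < h A w i := by
  simpa [h] using hG.inv.dotProduct_mulVec_pos hi

theorem h_eq_zero {w : Fin n → ℝ} {i : Fin n} (hi : A i = 0) : h A w i = 0 := by
  simp [h, hi]

/-- A leverage score is at most one: evaluate the Gram form at x = G⁻¹a_i, where it equals h, and
keep only the i-th summand w_i h². -/
theorem mul_h_le_one {w : Fin n → ℝ} (hw : ∀ i, 0 ≤ w i) (hG : (gram A w).PosDef) (i : Fin n) :
    w i * h A w i ≤ 1 := by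
  set x := (gram A w)⁻¹ *ᵥ A i with hx
  have h1 : h A w i = x ⬝ᵥ (gram A w *ᵥ x) := by
    rw [hx, mulVec_inv_mulVec hG, dotProduct_comm, h]
  have h2 : w i * (h A w i) ^ 2 ≤ h A w i := by
    conv_rhs => rw [h1, dotProduct_gram_mulVec]
    exact Finset.single_le_sum (f := fun j => w j * (A j ⬝ᵥ x) ^ 2)
      (fun j _ => mul_nonneg (hw j) (sq_nonneg _)) (Finset.mem_univ i)
  rcases (h_nonneg hG i).eq_or_lt with h3 | h3
  · rw [← h3]; norm_num
  · nlinarith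

/-- By cyclicity the sum is the trace of GG⁻¹. -/
theorem sum_mul_h {w : Fin n → ℝ} (hG : (gram A w).PosDef) : ∑ i, w i * h A w i = d := by
  have h1 : ∀ i, h A w i = (A * (gram A w)⁻¹ * Aᵀ) i i := fun i => by
    refine Eq.trans ?_ (congrFun (congrFun (Matrix.mul_assoc A (gram A w)⁻¹ Aᵀ) i) i).symm
    rw [Matrix.mul_apply]
    simp only [h, dotProduct, Matrix.mulVec, Matrix.mul_apply, Matrix.transpose_apply]
  have h2 : ∑ i, w i * h A w i = (Matrix.diagonal w * (A * (gram A w)⁻¹ * Aᵀ)).trace := by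
    simp [Matrix.trace, Matrix.diagonal_mul, h1]
  rw [h2, ← Matrix.mul_assoc, Matrix.trace_mul_comm, ← Matrix.mul_assoc, ← Matrix.mul_assoc,
    show Aᵀ * Matrix.diagonal w * A = gram A w from rfl,
    Matrix.mul_nonsing_inv _ hG.det_pos.ne'.isUnit, Matrix.trace_one, Fintype.card_fin]

theorem scaledRows_apply (w : Fin n → ℝ) (i : Fin n) : scaledRows A w i = √(w i) • A i := by
  ext j; simp [scaledRows, Matrix.diagonal_mul]

theorem transpose_scaledRows_mul (w e : Fin n → ℝ) (hw : ∀ i, 0 ≤ w i) :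
    (scaledRows A w)ᵀ * Matrix.diagonal e * scaledRows A w = gram A fun i => w i * e i := by
  rw [scaledRows, gram, Matrix.transpose_mul, Matrix.diagonal_transpose]
  calc _ = Aᵀ * (Matrix.diagonal (fun i => √(w i)) * Matrix.diagonal e *
        Matrix.diagonal (fun i => √(w i))) * A := by simp only [Matrix.mul_assoc]
    _ = _ := by
      rw [Matrix.diagonal_mul_diagonal, Matrix.diagonal_mul_diagonal]
      congr 3
      funext i
      rw [mul_right_comm, Real.mul_self_sqrt (hw i)]

theorem leverageScore_scaledRows {w : Fin n → ℝ} (hw : ∀ i, 0 ≤ w i) (i : Fin n) :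
    leverageScore (scaledRows A w) i = w i * h A w i := by
  have h1 : (scaledRows A w)ᵀ * scaledRows A w = gram A w := by
    have := transpose_scaledRows_mul (A := A) w (fun _ => 1) hw
    simpa using this
  rw [leverageScore, h1]
  refine (congrFun (congrFun (Matrix.mul_assoc (scaledRows A w) (gram A w)⁻¹
    (scaledRows A w)ᵀ) i) i).trans ?_
  rw [Matrix.mul_apply]
  have h2 : ∑ j, scaledRows A w i j * ((gram A w)⁻¹ * (scaledRows A w)ᵀ) j i
      = scaledRows A w i ⬝ᵥ ((gram A w)⁻¹ *ᵥ scaledRows A w i) := by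
    simp only [dotProduct, Matrix.mulVec, Matrix.mul_apply, Matrix.transpose_apply]
  rw [h2, scaledRows_apply, Matrix.mulVec_smul, smul_dotProduct, dotProduct_smul, smul_eq_mul,
    smul_eq_mul, ← mul_assoc, Real.mul_self_sqrt (hw i), h]

/-- No condition on c or on invertibility is needed, because the inverse of a singular matrix and of
the scalar 0 are both zero by convention. -/
theorem h_smul (c : ℝ) (w : Fin n → ℝ) (i : Fin n) :
    h A (fun j => c * w j) i = c⁻¹ * h A w i := by
  have hg : gram A (fun j => c * w j) = c • gram A w := by
    have : Matrix.diagonal (fun j => c * w j) = c • Matrix.diagonal w := by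
      ext a b; by_cases hab : a = b <;> simp [hab]
    rw [gram, this, gram, Matrix.mul_smul, Matrix.smul_mul]
  rcases eq_or_ne c 0 with rfl | hc
  · rw [h, hg]; simp
  · by_cases hdet : IsUnit (gram A w).det
    · have : (c • gram A w)⁻¹ = c⁻¹ • (gram A w)⁻¹ := by
        refine Matrix.inv_eq_right_inv ?_
        rw [smul_mul_smul_comm, mul_inv_cancel₀ hc, one_smul, Matrix.mul_nonsing_inv _ hdet]
      rw [h, hg, this, Matrix.smul_mulVec, dotProduct_smul, smul_eq_mul, h]
    · have h2 : ¬ IsUnit (c • gram A w).det := by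
        rw [Matrix.det_smul, isUnit_iff_ne_zero] at *
        simp only [ne_eq, not_not] at hdet ⊢
        rw [hdet, mul_zero]
      rw [h, h, hg, Matrix.nonsing_inv_apply_not_isUnit _ h2,
        Matrix.nonsing_inv_apply_not_isUnit _ hdet]
      simp

/-- Log-convexity of h without logarithms. Let G be the Gram matrix of the average, x = G⁻¹a_i and H
= a_i·x. Cauchy–Schwarz for each G_k gives H / h_k ≤ ⟨x, G_k x⟩ / H, and t ≤ e^{t-1} bounds the
right side by an exponential. The values ⟨x, G_k x⟩ average to H, so the exponents sum to zero and ∏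
(H / h_k) ≤ 1. -/
theorem h_average_pow_le (hA : A.rank = d) {T : ℕ} (hT : 0 < T) (w : ℕ → Fin n → ℝ)
    (hw : ∀ k < T, Admissible A (w k)) (i : Fin n) :
    Admissible A (fun j => 1 / (T : ℝ) * ∑ k ∈ Finset.range T, w k j) ∧
    h A (fun j => 1 / (T : ℝ) * ∑ k ∈ Finset.range T, w k j) i ^ T
      ≤ ∏ k ∈ Finset.range T, h A (w k) i := by
  have hTpos : (0 : ℝ) < T := by exact_mod_cast hT
  set u : Fin n → ℝ := fun j => 1 / (T : ℝ) * ∑ k ∈ Finset.range T, w k j with hu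
  have hadm : Admissible A u := fun j => by
    refine ⟨mul_nonneg (by positivity) (Finset.sum_nonneg fun k hk =>
      (hw k (Finset.mem_range.1 hk) j).1), fun hj => mul_pos (by positivity)
        (Finset.sum_pos (fun k hk => (hw k (Finset.mem_range.1 hk) j).2 hj) ?_)⟩
    exact Finset.nonempty_range_iff.2 hT.ne'
  refine ⟨hadm, ?_⟩
  have hG := hadm.posDef_gram hA
  by_cases hi : A i = 0
  · rw [h_eq_zero hi, zero_pow hT.ne']
    exact Finset.prod_nonneg fun k hk => h_nonneg ((hw k (Finset.mem_range.1 hk)).posDef_gram hA) i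
  set x := (gram A u)⁻¹ *ᵥ A i with hx
  set H := h A u i with hH
  have hHpos : 0 < H := h_pos hG hi
  have hHx : H = x ⬝ᵥ (gram A u *ᵥ x) := by
    rw [hx, mulVec_inv_mulVec hG, dotProduct_comm, hH, h]
  have hsum : T * H = ∑ k ∈ Finset.range T, x ⬝ᵥ (gram A (w k) *ᵥ x) := by
    rw [hHx]
    simp only [dotProduct_gram_mulVec, hu]
    rw [Finset.sum_comm, Finset.mul_sum]
    refine Finset.sum_congr rfl fun j _ => ?_
    rw [← Finset.sum_mul]
    field_simp
  have h1 : ∏ k ∈ Finset.range T, (H / h A (w k) i) ≤ 1 := by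
    calc ∏ k ∈ Finset.range T, (H / h A (w k) i)
        ≤ ∏ k ∈ Finset.range T, Real.exp (x ⬝ᵥ (gram A (w k) *ᵥ x) / H - 1) := by
          refine Finset.prod_le_prod (fun k hk => ?_) fun k hk => ?_
          · exact div_nonneg hHpos.le (h_nonneg ((hw k (Finset.mem_range.1 hk)).posDef_gram hA) i)
          · have hGk := (hw k (Finset.mem_range.1 hk)).posDef_gram hA
            have hk' := h_pos hGk hi
            refine le_trans (b := x ⬝ᵥ (gram A (w k) *ᵥ x) / H) ?_
              (le_trans (le_of_eq ?_) (Real.add_one_le_exp _))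
            · rw [div_le_div_iff₀ hk' hHpos]
              have := sq_dotProduct_le hGk (A i) x
              have e : A i ⬝ᵥ x = H := rfl
              rw [e] at this
              rw [← pow_two, mul_comm]
              exact this
            · ring
      _ = 1 := by
          rw [← Real.exp_sum, Finset.sum_sub_distrib, ← Finset.sum_div, ← hsum]
          simp [hHpos.ne']
  rw [Finset.prod_div_distrib, Finset.prod_const, Finset.card_range, div_le_one] at h1
  · exact h1
  · exact Finset.prod_pos fun k hk => h_pos ((hw k (Finset.mem_range.1 hk)).posDef_gram hA) hi

end Gram

end DPJohn

namespace DPJohn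

/-! ### Exponential and inverse moments of a Gaussian sketch. -/

section GaussianSketch

/-- By independence the characteristic function factors into one-dimensional Gaussian ones, whose
variances add up. -/
theorem map_dotProduct_pi_gaussianReal {d : ℕ} (v : Fin d → ℝ) :
    (Measure.pi fun _ : Fin d => gaussianReal 0 1).map (fun x => x ⬝ᵥ v)
      = gaussianReal 0 (v ⬝ᵥ v).toNNReal := by
  have hmeas : Measurable fun x : Fin d → ℝ => x ⬝ᵥ v := by
    simp only [dotProduct]; fun_prop
  have : IsProbabilityMeasure ((Measure.pi fun _ : Fin d => gaussianReal 0 1).map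
      (fun x => x ⬝ᵥ v)) := Measure.isProbabilityMeasure_map hmeas.aemeasurable
  have hv : 0 ≤ v ⬝ᵥ v := by
    simp only [dotProduct]; exact Finset.sum_nonneg fun i _ => mul_self_nonneg _
  refine Measure.ext_of_charFun ?_
  ext t
  rw [charFun_apply_real, integral_map hmeas.aemeasurable
    (Measurable.aestronglyMeasurable (by fun_prop)), charFun_gaussianReal]
  have h1 : ∀ x : Fin d → ℝ, Complex.exp (t * ((x ⬝ᵥ v : ℝ) : ℂ) * Complex.I)
      = ∏ i, Complex.exp (((t * v i : ℝ) : ℂ) * (x i : ℂ) * Complex.I) := fun x => by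
    rw [← Complex.exp_sum]
    congr 1
    simp only [dotProduct, Complex.ofReal_sum, Complex.ofReal_mul, Finset.mul_sum, Finset.sum_mul]
    exact Finset.sum_congr rfl fun i _ => by ring
  simp_rw [h1]
  rw [integral_fintype_prod_eq_prod
    (f := fun i (x : ℝ) => Complex.exp (((t * v i : ℝ) : ℂ) * (x : ℂ) * Complex.I))]
  simp_rw [← charFun_apply_real, charFun_gaussianReal]
  rw [← Complex.exp_sum]
  congr 1
  have h2 : ((v ⬝ᵥ v).toNNReal : ℝ) = ∑ i, v i * v i := Real.coe_toNNReal _ hv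
  have h3 : (((v ⬝ᵥ v).toNNReal : ℝ) : ℂ) = ∑ i, (v i : ℂ) * v i := by
    rw [h2]; push_cast; rfl
  simp only [Complex.ofReal_zero, mul_zero, zero_mul, zero_sub, NNReal.coe_one, Complex.ofReal_one,
    one_mul, Finset.sum_neg_distrib]
  rw [h3, Finset.sum_mul, Finset.sum_div]
  congr 1
  exact Finset.sum_congr rfl fun i _ => by push_cast; ring

theorem integral_exp_mul_sq_gaussianReal {t : ℝ} (ht : 2 * t < 1) :
    ∫ x, Real.exp (t * x ^ 2) ∂(gaussianReal 0 1) = (1 - 2 * t) ^ (-(1 / 2) : ℝ) := by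
  rw [integral_gaussianReal_eq_integral_smul one_ne_zero]
  have h1 : ∀ x : ℝ, gaussianPDFReal 0 1 x • Real.exp (t * x ^ 2)
      = (√(2 * Real.pi))⁻¹ * Real.exp (-(1 / 2 - t) * x ^ 2) := fun x => by
    rw [gaussianPDFReal, smul_eq_mul, mul_assoc, ← Real.exp_add]
    simp only [NNReal.coe_one, mul_one, sub_zero]
    congr 2
    ring
  simp_rw [h1]
  rw [integral_const_mul, integral_gaussian, Real.rpow_neg (by linarith), ← Real.sqrt_eq_rpow]
  have hpi := Real.pi_pos
  have h2 : 0 < 1 - 2 * t := by linarith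
  rw [← Real.sqrt_inv, ← Real.sqrt_inv, ← Real.sqrt_mul (by positivity)]
  congr 1
  have : 1 / 2 - t ≠ 0 := by linarith
  field_simp

theorem integral_exp_mul_dotProduct_sq {d : ℕ} (v : Fin d → ℝ) {t : ℝ}
    (ht : 2 * (t * (v ⬝ᵥ v)) < 1) :
    ∫ x, Real.exp (t * (x ⬝ᵥ v) ^ 2) ∂(Measure.pi fun _ : Fin d => gaussianReal 0 1)
      = (1 - 2 * (t * (v ⬝ᵥ v))) ^ (-(1 / 2) : ℝ) := by
  have hmeas : Measurable fun x : Fin d → ℝ => x ⬝ᵥ v := by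
    simp only [dotProduct]; fun_prop
  have hv : 0 ≤ v ⬝ᵥ v := by
    simp only [dotProduct]; exact Finset.sum_nonneg fun i _ => mul_self_nonneg _
  have h1 := integral_map (μ := Measure.pi fun _ : Fin d => gaussianReal 0 1) hmeas.aemeasurable
    (f := fun y : ℝ => Real.exp (t * y ^ 2)) (Measurable.aestronglyMeasurable (by fun_prop))
  rw [← h1, map_dotProduct_pi_gaussianReal]
  have h2 : gaussianReal 0 (v ⬝ᵥ v).toNNReal
      = (gaussianReal 0 1).map (fun x => √(v ⬝ᵥ v) * x) := by
    rw [gaussianReal_map_const_mul]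
    congr 1
    · simp
    · ext
      simp only [Real.coe_toNNReal _ hv, mul_one, NNReal.coe_mk]
      exact (Real.sq_sqrt hv).symm
  rw [h2, integral_map (by fun_prop) (Measurable.aestronglyMeasurable (by fun_prop)),
    ← integral_exp_mul_sq_gaussianReal ht]
  refine integral_congr_ae (Filter.Eventually.of_forall fun x => ?_)
  simp only [mul_pow, Real.sq_sqrt hv, mul_assoc]

/-- The law of a sketching matrix with independent standard Gaussian entries. -/
noncomputable abbrev sketchLaw (s d : ℕ) : Measure (Fin s → Fin d → ℝ) :=
  Measure.pi fun _ : Fin s => Measure.pi fun _ : Fin d => gaussianReal 0 1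

/-- The squared Euclidean norm of `S v`. -/
def sketchSq {s d : ℕ} (S : Fin s → Fin d → ℝ) (v : Fin d → ℝ) : ℝ := ∑ j, (S j ⬝ᵥ v) ^ 2

theorem sketchSq_nonneg {s d : ℕ} (S : Fin s → Fin d → ℝ) (v : Fin d → ℝ) : 0 ≤ sketchSq S v :=
  Finset.sum_nonneg fun _ _ => sq_nonneg _

theorem measurable_sketchSq {s d : ℕ} (v : Fin d → ℝ) :
    Measurable fun S : Fin s → Fin d → ℝ => sketchSq S v := by
  simp only [sketchSq, dotProduct]; fun_prop

theorem lintegral_exp_mul_sketchSq {s d : ℕ} (v : Fin d → ℝ) {t : ℝ}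
    (ht : 2 * (t * (v ⬝ᵥ v)) < 1) :
    ∫⁻ S, ENNReal.ofReal (Real.exp (t * sketchSq S v)) ∂(sketchLaw s d)
      = ENNReal.ofReal ((1 - 2 * (t * (v ⬝ᵥ v))) ^ (-(s / 2) : ℝ)) := by
  have h0 : 0 < 1 - 2 * (t * (v ⬝ᵥ v)) := by linarith
  have h1 : ∫ S, Real.exp (t * sketchSq S v) ∂(sketchLaw s d)
      = (1 - 2 * (t * (v ⬝ᵥ v))) ^ (-(s / 2) : ℝ) := by
    simp only [sketchSq, Finset.mul_sum, Real.exp_sum]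
    rw [integral_fintype_prod_eq_prod (f := fun _ (x : Fin d → ℝ) => Real.exp (t * (x ⬝ᵥ v) ^ 2))]
    simp only [integral_exp_mul_dotProduct_sq v ht, Finset.prod_const, Finset.card_univ,
      Fintype.card_fin]
    rw [← Real.rpow_natCast, ← Real.rpow_mul h0.le]
    congr 1
    ring
  rw [← h1, ofReal_integral_eq_lintegral_ofReal]
  -- A non-integrable function has integral zero by convention, while the computed value is
  -- positive; integrability comes for free.
  · by_contra hni
    rw [integral_undef hni] at h1
    exact absurd h1 (Real.rpow_pos_of_pos h0 _).ne
  · exact Filter.Eventually.of_forall fun S => (Real.exp_pos _).le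

/-- An equality for y > 0. It is stated as an inequality so as to cover y = 0, where the left side
is zero by convention and the integral is infinite. -/
theorem ofReal_inv_le_lintegral_exp {y : ℝ} (hy : 0 ≤ y) :
    ENNReal.ofReal y⁻¹ ≤ ∫⁻ u in Set.Ioi (1 : ℝ), ENNReal.ofReal (Real.exp (-(u - 1) * y)) := by
  rcases hy.eq_or_lt with rfl | hy
  · simp
  have h1 : ∫ u in Set.Ioi (1 : ℝ), Real.exp (-(u - 1) * y) = y⁻¹ := by
    have : ∀ u : ℝ, Real.exp (-(u - 1) * y) = Real.exp y * Real.exp (-y * u) := fun u => by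
      rw [← Real.exp_add]; congr 1; ring
    simp_rw [this]
    rw [integral_const_mul, integral_exp_mul_Ioi (by linarith)]
    rw [mul_one, neg_div_neg_eq, mul_div_assoc', ← Real.exp_add]
    simp
  rw [← h1, ofReal_integral_eq_lintegral_ofReal]
  · by_contra hni
    rw [integral_undef hni] at h1
    exact absurd h1 (inv_pos.2 hy).ne
  · exact Filter.Eventually.of_forall fun S => (Real.exp_pos _).le

/-- The mean of an inverse chi-square variable. Write 1/y as the integral of e^{-(u-1)y} over u > 1
with y = ‖Sv‖² / (2‖v‖²) and exchange the integrals. The moment generating function turns the inner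
one into u^{-s/2}, whose integral is 2/(s-2). -/
theorem lintegral_inv_sketchSq_le {s d : ℕ} (hs : 2 < s) (v : Fin d → ℝ) (hv : 0 < v ⬝ᵥ v) :
    ∫⁻ S, ENNReal.ofReal (sketchSq S v)⁻¹ ∂(sketchLaw s d)
      ≤ ENNReal.ofReal (((s : ℝ) - 2)⁻¹ * (v ⬝ᵥ v)⁻¹) := by
  have hs' : (2 : ℝ) < s := by exact_mod_cast hs
  set q := v ⬝ᵥ v with hq
  have hscale : ∀ S : Fin s → Fin d → ℝ, ENNReal.ofReal (sketchSq S v)⁻¹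
      ≤ ENNReal.ofReal (2 * q)⁻¹ * ∫⁻ u in Set.Ioi (1 : ℝ),
        ENNReal.ofReal (Real.exp (-(u - 1) / (2 * q) * sketchSq S v)) := fun S => by
    have h := ofReal_inv_le_lintegral_exp (y := sketchSq S v / (2 * q))
      (div_nonneg (sketchSq_nonneg S v) (by positivity))
    have e : (sketchSq S v)⁻¹ = (2 * q)⁻¹ * (sketchSq S v / (2 * q))⁻¹ := by
      rw [inv_div, div_eq_mul_inv, ← mul_assoc, inv_mul_cancel₀ (by positivity), one_mul]
    rw [e, ENNReal.ofReal_mul (by positivity)]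
    refine mul_le_mul_right (h.trans_eq ?_) _
    refine lintegral_congr fun u => ?_
    congr 2; ring
  have hm2 : Measurable fun p : (Fin s → Fin d → ℝ) × ℝ =>
      ENNReal.ofReal (Real.exp (-(p.2 - 1) / (2 * q) * sketchSq p.1 v)) := by
    have : Measurable fun p : (Fin s → Fin d → ℝ) × ℝ => sketchSq p.1 v :=
      (measurable_sketchSq v).comp measurable_fst
    fun_prop
  have hconst : ∀ u ∈ Set.Ioi (1 : ℝ), ∫⁻ S, ENNReal.ofReal
      (Real.exp (-(u - 1) / (2 * q) * sketchSq S v)) ∂(sketchLaw s d)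
        = ENNReal.ofReal (u ^ (-(s / 2) : ℝ)) := fun u hu => by
    have e : 2 * (-(u - 1) / (2 * q) * (v ⬝ᵥ v)) = 1 - u := by
      rw [← hq]; field_simp; ring
    rw [lintegral_exp_mul_sketchSq v (by rw [e]; linarith [Set.mem_Ioi.1 hu]), e]
    congr 2; ring
  calc ∫⁻ S, ENNReal.ofReal (sketchSq S v)⁻¹ ∂(sketchLaw s d)
      ≤ ∫⁻ S, ENNReal.ofReal (2 * q)⁻¹ * (∫⁻ u in Set.Ioi (1 : ℝ),
        ENNReal.ofReal (Real.exp (-(u - 1) / (2 * q) * sketchSq S v))) ∂(sketchLaw s d) :=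
        lintegral_mono hscale
    _ = ENNReal.ofReal (2 * q)⁻¹ * ∫⁻ u in Set.Ioi (1 : ℝ), (∫⁻ S,
        ENNReal.ofReal (Real.exp (-(u - 1) / (2 * q) * sketchSq S v)) ∂(sketchLaw s d)) := by
        rw [lintegral_const_mul _ hm2.lintegral_prod_right, lintegral_lintegral_swap hm2.aemeasurable]
    _ = ENNReal.ofReal (2 * q)⁻¹ *
          ∫⁻ u in Set.Ioi (1 : ℝ), ENNReal.ofReal (u ^ (-(s / 2) : ℝ)) := by
        rw [setLIntegral_congr_fun measurableSet_Ioi hconst]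
    _ = ENNReal.ofReal (2 * q)⁻¹ * ENNReal.ofReal (∫ u in Set.Ioi (1 : ℝ), u ^ (-(s / 2) : ℝ)) := by
        rw [ofReal_integral_eq_lintegral_ofReal]
        · exact integrableOn_Ioi_rpow_of_lt (by linarith) one_pos
        · filter_upwards [ae_restrict_mem measurableSet_Ioi] with u hu
          exact Real.rpow_nonneg (by linarith [Set.mem_Ioi.1 hu]) _
    _ = _ := by
        rw [integral_Ioi_rpow_of_lt (by linarith) one_pos, Real.one_rpow,
          ← ENNReal.ofReal_mul (by positivity)]
        congr 1
        have : (-(s / 2) + 1 : ℝ) = -((s - 2) / 2) := by ring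
        rw [this]
        have : (s - 2 : ℝ) ≠ 0 := by linarith
        field_simp

/-- One row of S is enough: its product with v is a nondegenerate Gaussian, which has no atom at
zero. -/
theorem ae_sketchSq_pos {s d : ℕ} (hs : 0 < s) (v : Fin d → ℝ) (hv : 0 < v ⬝ᵥ v) :
    ∀ᵐ S ∂(sketchLaw s d), 0 < sketchSq S v := by
  have hmeas : Measurable fun x : Fin d → ℝ => x ⬝ᵥ v := by
    simp only [dotProduct]; fun_prop
  have h1 : ∀ᵐ x ∂(Measure.pi fun _ : Fin d => gaussianReal 0 1), x ⬝ᵥ v ≠ 0 := by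
    have h2 : ∀ᵐ y ∂((Measure.pi fun _ : Fin d => gaussianReal 0 1).map (fun x => x ⬝ᵥ v)),
        y ≠ (0 : ℝ) := by
      rw [map_dotProduct_pi_gaussianReal]
      have hne : (v ⬝ᵥ v).toNNReal ≠ 0 := (Real.toNNReal_pos.2 hv).ne'
      have := nullSingletonClass_gaussianReal (μ := 0) hne
      rw [ae_iff]
      simp
    exact ae_of_ae_map hmeas.aemeasurable h2
  have h3 := (Measure.quasiMeasurePreserving_eval
    (μ := fun _ : Fin s => Measure.pi fun _ : Fin d => gaussianReal 0 1) ⟨0, hs⟩).ae h1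
  filter_upwards [h3] with S hS
  exact Finset.sum_pos' (fun _ _ => sq_nonneg _) ⟨⟨0, hs⟩, Finset.mem_univ _, by positivity⟩

end GaussianSketch

/-! ### Moments of the truncated noise. -/

section TruncatedGaussian

theorem integral_sq_gaussianReal (σ : ℝ) :
    ∫ x, x ^ 2 ∂(gaussianReal 0 (Real.toNNReal (σ ^ 2))) = σ ^ 2 := by
  have h := variance_fun_id_gaussianReal (μ := 0) (v := Real.toNNReal (σ ^ 2))
  rw [variance_eq_integral (by fun_prop), integral_id_gaussianReal] at h
  simpa [Real.coe_toNNReal _ (sq_nonneg σ)] using h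

theorem integrable_sq_gaussianReal (v : NNReal) :
    Integrable (fun x : ℝ => x ^ 2) (gaussianReal 0 v) :=
  (memLp_id_gaussianReal' (μ := 0) (v := v) 2 (by simp)).integrable_sq

/-- Chebyshev: the mass outside the interval is at most 4σ² ≤ 1/2. Conditioning therefore at most
doubles the second moment. -/
theorem half_le_gaussianReal_Icc {σ : ℝ} (hσ1 : σ ^ 2 ≤ 1 / 8) :
    1 / 2 ≤ (gaussianReal 0 (Real.toNNReal (σ ^ 2))).real (Set.Icc (-1 / 2) (1 / 2)) := by
  set γ := gaussianReal 0 (Real.toNNReal (σ ^ 2))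
  have h1 : γ.real (Set.Icc (-1 / 2) (1 / 2))ᶜ ≤ 4 * σ ^ 2 := by
    rw [← integral_sq_gaussianReal σ, ← integral_const_mul, ← integral_indicator_one
      measurableSet_Icc.compl]
    refine integral_mono ((integrable_const 1).indicator measurableSet_Icc.compl)
      ((integrable_sq_gaussianReal _).const_mul 4) fun x => ?_
    by_cases hx : x ∈ (Set.Icc (-1 / 2 : ℝ) (1 / 2))ᶜ
    · rw [Set.indicator_of_mem hx]
      simp only [Set.mem_compl_iff, Set.mem_Icc, not_and_or, not_le] at hx
      simp only [Pi.one_apply]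
      rcases hx with hx | hx <;> nlinarith
    · rw [Set.indicator_of_notMem hx]; positivity
  have h2 := measureReal_compl (μ := γ) (measurableSet_Icc (a := (-1 / 2 : ℝ)) (b := 1 / 2))
  rw [h2, probReal_univ] at h1
  linarith

theorem isProbabilityMeasure_truncGaussian {σ : ℝ} (hσ1 : σ ^ 2 ≤ 1 / 8) :
    IsProbabilityMeasure (truncGaussian 0 σ) := by
  refine cond_isProbabilityMeasure fun h0 => ?_
  have h1 := half_le_gaussianReal_Icc hσ1
  rw [measureReal_def, h0] at h1
  norm_num at h1

theorem ae_mem_Icc_truncGaussian (σ : ℝ) :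
    ∀ᵐ z ∂(truncGaussian 0 σ), z ∈ Set.Icc (-1 / 2 : ℝ) (1 / 2) := by
  rw [truncGaussian, ProbabilityTheory.cond]
  exact Measure.ae_smul_measure (ae_restrict_mem measurableSet_Icc) _

theorem integral_id_truncGaussian (σ : ℝ) : ∫ z, z ∂(truncGaussian 0 σ) = 0 := by
  rw [truncGaussian, ProbabilityTheory.cond, integral_smul_measure]
  set γ := gaussianReal 0 (Real.toNNReal (σ ^ 2)) with hγ
  have h1 : γ.map (fun x => -x) = γ := by rw [hγ, gaussianReal_map_neg, neg_zero]
  have h2 : ∫ z in Set.Icc (-1 / 2 : ℝ) (1 / 2), z ∂γ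
      = ∫ z in Set.Icc (-1 / 2 : ℝ) (1 / 2), -z ∂γ := by
    have h3 := (MeasurableEquiv.neg ℝ).measurableEmbedding.setIntegral_map (μ := γ)
      (fun z => z) (Set.Icc (-1 / 2 : ℝ) (1 / 2))
    have h4 : (MeasurableEquiv.neg ℝ) ⁻¹' (Set.Icc (-1 / 2 : ℝ) (1 / 2))
        = Set.Icc (-1 / 2 : ℝ) (1 / 2) := by
      ext x
      have hx : (MeasurableEquiv.neg ℝ) x = -x := rfl
      simp only [Set.mem_preimage, hx, Set.mem_Icc]
      constructor <;> rintro ⟨a, b⟩ <;> constructor <;> linarith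
    rw [h4] at h3
    refine Eq.trans ?_ h3
    congr 2
    exact h1.symm
  rw [integral_neg] at h2
  have : ∫ z in Set.Icc (-1 / 2 : ℝ) (1 / 2), z ∂γ = 0 := by linarith
  rw [this, smul_zero]

theorem integral_sq_truncGaussian_le {σ : ℝ} (hσ1 : σ ^ 2 ≤ 1 / 8) :
    ∫ z, z ^ 2 ∂(truncGaussian 0 σ) ≤ 2 * σ ^ 2 := by
  rw [truncGaussian, ProbabilityTheory.cond, integral_smul_measure, ENNReal.toReal_inv,
    ← measureReal_def, smul_eq_mul]
  have h1 := half_le_gaussianReal_Icc hσ1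
  have h2 : ∫ z in Set.Icc (-1 / 2 : ℝ) (1 / 2), z ^ 2 ∂(gaussianReal 0 (Real.toNNReal (σ ^ 2)))
      ≤ σ ^ 2 := by
    refine (setIntegral_le_integral (integrable_sq_gaussianReal _)
      (Filter.Eventually.of_forall fun x => sq_nonneg x)).trans_eq (integral_sq_gaussianReal σ)
  rw [inv_mul_le_iff₀ (by linarith)]
  nlinarith [sq_nonneg σ]

/-- Symmetry kills the linear term of the quadratic majorant, so the noise costs only second order
in σ. -/
theorem lintegral_truncGaussian_le {σ : ℝ} (hσ1 : σ ^ 2 ≤ 1 / 8) (φ : ℝ → ℝ) (a b : ℝ)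
    (hb : 0 ≤ b)
    (hφ : ∀ z ∈ Set.Icc (-1 / 2 : ℝ) (1 / 2), 0 ≤ φ z ∧ φ z ≤ 1 + a * z + b * z ^ 2) :
    ∫⁻ z, ENNReal.ofReal (φ z) ∂(truncGaussian 0 σ) ≤ ENNReal.ofReal (1 + 2 * b * σ ^ 2) := by
  have := isProbabilityMeasure_truncGaussian hσ1
  have hae := ae_mem_Icc_truncGaussian σ
  have hi1 : Integrable (fun z : ℝ => z) (truncGaussian 0 σ) := by
    refine Integrable.of_bound (by fun_prop) 1 ?_
    filter_upwards [hae] with z hz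
    rw [Real.norm_eq_abs, abs_le]; constructor <;> linarith [hz.1, hz.2]
  have hi2 : Integrable (fun z : ℝ => z ^ 2) (truncGaussian 0 σ) := by
    refine Integrable.of_bound (by fun_prop) 1 ?_
    filter_upwards [hae] with z hz
    rw [Real.norm_of_nonneg (sq_nonneg z)]; nlinarith [hz.1, hz.2]
  have hi : Integrable (fun z : ℝ => 1 + a * z + b * z ^ 2) (truncGaussian 0 σ) :=
    ((integrable_const 1).add (hi1.const_mul a)).add (hi2.const_mul b)
  calc ∫⁻ z, ENNReal.ofReal (φ z) ∂(truncGaussian 0 σ)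
      ≤ ∫⁻ z, ENNReal.ofReal (1 + a * z + b * z ^ 2) ∂(truncGaussian 0 σ) := by
        refine lintegral_mono_ae ?_
        filter_upwards [hae] with z hz
        exact ENNReal.ofReal_le_ofReal (hφ z hz).2
    _ = ENNReal.ofReal (∫ z, (1 + a * z + b * z ^ 2) ∂(truncGaussian 0 σ)) := by
        rw [ofReal_integral_eq_lintegral_ofReal hi]
        filter_upwards [hae] with z hz
        exact (hφ z hz).1.trans (hφ z hz).2
    _ ≤ _ := by
        refine ENNReal.ofReal_le_ofReal ?_
        have e1 := integral_add ((integrable_const (μ := truncGaussian 0 σ) (1 : ℝ)).add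
          (hi1.const_mul a)) (hi2.const_mul b)
        have e2 := integral_add (integrable_const (μ := truncGaussian 0 σ) (1 : ℝ)) (hi1.const_mul a)
        simp only [Pi.add_apply] at e1
        rw [e1, e2, integral_const_mul, integral_const_mul, integral_id_truncGaussian]
        simp only [integral_const, probReal_univ, smul_eq_mul, mul_one, mul_zero,
          add_zero]
        nlinarith [integral_sq_truncGaussian_le hσ1]

end TruncatedGaussian
end DPJohn

namespace DPJohn

/-! ### Moments of the sketch combined with the noise. -/

section NoisySketch

/-- The law of the multiplicative noise. -/
noncomputable abbrev noiseLaw (n : ℕ) (σ : ℝ) : Measure (Fin n → ℝ) :=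
  Measure.pi fun _ : Fin n => truncGaussian 0 σ

theorem lintegral_eval_noiseLaw {n : ℕ} {σ : ℝ} (hσ : σ ^ 2 ≤ 1 / 8) (i : Fin n) {φ : ℝ → ENNReal}
    (hφ : Measurable φ) :
    ∫⁻ z, φ (z i) ∂(noiseLaw n σ) = ∫⁻ y, φ y ∂(truncGaussian 0 σ) := by
  have := isProbabilityMeasure_truncGaussian hσ
  exact (measurePreserving_eval (fun _ : Fin n => truncGaussian 0 σ) i).lintegral_comp hφ

theorem lintegral_inv_noisy_sketchSq_le {n d s : ℕ} (hs : 2 < s) {σ : ℝ} (hσ : σ ^ 2 ≤ 1 / 8)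
    (v : Fin d → ℝ) (hv : 0 < v ⬝ᵥ v) (i : Fin n) :
    ∫⁻ S, ∫⁻ z, ENNReal.ofReal (1 / (s : ℝ) * sketchSq S v * (1 + z i))⁻¹ ∂(noiseLaw n σ)
      ∂(sketchLaw s d)
      ≤ ENNReal.ofReal ((s : ℝ) / (s - 2) * (1 + 4 * σ ^ 2) * (v ⬝ᵥ v)⁻¹) := by
  have hs' : (2 : ℝ) < s := by exact_mod_cast hs
  have h1 : ∀ S : Fin s → Fin d → ℝ,
      ∫⁻ z, ENNReal.ofReal (1 / (s : ℝ) * sketchSq S v * (1 + z i))⁻¹ ∂(noiseLaw n σ)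
        ≤ ENNReal.ofReal (s * (1 + 4 * σ ^ 2)) * ENNReal.ofReal (sketchSq S v)⁻¹ := fun S => by
    have h2 : ∀ z : Fin n → ℝ, ENNReal.ofReal (1 / (s : ℝ) * sketchSq S v * (1 + z i))⁻¹
        = ENNReal.ofReal (s * (sketchSq S v)⁻¹) * ENNReal.ofReal (1 + z i)⁻¹ := fun z => by
      rw [← ENNReal.ofReal_mul (mul_nonneg (by positivity) (inv_nonneg.2 (sketchSq_nonneg S v)))]
      congr 1
      rw [mul_inv, mul_inv, one_div, inv_inv]
    simp_rw [h2]
    rw [lintegral_const_mul _ (by fun_prop),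
      lintegral_eval_noiseLaw hσ i (φ := fun y => ENNReal.ofReal (1 + y)⁻¹) (by fun_prop)]
    -- The majorant of 1/(1+z) is 1 - z + 2z²; multiplied by 1 + z it gives 1 + z²(1 + 2z), which is
    -- at least 1 for z ≥ -1/2.
    have h3 := lintegral_truncGaussian_le hσ (fun y => (1 + y)⁻¹) (-1) 2 (by norm_num)
      fun z hz => by
        have hz1 : 0 < 1 + z := by linarith [hz.1]
        refine ⟨inv_nonneg.2 hz1.le, ?_⟩
        rw [inv_le_iff_one_le_mul₀ hz1]
        nlinarith [sq_nonneg z, mul_nonneg (sq_nonneg z) (show 0 ≤ 1 + 2 * z by linarith [hz.1])]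
    calc _ ≤ ENNReal.ofReal (s * (sketchSq S v)⁻¹) * ENNReal.ofReal (1 + 2 * 2 * σ ^ 2) :=
          mul_le_mul_right h3 _
      _ = _ := by
          rw [← ENNReal.ofReal_mul (mul_nonneg (by positivity) (inv_nonneg.2 (sketchSq_nonneg S v))),
            ← ENNReal.ofReal_mul (by positivity)]
          congr 1; ring
  calc _ ≤ ∫⁻ S, ENNReal.ofReal (s * (1 + 4 * σ ^ 2)) * ENNReal.ofReal (sketchSq S v)⁻¹
        ∂(sketchLaw s d) := lintegral_mono h1
    _ = ENNReal.ofReal (s * (1 + 4 * σ ^ 2)) * ∫⁻ S, ENNReal.ofReal (sketchSq S v)⁻¹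
        ∂(sketchLaw s d) := by
        rw [lintegral_const_mul]
        exact (measurable_sketchSq v).inv.ennreal_ofReal
    _ ≤ ENNReal.ofReal (s * (1 + 4 * σ ^ 2)) * ENNReal.ofReal (((s : ℝ) - 2)⁻¹ * (v ⬝ᵥ v)⁻¹) :=
        mul_le_mul_right (lintegral_inv_sketchSq_le hs v hv) _
    _ = _ := by
        rw [← ENNReal.ofReal_mul (by positivity)]
        congr 1
        rw [div_eq_mul_inv]; ring

/-- This is -log(1-x) ≤ x + x² on [0, 1/2]. -/
theorem one_sub_rpow_neg_le {x r : ℝ} (hx0 : 0 ≤ x) (hx : x ≤ 1 / 2) (hr : 0 ≤ r) :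
    (1 - x) ^ (-r) ≤ Real.exp (r * (x + x ^ 2)) := by
  have h1 : Real.exp (-(x + x ^ 2)) ≤ 1 - x := by
    rw [Real.exp_neg, inv_le_comm₀ (Real.exp_pos _) (by linarith)]
    refine le_trans ?_ (Real.quadratic_le_exp_of_nonneg (x := x + x ^ 2) (by positivity))
    rw [inv_le_iff_one_le_mul₀ (by linarith)]
    have h2 : 0 ≤ x ^ 2 * (1 - x - x ^ 2 - x ^ 3) := by
      refine mul_nonneg (sq_nonneg _) ?_
      nlinarith [sq_nonneg x, mul_nonneg hx0 (sq_nonneg x)]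
    nlinarith
  calc (1 - x) ^ (-r) ≤ Real.exp (-(x + x ^ 2)) ^ (-r) :=
        Real.rpow_le_rpow_of_nonpos (Real.exp_pos _) h1 (by linarith)
    _ = _ := by rw [← Real.exp_mul]; congr 1; ring

theorem lintegral_exp_noisy_sketchSq_le {n d s : ℕ} {σ : ℝ} (hσ : σ ^ 2 ≤ 1 / 8)
    {a : ℝ} (ha0 : 0 ≤ a) (ha1 : a ≤ 1) (hs : 6 ≤ s)
    (v : Fin d → ℝ) (i : Fin n) :
    ∫⁻ z, ∫⁻ S, ENNReal.ofReal (Real.exp (a * (1 / (s : ℝ) * (sketchSq S v / (v ⬝ᵥ v)) * (1 + z i))))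
      ∂(sketchLaw s d) ∂(noiseLaw n σ)
      ≤ ENNReal.ofReal (Real.exp (a + 5 * a ^ 2 / s + 2 * a ^ 2 * σ ^ 2)) := by
  have hs' : (6 : ℝ) ≤ s := by exact_mod_cast hs
  have := isProbabilityMeasure_truncGaussian hσ
  have hv : 0 ≤ v ⬝ᵥ v := by
    simp only [dotProduct]; exact Finset.sum_nonneg fun i _ => mul_self_nonneg _
  rcases hv.eq_or_lt with h0 | hv
  -- For v = 0 the quotient is zero by convention and the integrand is 1.
  · rw [← h0]
    simp only [div_zero, mul_zero, zero_mul, Real.exp_zero, ENNReal.ofReal_one, lintegral_const,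
      measure_univ, mul_one]
    rw [ENNReal.one_le_ofReal]
    exact Real.one_le_exp (by positivity)
  have hae : ∀ᵐ z ∂(noiseLaw n σ), z i ∈ Set.Icc (-1 / 2 : ℝ) (1 / 2) :=
    (Measure.quasiMeasurePreserving_eval (μ := fun _ : Fin n => truncGaussian 0 σ) i).ae
      (ae_mem_Icc_truncGaussian σ)
  have h1 : ∀ y ∈ Set.Icc (-1 / 2 : ℝ) (1 / 2),
      ∫⁻ S, ENNReal.ofReal (Real.exp (a * (1 / (s : ℝ) * (sketchSq S v / (v ⬝ᵥ v)) * (1 + y))))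
        ∂(sketchLaw s d)
        ≤ ENNReal.ofReal (Real.exp (a + 5 * a ^ 2 / s)) * ENNReal.ofReal (Real.exp (a * y)) :=
    fun y hy => by
      have e : ∀ S : Fin s → Fin d → ℝ, a * (1 / (s : ℝ) * (sketchSq S v / (v ⬝ᵥ v)) * (1 + y))
          = (a * (1 + y) / (s * (v ⬝ᵥ v))) * sketchSq S v := fun S => by field_simp
      have e2 : 2 * (a * (1 + y) / (s * (v ⬝ᵥ v)) * (v ⬝ᵥ v)) = 2 * a * (1 + y) / s := by
        field_simp
      have hy1 : 0 ≤ 1 + y := by linarith [hy.1]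
      have hx0 : 0 ≤ 2 * a * (1 + y) / s := by positivity
      -- Since a ≤ 1 and 1 + y ≤ 3/2, the condition s ≥ 6 keeps the parameter of the moment
      -- generating function at most 1/2.
      have hx1 : 2 * a * (1 + y) / s ≤ 1 / 2 := by
        rw [div_le_iff₀ (by linarith)]
        nlinarith [hy.2, mul_le_mul ha1 (show 1 + y ≤ 3 / 2 by linarith [hy.2]) hy1 zero_le_one]
      simp_rw [e]
      rw [lintegral_exp_mul_sketchSq v (by rw [e2]; linarith), e2,
        ← ENNReal.ofReal_mul (Real.exp_pos _).le, ← Real.exp_add]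
      refine ENNReal.ofReal_le_ofReal ((one_sub_rpow_neg_le hx0 hx1 (by positivity)).trans ?_)
      refine Real.exp_le_exp.2 ?_
      have e3 : (s : ℝ) / 2 * (2 * a * (1 + y) / s + (2 * a * (1 + y) / s) ^ 2)
          = a * (1 + y) + 2 * (1 + y) ^ 2 * (a ^ 2 / s) := by field_simp
      rw [e3]
      have h4 : 2 * (1 + y) ^ 2 ≤ 5 := by nlinarith [hy.1, hy.2]
      have h5 : 0 ≤ a ^ 2 / s := by positivity
      have := mul_le_mul_of_nonneg_right h4 h5
      rw [mul_div_assoc 5]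
      linarith
  calc _ ≤ ∫⁻ z, ENNReal.ofReal (Real.exp (a + 5 * a ^ 2 / s))
          * ENNReal.ofReal (Real.exp (a * z i)) ∂(noiseLaw n σ) := by
        refine lintegral_mono_ae ?_
        filter_upwards [hae] with z hz
        exact h1 (z i) hz
    _ = ENNReal.ofReal (Real.exp (a + 5 * a ^ 2 / s))
          * ∫⁻ y, ENNReal.ofReal (Real.exp (a * y)) ∂(truncGaussian 0 σ) := by
        rw [lintegral_const_mul _ (by fun_prop), lintegral_eval_noiseLaw hσ i
          (φ := fun y => ENNReal.ofReal (Real.exp (a * y))) (by fun_prop)]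
    _ ≤ ENNReal.ofReal (Real.exp (a + 5 * a ^ 2 / s)) * ENNReal.ofReal (1 + 2 * a ^ 2 * σ ^ 2) := by
        refine mul_le_mul_right (lintegral_truncGaussian_le hσ _ a (a ^ 2) (sq_nonneg a)
          fun z hz => ⟨(Real.exp_pos _).le, ?_⟩) _
        rw [← mul_pow]
        exact real_exp_le_one_add_add_sq (by nlinarith [hz.2])
    _ ≤ _ := by
        rw [← ENNReal.ofReal_mul (Real.exp_pos _).le, Real.exp_add (a + 5 * a ^ 2 / s)]
        refine ENNReal.ofReal_le_ofReal (mul_le_mul_of_nonneg_left ?_ (Real.exp_pos _).le)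
        linarith [Real.add_one_le_exp (2 * a ^ 2 * σ ^ 2)]

/-- The rows share one sketch and are dependent. Jensen's inequality with weights ‖v_j‖²/Q bounds
the exponential of the sum by a convex combination of exponentials in a single normalized row, each
with the same moment bound. -/
theorem lintegral_exp_sum_noisy_sketchSq_le {n d s : ℕ} {σ : ℝ} (hσ : σ ^ 2 ≤ 1 / 8)
    {c : ℝ} (hc0 : 0 ≤ c) (hs : 6 ≤ s) (v : Fin n → Fin d → ℝ)
    (hQ : 0 < ∑ j, v j ⬝ᵥ v j) (hc1 : c * ∑ j, v j ⬝ᵥ v j ≤ 1) :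
    ∫⁻ S, ∫⁻ z, ENNReal.ofReal
      (Real.exp (c * ∑ j, 1 / (s : ℝ) * sketchSq S (v j) * (1 + z j))) ∂(noiseLaw n σ)
        ∂(sketchLaw s d)
      ≤ ENNReal.ofReal (Real.exp (c * ∑ j, v j ⬝ᵥ v j + 5 * (c * ∑ j, v j ⬝ᵥ v j) ^ 2 / s
        + 2 * (c * ∑ j, v j ⬝ᵥ v j) ^ 2 * σ ^ 2)) := by
  have := isProbabilityMeasure_truncGaussian hσ
  have hv : ∀ j, 0 ≤ v j ⬝ᵥ v j := fun j => by
    simp only [dotProduct]; exact Finset.sum_nonneg fun i _ => mul_self_nonneg _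
  set Q := ∑ j, v j ⬝ᵥ v j with hQdef
  set a := c * Q with ha
  set b := Real.exp (a + 5 * a ^ 2 / s + 2 * a ^ 2 * σ ^ 2) with hb
  have ha0 : 0 ≤ a := by positivity
  have hα0 : ∀ j, 0 ≤ v j ⬝ᵥ v j / Q := fun j => div_nonneg (hv j) hQ.le
  have hα1 : ∑ j, v j ⬝ᵥ v j / Q = 1 := by rw [← Finset.sum_div, ← hQdef, div_self hQ.ne']
  let F : Fin n → (Fin s → Fin d → ℝ) → (Fin n → ℝ) → ℝ := fun j S z =>
    Real.exp (a * (1 / (s : ℝ) * (sketchSq S (v j) / (v j ⬝ᵥ v j)) * (1 + z j)))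
  have hF : ∀ j, Measurable fun p : (Fin s → Fin d → ℝ) × (Fin n → ℝ) => F j p.1 p.2 := fun j => by
    have h1 : Measurable fun p : (Fin s → Fin d → ℝ) × (Fin n → ℝ) => sketchSq p.1 (v j) :=
      (measurable_sketchSq (v j)).comp measurable_fst
    simp only [F]
    fun_prop
  have hF2 : ∀ j (S : Fin s → Fin d → ℝ), Measurable fun z => F j S z := fun j S => by
    simp only [F]; fun_prop
  have hzero : ∀ (S : Fin s → Fin d → ℝ) j, v j ⬝ᵥ v j = 0 → sketchSq S (v j) = 0 := fun S j h => by
    have : v j = 0 := by rwa [dotProduct_self_eq_zero] at h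
    simp [sketchSq, this]
  have hjensen : ∀ S z, Real.exp (c * ∑ j, 1 / (s : ℝ) * sketchSq S (v j) * (1 + z j))
      ≤ ∑ j, v j ⬝ᵥ v j / Q * F j S z := fun S z => by
    have h := convexOn_exp.map_sum_le (t := Finset.univ) (w := fun j => v j ⬝ᵥ v j / Q)
      (p := fun j => a * (1 / (s : ℝ) * (sketchSq S (v j) / (v j ⬝ᵥ v j)) * (1 + z j)))
      (fun j _ => hα0 j) hα1 (fun _ _ => Set.mem_univ _)
    simp only [smul_eq_mul] at h
    refine le_trans (le_of_eq ?_) h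
    rw [Finset.mul_sum]
    congr 1
    refine Finset.sum_congr rfl fun j _ => ?_
    rcases (hv j).eq_or_lt with h0 | h0
    · rw [hzero S j h0.symm, ← h0]; simp
    · rw [ha]; field_simp
  have hofReal : ∀ S z, ENNReal.ofReal (∑ j, v j ⬝ᵥ v j / Q * F j S z)
      = ∑ j, ENNReal.ofReal (v j ⬝ᵥ v j / Q) * ENNReal.ofReal (F j S z) := fun S z => by
    rw [ENNReal.ofReal_sum_of_nonneg fun j _ => mul_nonneg (hα0 j) (Real.exp_pos _).le]
    exact Finset.sum_congr rfl fun j _ => ENNReal.ofReal_mul (hα0 j)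
  calc _ ≤ ∫⁻ S, ∫⁻ z, ∑ j, ENNReal.ofReal (v j ⬝ᵥ v j / Q) * ENNReal.ofReal (F j S z)
          ∂(noiseLaw n σ) ∂(sketchLaw s d) := by
        refine lintegral_mono fun S => lintegral_mono fun z => ?_
        rw [← hofReal]
        exact ENNReal.ofReal_le_ofReal (hjensen S z)
    _ = ∑ j, ENNReal.ofReal (v j ⬝ᵥ v j / Q) * ∫⁻ S, ∫⁻ z, ENNReal.ofReal (F j S z)
          ∂(noiseLaw n σ) ∂(sketchLaw s d) := by
        have h1 : ∀ S : Fin s → Fin d → ℝ, ∫⁻ z, ∑ j, ENNReal.ofReal (v j ⬝ᵥ v j / Q)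
            * ENNReal.ofReal (F j S z) ∂(noiseLaw n σ) = ∑ j, ENNReal.ofReal (v j ⬝ᵥ v j / Q)
              * ∫⁻ z, ENNReal.ofReal (F j S z) ∂(noiseLaw n σ) := fun S => by
          rw [lintegral_finsetSum _ fun j _ => ((hF2 j S).ennreal_ofReal).const_mul _]
          exact Finset.sum_congr rfl fun j _ => lintegral_const_mul _ (hF2 j S).ennreal_ofReal
        simp_rw [h1]
        rw [lintegral_finsetSum _ fun j _ =>
          ((hF j).ennreal_ofReal.lintegral_prod_right').const_mul _]
        exact Finset.sum_congr rfl fun j _ =>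
          lintegral_const_mul _ (hF j).ennreal_ofReal.lintegral_prod_right'
    _ ≤ ∑ j, ENNReal.ofReal (v j ⬝ᵥ v j / Q) * ENNReal.ofReal b := by
        refine Finset.sum_le_sum fun j _ => mul_le_mul_right ?_ _
        rw [lintegral_lintegral_swap (hF j).ennreal_ofReal.aemeasurable]
        exact lintegral_exp_noisy_sketchSq_le hσ ha0 hc1 hs (v j) j
    _ = ENNReal.ofReal b := by
        rw [← Finset.sum_mul, ← ENNReal.ofReal_sum_of_nonneg fun j _ => hα0 j, hα1,
          ENNReal.ofReal_one, one_mul]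

end NoisySketch
end DPJohn

namespace DPJohn

/-! ### Measurability of the iteration. -/

section Measurability

open Filter Topology

/-- The limit is discontinuous at 0, so convergence is only pointwise: regularize the denominator to
get continuous functions, then apply Weierstrass on the growing intervals [-k, k]. -/
theorem exists_polynomial_tendsto_inv_sqrt :
    ∃ q : ℕ → Polynomial ℝ, ∀ x, Tendsto (fun k => (q k).eval x) atTop (𝓝 (√x)⁻¹) := by
  let f : ℕ → ℝ → ℝ := fun k x => √x / (max x 0 + 1 / ((k : ℝ) + 1))
  have hf : ∀ k, Continuous (f k) := fun k => by
    refine Continuous.div (by fun_prop) (by fun_prop) fun x => ?_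
    have : 0 ≤ max x 0 := le_max_right _ _
    positivity
  have hlim : ∀ x, Tendsto (fun k => f k x) atTop (𝓝 (√x)⁻¹) := fun x => by
    rcases le_or_gt x 0 with hx | hx
    · simp [f, Real.sqrt_eq_zero'.2 hx]
    · have h1 : Tendsto (fun k : ℕ => max x 0 + 1 / ((k : ℝ) + 1)) atTop (𝓝 x) := by
        have := (tendsto_one_div_add_atTop_nhds_zero_nat (𝕜 := ℝ)).const_add (max x 0)
        rw [add_zero, max_eq_left hx.le] at this
        rwa [max_eq_left hx.le]
      have h2 := (tendsto_const_nhds (x := √x)).div h1 hx.ne'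
      rwa [Real.sqrt_div_self', one_div] at h2
  choose q hq using fun k : ℕ => exists_polynomial_near_of_continuousOn (-(k : ℝ)) k (f k)
    (hf k).continuousOn (1 / ((k : ℝ) + 1)) (by positivity)
  refine ⟨q, fun x => ?_⟩
  have h3 : Tendsto (fun k => (q k).eval x - f k x) atTop (𝓝 0) := by
    refine squeeze_zero_norm' ?_ (tendsto_one_div_add_atTop_nhds_zero_nat (𝕜 := ℝ))
    filter_upwards [eventually_ge_atTop ⌈|x|⌉₊] with k hk
    have hk' : |x| ≤ k := (Nat.le_ceil _).trans (by exact_mod_cast hk)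
    exact (hq k x (abs_le.1 hk')).le
  simpa using h3.add (hlim x)

variable {X : Type*} [MeasurableSpace X]

theorem measurable_matrix_mul {l m n : Type*} [Fintype m] {F : X → Matrix l m ℝ}
    {G : X → Matrix m n ℝ} (hF : ∀ i j, Measurable fun x => F x i j)
    (hG : ∀ i j, Measurable fun x => G x i j) (i : l) (j : n) :
    Measurable fun x => (F x * G x) i j := by
  simp only [Matrix.mul_apply]
  exact Finset.measurable_fun_sum _ fun k _ => (hF i k).mul (hG k j)

theorem measurable_mulVec {m n : Type*} [Fintype n] {F : X → Matrix m n ℝ} {v : X → n → ℝ}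
    (hF : ∀ i j, Measurable fun x => F x i j) (hv : ∀ j, Measurable fun x => v x j) (i : m) :
    Measurable fun x => (F x *ᵥ v x) i := by
  simp only [Matrix.mulVec, dotProduct]
  exact Finset.measurable_fun_sum _ fun k _ => (hF i k).mul (hv k)

theorem measurable_matrix_pow {m : Type*} [Fintype m] [DecidableEq m] {F : X → Matrix m m ℝ}
    (hF : ∀ i j, Measurable fun x => F x i j) (k : ℕ) (i j : m) :
    Measurable fun x => (F x ^ k) i j := by
  induction k generalizing i j with
  | zero => simp only [pow_zero]; exact measurable_const
  | succ k ih => simp only [pow_succ]; exact measurable_matrix_mul ih hF i j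

theorem measurable_matrix_inv {m : Type*} [Fintype m] [DecidableEq m] {F : X → Matrix m m ℝ}
    (hF : ∀ i j, Measurable fun x => F x i j) (i j : m) :
    Measurable fun x => (F x)⁻¹ i j := by
  have hof : Measurable fun x => (fun i j => F x i j : m → m → ℝ) :=
    measurable_pi_lambda _ fun i => measurable_pi_lambda _ fun j => hF i j
  have h1 : Measurable fun x => (F x).det := by
    have : Continuous fun M : m → m → ℝ => (Matrix.of M).det :=
      Continuous.matrix_det (continuous_id (X := Matrix m m ℝ))
    exact this.measurable.comp hof
  have h2 : Measurable fun x => (F x).adjugate i j := by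
    have : Continuous fun M : m → m → ℝ => (Matrix.of M).adjugate i j :=
      (Continuous.matrix_adjugate (continuous_id (X := Matrix m m ℝ))).matrix_elem i j
    exact this.measurable.comp hof
  simp only [Matrix.inv_def, Ring.inverse_eq_inv', Matrix.smul_apply, smul_eq_mul]
  exact h1.inv.mul h2

/-- No measurable choice of eigenvectors is made: at each fixed matrix, polynomials in it converge
entrywise to the inverse square root, and their entries are measurable. -/
theorem measurable_invSqrt {d : ℕ} {F : X → Matrix (Fin d) (Fin d) ℝ}
    (hF : ∀ i j, Measurable fun x => F x i j) (hherm : ∀ x, (F x).IsHermitian) (i j : Fin d) :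
    Measurable fun x => invSqrt (F x) i j := by
  obtain ⟨q, hq⟩ := exists_polynomial_tendsto_inv_sqrt
  refine measurable_of_tendsto_metrizable (f := fun k x => Polynomial.aeval (F x) (q k) i j)
    (fun k => ?_) ?_
  · simp only [Polynomial.aeval_eq_sum_range, Matrix.sum_apply, Matrix.smul_apply, smul_eq_mul]
    exact Finset.measurable_fun_sum _ fun e _ => (measurable_matrix_pow hF e i j).const_mul _
  · rw [tendsto_pi_nhds]
    intro x
    obtain ⟨U, l, -, -, -, hf⟩ := exists_orthogonal_diagonalization (F x) (hherm x)
    have h1 : ∀ f : ℝ → ℝ, cfc f (F x) i j = ∑ a, U i a * f (l a) * U j a := fun f => by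
      rw [hf f, Matrix.mul_apply]
      simp only [Matrix.mul_diagonal, Function.comp_apply, Matrix.transpose_apply]
    have h2 : ∀ k, Polynomial.aeval (F x) (q k) i j = ∑ a, U i a * (q k).eval (l a) * U j a :=
      fun k => (congrFun (congrFun (cfc_polynomial (q k) (F x)
        (show IsSelfAdjoint (F x) from hherm x)) i) j).symm.trans (h1 fun y => (q k).eval y)
    simp only [h2, invSqrt, h1]
    exact tendsto_finsetSum _ fun a _ => ((hq (l a)).const_mul _).mul_const _

variable {n d s N : ℕ} (A : Matrix (Fin n) (Fin d) ℝ)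

theorem measurable_gram {w : X → Fin n → ℝ} (hw : ∀ i, Measurable fun x => w x i)
    (i j : Fin d) : Measurable fun x => gram A (w x) i j := by
  refine measurable_matrix_mul (F := fun x => Aᵀ * Matrix.diagonal (w x)) (G := fun _ => A)
    (measurable_matrix_mul (F := fun _ => Aᵀ) (fun _ _ => measurable_const) fun a b => ?_)
    (fun _ _ => measurable_const) i j
  by_cases hab : a = b
  · subst hab; simp only [Matrix.diagonal_apply_eq]; exact hw a
  · simp only [Matrix.diagonal_apply_ne _ hab]; exact measurable_const

theorem measurable_h {w : X → Fin n → ℝ} (hw : ∀ i, Measurable fun x => w x i) (i : Fin n) :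
    Measurable fun x => h A (w x) i := by
  simp only [h, dotProduct]
  exact Finset.measurable_fun_sum _ fun k _ => measurable_const.mul
    (measurable_mulVec (v := fun _ => A i) (measurable_matrix_inv (measurable_gram A hw))
      (fun _ => measurable_const) k)

theorem sampleCount_eq_sum (p : Fin n → ℝ) (U : Fin N → ℝ) (i : Fin n) :
    (sampleCount p U i : ℝ) = ∑ t : Fin N, Set.indicator
      (Set.Ico (∑ j ∈ Finset.Iio i, p j) (∑ j ∈ Finset.Iic i, p j)) 1 (U t) := by
  classical
  rw [sampleCount, Nat.card_eq_fintype_card, Fintype.card_subtype, Finset.card_filter]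
  push_cast
  refine Finset.sum_congr rfl fun t _ => ?_
  simp only [Set.indicator_apply, Set.mem_Ico, Pi.one_apply]

theorem measurable_sampleCount {p : X → Fin n → ℝ} {U : X → Fin N → ℝ}
    (hp : ∀ i, Measurable fun x => p x i) (hU : ∀ t, Measurable fun x => U x t) (i : Fin n) :
    Measurable fun x => (sampleCount (p x) (U x) i : ℝ) := by
  classical
  simp only [sampleCount_eq_sum, Set.indicator_apply, Pi.one_apply]
  refine Finset.measurable_fun_sum _ fun t _ => Measurable.ite ?_ measurable_const measurable_const
  exact (measurableSet_le (Finset.measurable_fun_sum _ fun j _ => hp j) (hU t)).inter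
    (measurableSet_lt (hU t) (Finset.measurable_fun_sum _ fun j _ => hp j))

/-- The vector `(Bᵀ D B)^(-1/2) √wᵢ aᵢ` for the sampling matrix `D` of one iteration. -/
noncomputable def whitenedRow (p : Fin n → ℝ) (U : Fin N → ℝ) (w : Fin n → ℝ) (i : Fin n) :
    Fin d → ℝ :=
  invSqrt ((scaledRows A w)ᵀ * samplingMatrix p U * scaledRows A w) *ᵥ (√(w i) • A i)

theorem sketchedWeight_eq (p : Fin n → ℝ) (U : Fin N → ℝ) (S : Fin s → Fin d → ℝ)
    (w : Fin n → ℝ) (i : Fin n) :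
    sketchedWeight A (samplingMatrix p U) (Matrix.of S) w i
      = 1 / (s : ℝ) * sketchSq S (whitenedRow A p U w i) := by
  simp only [sketchedWeight, sketchSq, whitenedRow, ← Matrix.mulVec_mulVec]
  rfl

theorem measurable_whitenedRow {p : X → Fin n → ℝ} {U : X → Fin N → ℝ} {w : X → Fin n → ℝ}
    (hp : ∀ i, Measurable fun x => p x i) (hU : ∀ t, Measurable fun x => U x t)
    (hw : ∀ i, Measurable fun x => w x i) (i : Fin n) (a : Fin d) :
    Measurable fun x => whitenedRow A (p x) (U x) (w x) i a := by
  have hB : ∀ i j, Measurable fun x => scaledRows A (w x) i j := fun i j => by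
    simp only [scaledRows_apply, Pi.smul_apply, smul_eq_mul]
    exact (hw i).sqrt.mul measurable_const
  have hD : ∀ i j, Measurable fun x => samplingMatrix (p x) (U x) i j := fun i j => by
    by_cases hij : i = j
    · subst hij
      simp only [samplingMatrix, Matrix.diagonal_apply_eq]
      exact (measurable_sampleCount hp hU i).div (measurable_const.mul (hp i))
    · simp only [samplingMatrix, Matrix.diagonal_apply_ne _ hij]; exact measurable_const
  refine measurable_mulVec (measurable_invSqrt (measurable_matrix_mul (measurable_matrix_mul
    (F := fun x => (scaledRows A (w x))ᵀ) (fun i j => hB j i) hD) hB) fun x => ?_) (fun j => ?_) a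
  · rw [Matrix.IsHermitian, Matrix.conjTranspose_eq_transpose_of_trivial, samplingMatrix]
    simp [Matrix.transpose_mul, Matrix.mul_assoc]
  · simp only [Pi.smul_apply, smul_eq_mul]
    exact (hw i).sqrt.mul measurable_const

theorem measurable_samplingProb {τ : X → Fin n → ℝ} (hτ : ∀ i, Measurable fun x => τ x i)
    (i : Fin n) : Measurable fun x => samplingProb (τ x) i :=
  (hτ i).div (Finset.measurable_fun_sum _ fun j _ => hτ j)

theorem measurable_sketchSq_comp {S : X → Fin s → Fin d → ℝ} {v : X → Fin d → ℝ}
    (hS : ∀ i j, Measurable fun x => S x i j) (hv : ∀ j, Measurable fun x => v x j) :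
    Measurable fun x => sketchSq (S x) (v x) := by
  simp only [sketchSq, dotProduct]
  exact Finset.measurable_fun_sum _ fun j _ =>
    (Finset.measurable_fun_sum _ fun k _ => (hS j k).mul (hv k)).pow_const 2

end Measurability

end DPJohn

namespace DPJohn

/-! ### From uniform variables to sequences of drawn indices. -/

section SamplingCells

variable {n : ℕ}

/-- The values of the uniform variable for which row `i` is drawn. -/
def sampleCell (p : Fin n → ℝ) (i : Fin n) : Set ℝ :=
  Set.Ico (∑ j ∈ Finset.Iio i, p j) (∑ j ∈ Finset.Iic i, p j)

theorem sum_Iic_eq_add (p : Fin n → ℝ) (i : Fin n) :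
    ∑ j ∈ Finset.Iic i, p j = ∑ j ∈ Finset.Iio i, p j + p i := by
  rw [← Finset.Iio_insert, Finset.sum_insert (by simp), add_comm]

theorem eq_of_mem_sampleCell {p : Fin n → ℝ} (hp : ∀ i, 0 ≤ p i) {i j : Fin n} {u : ℝ}
    (hi : u ∈ sampleCell p i) (hj : u ∈ sampleCell p j) : i = j := by
  have key : ∀ {a b : Fin n}, a < b → u ∈ sampleCell p a → u ∈ sampleCell p b → False :=
    fun {a b} hab ha hb => by
      have h1 : ∑ j ∈ Finset.Iic a, p j ≤ ∑ j ∈ Finset.Iio b, p j :=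
        Finset.sum_le_sum_of_subset_of_nonneg (fun x hx =>
          Finset.mem_Iio.2 ((Finset.mem_Iic.1 hx).trans_lt hab)) fun _ _ _ => hp _
      linarith [ha.2, hb.1]
  rcases lt_trichotomy i j with h | h | h
  · exact (key h hi hj).elim
  · exact h
  · exact (key h hj hi).elim

/-- The cell is that of the first index whose cumulative sum exceeds u. -/
theorem exists_mem_sampleCell {p : Fin n → ℝ} (hp1 : ∑ i, p i = 1) {u : ℝ} (h0 : 0 ≤ u)
    (h1 : u < 1) : ∃ i, u ∈ sampleCell p i := by
  classical
  have hne : (Finset.univ.filter fun i => u < ∑ j ∈ Finset.Iic i, p j).Nonempty := by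
    have hn : 0 < n := by
      rcases Nat.eq_zero_or_pos n with rfl | h
      · simp at hp1
      · exact h
    refine ⟨⟨n - 1, by omega⟩, Finset.mem_filter.2 ⟨Finset.mem_univ _, ?_⟩⟩
    have : Finset.Iic (⟨n - 1, by omega⟩ : Fin n) = Finset.univ := by
      ext x; simp only [Finset.mem_Iic, Finset.mem_univ, iff_true, Fin.le_def]; omega
    rw [this, hp1]; exact h1
  set i := (Finset.univ.filter fun i => u < ∑ j ∈ Finset.Iic i, p j).min' hne with hi
  have hi1 := (Finset.mem_filter.1 (Finset.min'_mem _ hne)).2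
  refine ⟨i, ?_, hi1⟩
  by_contra! hcon
  have hne2 : (Finset.Iio i).Nonempty := by
    by_contra hemp
    rw [Finset.not_nonempty_iff_eq_empty.1 hemp, Finset.sum_empty] at hcon
    linarith
  set j := (Finset.Iio i).max' hne2 with hj
  have hj1 : j < i := Finset.mem_Iio.1 (Finset.max'_mem _ hne2)
  have hIic : Finset.Iic j = Finset.Iio i := by
    ext x
    rw [Finset.mem_Iic, Finset.mem_Iio]
    exact ⟨fun h => h.trans_lt hj1, fun h => Finset.le_max' _ _ (Finset.mem_Iio.2 h)⟩
  have hj2 : j ∈ Finset.univ.filter fun i => u < ∑ j ∈ Finset.Iic i, p j :=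
    Finset.mem_filter.2 ⟨Finset.mem_univ _, by rw [hIic]; exact hcon⟩
  exact absurd (Finset.min'_le _ _ hj2) (not_le.2 hj1)

/-- The law of the uniform variables behind the row sampling. -/
noncomputable abbrev uniformLaw (N : ℕ) : Measure (Fin N → ℝ) :=
  Measure.pi fun _ : Fin N => (volume : Measure ℝ).restrict (Set.Icc 0 1)

theorem uniformLaw_cells {N : ℕ} {p : Fin n → ℝ} (hp : ∀ i, 0 ≤ p i) (hp1 : ∑ i, p i = 1)
    (f : Fin N → Fin n) :
    uniformLaw N {U | ∀ t, U t ∈ sampleCell p (f t)} = ENNReal.ofReal (∏ t, p (f t)) := by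
  have h1 : {U : Fin N → ℝ | ∀ t, U t ∈ sampleCell p (f t)}
      = Set.pi Set.univ fun t => sampleCell p (f t) := by ext; simp
  rw [h1, Measure.pi_pi, ENNReal.ofReal_prod_of_nonneg fun t _ => hp _]
  refine Finset.prod_congr rfl fun t _ => ?_
  have h2 : 0 ≤ ∑ j ∈ Finset.Iio (f t), p j := Finset.sum_nonneg fun _ _ => hp _
  have h3 : ∑ j ∈ Finset.Iic (f t), p j ≤ 1 := by
    rw [← hp1]
    exact Finset.sum_le_sum_of_subset_of_nonneg (Finset.subset_univ _) fun _ _ _ => hp _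
  have h4 : sampleCell p (f t) ∩ Set.Icc 0 1 = sampleCell p (f t) :=
    Set.inter_eq_left.2 fun x hx => ⟨h2.trans hx.1, hx.2.le.trans h3⟩
  rw [sampleCell] at h4 ⊢
  rw [Measure.restrict_apply measurableSet_Ico, h4, Real.volume_Ico, sum_Iic_eq_add, add_sub_cancel_left]

/-- Reduces an event about the uniform variables to a finite sum over index sequences, the form in
which the Bernstein bound is stated. Only the null event that some variable equals 1 is missed by
the cells. -/
theorem uniformLaw_le_sum_cells {N : ℕ} {p : Fin n → ℝ} (hp : ∀ i, 0 ≤ p i)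
    (hp1 : ∑ i, p i = 1) (s : Set (Fin N → ℝ)) (bad : (Fin N → Fin n) → Prop) [DecidablePred bad]
    (hbad : ∀ U ∈ s, ∀ f : Fin N → Fin n, (∀ t, U t ∈ sampleCell p (f t)) → bad f) :
    uniformLaw N s ≤ ENNReal.ofReal (∑ f, if bad f then ∏ t, p (f t) else 0) := by
  have hnull : uniformLaw N {U | ∀ t, U t ∈ Set.Ico (0 : ℝ) 1}ᶜ = 0 := by
    have h1 : ∀ᵐ y ∂((volume : Measure ℝ).restrict (Set.Icc 0 1)), y ∈ Set.Ico (0 : ℝ) 1 := by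
      have h2 : ∀ᵐ y ∂((volume : Measure ℝ).restrict (Set.Icc 0 1)), y ≠ (1 : ℝ) := by
        rw [ae_iff]
        simp
      filter_upwards [h2, ae_restrict_mem measurableSet_Icc] with y hy hy2
      exact ⟨hy2.1, lt_of_le_of_ne hy2.2 hy⟩
    have h3 : ∀ᵐ U ∂(uniformLaw N), ∀ t, U t ∈ Set.Ico (0 : ℝ) 1 := by
      rw [ae_all_iff]
      intro t
      exact (Measure.quasiMeasurePreserving_eval
        (μ := fun _ : Fin N => (volume : Measure ℝ).restrict (Set.Icc 0 1)) t).ae h1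
    exact h3
  have hsub : s ⊆ (⋃ f ∈ Finset.univ.filter bad, {U | ∀ t, U t ∈ sampleCell p (f t)})
      ∪ {U | ∀ t, U t ∈ Set.Ico (0 : ℝ) 1}ᶜ := fun U hU => by
    by_cases hU1 : ∀ t, U t ∈ Set.Ico (0 : ℝ) 1
    · left
      choose f hf using fun t => exists_mem_sampleCell hp1 (hU1 t).1 (hU1 t).2
      exact Set.mem_biUnion (x := f)
        (Finset.mem_coe.2 (Finset.mem_filter.2 ⟨Finset.mem_univ _, hbad U hU f hf⟩)) hf
    · right; exact hU1
  calc uniformLaw N s ≤ uniformLaw N (⋃ f ∈ Finset.univ.filter bad,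
        {U | ∀ t, U t ∈ sampleCell p (f t)}) + 0 := by
        rw [← hnull]
        exact (measure_mono hsub).trans (measure_union_le _ _)
    _ ≤ ∑ f ∈ Finset.univ.filter bad, uniformLaw N {U | ∀ t, U t ∈ sampleCell p (f t)} := by
        rw [add_zero]; exact measure_biUnion_finset_le _ _
    _ = _ := by
        rw [← Finset.sum_filter,
          ENNReal.ofReal_sum_of_nonneg fun f _ => Finset.prod_nonneg fun t _ => hp _]
        exact Finset.sum_congr rfl fun f _ => uniformLaw_cells hp hp1 f

theorem sampleCount_of_cells {N : ℕ} {p : Fin n → ℝ} (hp : ∀ i, 0 ≤ p i) {U : Fin N → ℝ}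
    {f : Fin N → Fin n} (hf : ∀ t, U t ∈ sampleCell p (f t)) (i : Fin n) :
    (sampleCount p U i : ℝ) = ∑ t, if f t = i then 1 else 0 := by
  classical
  rw [sampleCount_eq_sum]
  refine Finset.sum_congr rfl fun t _ => ?_
  change Set.indicator (sampleCell p i) 1 (U t) = _
  by_cases h : f t = i
  · rw [if_pos h, ← h, Set.indicator_of_mem (hf t)]; rfl
  · rw [if_neg h, Set.indicator_of_notMem fun hmem => h (eq_of_mem_sampleCell hp (hf t) hmem)]

end SamplingCells

/-! ### Accuracy of leverage score sampling. -/

section Sampling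

variable {n d N : ℕ} {A : Matrix (Fin n) (Fin d) ℝ}

theorem isHermitian_invSqrt {M : Matrix (Fin d) (Fin d) ℝ} (hM : M.IsHermitian) :
    (invSqrt M)ᵀ = invSqrt M := by
  obtain ⟨U, l, -, -, -, hf⟩ := exists_orthogonal_diagonalization M hM
  rw [invSqrt, hf]
  simp [Matrix.transpose_mul, Matrix.mul_assoc]

/-- Both symmetric matrices have the same quadratic form; polarization at basis vectors compares
their entries. -/
theorem invSqrt_mul_self {M : Matrix (Fin d) (Fin d) ℝ} (hM : M.PosDef) :
    invSqrt M * invSqrt M = M⁻¹ := by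
  have hS := isHermitian_invSqrt hM.1
  have hT : (M⁻¹)ᵀ = M⁻¹ := by
    rw [← Matrix.conjTranspose_eq_transpose_of_trivial]; exact hM.inv.1
  have h : ∀ v, v ⬝ᵥ ((invSqrt M * invSqrt M - M⁻¹) *ᵥ v) = 0 := fun v => by
    have h2 := invSqrt_mulVec_sq hM v
    rw [Matrix.dotProduct_mulVec, ← Matrix.mulVec_transpose, hS, dotProduct_comm] at h2
    rw [Matrix.sub_mulVec, dotProduct_sub, ← h2, ← Matrix.mulVec_mulVec, sub_self]
  have hherm : (invSqrt M * invSqrt M - M⁻¹).IsHermitian := by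
    rw [Matrix.IsHermitian, Matrix.conjTranspose_eq_transpose_of_trivial, Matrix.transpose_sub,
      Matrix.transpose_mul, hS, hT]
  ext i j
  have e1 := h (Pi.single i 1 + Pi.single j 1)
  have e2 := h (Pi.single i 1)
  have e3 := h (Pi.single j 1)
  have e4 := dotProduct_mulVec_comm hherm (Pi.single i 1) (Pi.single j 1)
  rw [Matrix.mulVec_add, add_dotProduct, dotProduct_add, dotProduct_add, e2, e3, ← e4] at e1
  have e5 : (Pi.single i 1 : Fin d → ℝ) ⬝ᵥ
      ((invSqrt M * invSqrt M - M⁻¹) *ᵥ Pi.single j 1) = 0 := by linarith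
  rw [single_one_dotProduct, Matrix.mulVec_single_one, Matrix.col_apply, Matrix.sub_apply] at e5
  linarith

/-- The rescaled rank one matrix contributed by a draw of row `i`, in coordinates in which
`gram A w` is the identity. -/
noncomputable def sampleTerm (A : Matrix (Fin n) (Fin d) ℝ) (w p : Fin n → ℝ) (i : Fin n) :
    Matrix (Fin d) (Fin d) ℝ :=
  (w i / p i) • Matrix.vecMulVec (invSqrt (gram A w) *ᵥ A i) (invSqrt (gram A w) *ᵥ A i)

theorem dotProduct_vecMulVec_mulVec {k : Type*} [Fintype k] (c x : k → ℝ) :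
    x ⬝ᵥ (Matrix.vecMulVec c c *ᵥ x) = (c ⬝ᵥ x) ^ 2 := by
  have : Matrix.vecMulVec c c *ᵥ x = (c ⬝ᵥ x) • c := by
    ext i
    simp only [Matrix.mulVec, Matrix.vecMulVec_apply, dotProduct, Pi.smul_apply, smul_eq_mul,
      Finset.sum_mul]
    exact Finset.sum_congr rfl fun j _ => by ring
  rw [this, dotProduct_smul, smul_eq_mul, dotProduct_comm x c, pow_two]

theorem dotProduct_sampleTerm_mulVec (w p : Fin n → ℝ) (i : Fin n) (x : Fin d → ℝ) :
    x ⬝ᵥ (sampleTerm A w p i *ᵥ x) = w i / p i * ((invSqrt (gram A w) *ᵥ A i) ⬝ᵥ x) ^ 2 := by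
  rw [sampleTerm, Matrix.smul_mulVec, dotProduct_smul, dotProduct_vecMulVec_mulVec, smul_eq_mul]

theorem isHermitian_sampleTerm (w p : Fin n → ℝ) (i : Fin n) :
    (sampleTerm A w p i).IsHermitian := by
  rw [Matrix.IsHermitian, Matrix.conjTranspose_eq_transpose_of_trivial, sampleTerm,
    Matrix.transpose_smul, Matrix.transpose_vecMulVec]

/-- A rank one matrix squares to a multiple of itself. Since the multiple is at most L when w_i h_i
≤ L p_i, this bounds the variance in the Bernstein inequality. -/
theorem sampleTerm_sq (w p : Fin n → ℝ) (hG : (gram A w).PosDef) (i : Fin n) :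
    sampleTerm A w p i ^ 2 = (w i * h A w i / p i) • sampleTerm A w p i := by
  rw [pow_two, sampleTerm, smul_mul_smul_comm, Matrix.vecMulVec_mul_vecMulVec,
    invSqrt_mulVec_sq hG, Matrix.vecMulVec_smul, smul_smul, smul_smul, ← h]
  congr 1
  ring

/-- The sampled term is unbiased: in whitened coordinates its mean is the identity. -/
theorem sum_smul_sampleTerm {w p : Fin n → ℝ} (hG : (gram A w).PosDef)
    (hp : ∀ i, p i = 0 → w i * h A w i = 0) :
    ∑ i, p i • sampleTerm A w p i = 1 := by
  set R := invSqrt (gram A w) with hR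
  have hRT : Rᵀ = R := isHermitian_invSqrt hG.1
  have h1 : ∀ i, p i • sampleTerm A w p i = w i • Matrix.vecMulVec (R *ᵥ A i) (R *ᵥ A i) :=
    fun i => by
      -- Division by p_i = 0 makes the sampled term zero; nothing is lost, as the row then has
      -- weight zero or is itself zero.
      by_cases hpi : p i = 0
      · have h2 := hp i hpi
        rw [hpi, zero_smul]
        rcases mul_eq_zero.1 h2 with h3 | h3
        · rw [h3, zero_smul]
        · have h4 : A i = 0 := by
            by_contra hne; exact (h_pos hG hne).ne' h3
          rw [h4, Matrix.mulVec_zero, Matrix.vecMulVec_zero, smul_zero]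
      · rw [sampleTerm, smul_smul, mul_div_cancel₀ _ hpi]
  have h2 : ∑ i, w i • Matrix.vecMulVec (R *ᵥ A i) (R *ᵥ A i) = R * gram A w * R := by
    have h3 : ∀ i a, (R *ᵥ A i) a = (A * R) i a := fun i a => by
      conv_rhs => rw [← hRT, Matrix.mul_apply]
      simp only [Matrix.mulVec, dotProduct, Matrix.transpose_apply]
      exact Finset.sum_congr rfl fun j _ => mul_comm _ _
    have h4 : R * gram A w * R = (A * R)ᵀ * (Matrix.diagonal w * (A * R)) := by
      rw [Matrix.transpose_mul, hRT, gram]; simp only [Matrix.mul_assoc]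
    rw [h4]
    ext a b
    rw [Matrix.sum_apply, Matrix.mul_apply]
    refine Finset.sum_congr rfl fun i _ => ?_
    rw [Matrix.smul_apply, Matrix.vecMulVec_apply, h3, h3, Matrix.diagonal_mul,
      Matrix.transpose_apply, smul_eq_mul]
    ring
  have hdet : IsUnit (gram A w).det := hG.det_pos.ne'.isUnit
  have h5 : (R * gram A w) * R = 1 := by
    have h6 : R * (R * gram A w) = 1 := by
      rw [← Matrix.mul_assoc, hR, invSqrt_mul_self hG, Matrix.nonsing_inv_mul _ hdet]
    exact mul_eq_one_comm.1 h6
  rw [Finset.sum_congr rfl fun i _ => h1 i, h2, h5]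

/-- The whitened squared row norms are within a factor `1 ± ε` of the leverage scores. -/
def GoodSample (A : Matrix (Fin n) (Fin d) ℝ) (ε : ℝ) (p : Fin n → ℝ) (U : Fin N → ℝ)
    (w : Fin n → ℝ) : Prop :=
  ∀ i, w i * h A w i ≤ (1 + ε) * (whitenedRow A p U w i ⬝ᵥ whitenedRow A p U w i) ∧
    (1 - ε) * (whitenedRow A p U w i ⬝ᵥ whitenedRow A p U w i) ≤ w i * h A w i

/-- The two quadratic form bounds say that the sampled Gram matrix lies between (1-ε)G and (1+ε)G.
Inverting these inequalities compares ‖v_i‖² with w_i h_i. -/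
theorem goodSample_of_quadForm {w p : Fin n → ℝ} (hw : ∀ i, 0 ≤ w i) (hG : (gram A w).PosDef)
    (hp : ∀ i, 0 ≤ p i) (hN : 0 < N) {ε : ℝ} (hε1 : ε < 1)
    {U : Fin N → ℝ} {f : Fin N → Fin n} (hf : ∀ t, U t ∈ sampleCell p (f t))
    (hlow : ∀ x : Fin d → ℝ, x ⬝ᵥ ((∑ t, (1 - sampleTerm A w p (f t))) *ᵥ x) ≤ ε * N * (x ⬝ᵥ x))
    (hupp : ∀ x : Fin d → ℝ, x ⬝ᵥ ((∑ t, (sampleTerm A w p (f t) - 1)) *ᵥ x) ≤ ε * N * (x ⬝ᵥ x)) :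
    GoodSample A ε p U w := by
  have hN' : (0 : ℝ) < N := by exact_mod_cast hN
  have hdet : IsUnit (gram A w).det := hG.det_pos.ne'.isUnit
  set R := invSqrt (gram A w) with hR
  have hRT : Rᵀ = R := isHermitian_invSqrt hG.1
  set D : Fin n → ℝ := fun i => (sampleCount p U i : ℝ) / (N * p i) with hD
  set M := (scaledRows A w)ᵀ * samplingMatrix p U * scaledRows A w with hM
  have hMg : M = gram A fun i => w i * D i := transpose_scaledRows_mul w D hw
  -- R is the inverse square root of G, so R(Gy) is the square root of G applied to y; taking x =
  -- R(Gy) below undoes the whitening.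
  have hRR : ∀ y, R *ᵥ (R *ᵥ (gram A w *ᵥ y)) = y := fun y => by
    rw [Matrix.mulVec_mulVec, Matrix.mulVec_mulVec, hR, invSqrt_mul_self hG,
      Matrix.nonsing_inv_mul _ hdet, Matrix.one_mulVec]
  have hadj : ∀ a b, (R *ᵥ a) ⬝ᵥ b = a ⬝ᵥ (R *ᵥ b) := fun a b => by
    rw [Matrix.dotProduct_mulVec, ← Matrix.mulVec_transpose, hRT]
  have hterm : ∀ i y, (R *ᵥ (gram A w *ᵥ y)) ⬝ᵥ (sampleTerm A w p i *ᵥ (R *ᵥ (gram A w *ᵥ y)))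
      = w i / p i * (A i ⬝ᵥ y) ^ 2 := fun i y => by
    rw [dotProduct_sampleTerm_mulVec, ← hR, hadj, hRR]
  have hsum : ∀ y, ∑ t, (R *ᵥ (gram A w *ᵥ y)) ⬝ᵥ (sampleTerm A w p (f t) *ᵥ
      (R *ᵥ (gram A w *ᵥ y))) = N * (y ⬝ᵥ (M *ᵥ y)) := fun y => by
    rw [hMg, dotProduct_gram_mulVec, Finset.mul_sum]
    simp only [hterm, hD, sampleCount_of_cells hp hf]
    have e : ∀ i, (N : ℝ) * (w i * ((∑ t, if f t = i then (1 : ℝ) else 0) / (N * p i))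
        * (A i ⬝ᵥ y) ^ 2) = ∑ t, if f t = i then w i / p i * (A i ⬝ᵥ y) ^ 2 else 0 := fun i => by
      have : ∀ t, (if f t = i then w i / p i * (A i ⬝ᵥ y) ^ 2 else 0)
          = (if f t = i then (1 : ℝ) else 0) * (w i / p i * (A i ⬝ᵥ y) ^ 2) := fun t => by
        split_ifs <;> simp
      simp_rw [this]
      rw [← Finset.sum_mul]
      field_simp
    simp_rw [e]
    rw [Finset.sum_comm]
    refine Finset.sum_congr rfl fun t _ => ?_
    rw [Finset.sum_ite_eq Finset.univ (f t) fun i => w i / p i * (A i ⬝ᵥ y) ^ 2,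
      if_pos (Finset.mem_univ _)]
  have hsq : ∀ y, (R *ᵥ (gram A w *ᵥ y)) ⬝ᵥ (R *ᵥ (gram A w *ᵥ y)) = y ⬝ᵥ (gram A w *ᵥ y) :=
    fun y => by rw [hadj, hRR, dotProduct_comm]
  have hlow' : ∀ y, (1 - ε) * (y ⬝ᵥ (gram A w *ᵥ y)) ≤ y ⬝ᵥ (M *ᵥ y) := fun y => by
    have h1 := hlow (R *ᵥ (gram A w *ᵥ y))
    rw [Finset.sum_sub_distrib, Matrix.sub_mulVec, dotProduct_sub, Matrix.sum_mulVec,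
      Matrix.sum_mulVec, dotProduct_sum, dotProduct_sum, hsum] at h1
    simp only [Matrix.one_mulVec, hsq, Finset.sum_const, Finset.card_univ, Fintype.card_fin,
      nsmul_eq_mul] at h1
    refine le_of_mul_le_mul_left ?_ hN'
    linarith
  have hupp' : ∀ y, y ⬝ᵥ (M *ᵥ y) ≤ (1 + ε) * (y ⬝ᵥ (gram A w *ᵥ y)) := fun y => by
    have h1 := hupp (R *ᵥ (gram A w *ᵥ y))
    rw [Finset.sum_sub_distrib, Matrix.sub_mulVec, dotProduct_sub, Matrix.sum_mulVec,
      Matrix.sum_mulVec, dotProduct_sum, dotProduct_sum, hsum] at h1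
    simp only [Matrix.one_mulVec, hsq, Finset.sum_const, Finset.card_univ, Fintype.card_fin,
      nsmul_eq_mul] at h1
    refine le_of_mul_le_mul_left ?_ hN'
    linarith
  have hMpd : M.PosDef := by
    refine Matrix.PosDef.of_dotProduct_mulVec_pos (hMg ▸ isHermitian_gram _) fun y hy => ?_
    rw [star_trivial]
    refine lt_of_lt_of_le (mul_pos (by linarith) ?_) (hlow' y)
    simpa using hG.dotProduct_mulVec_pos hy
  intro i
  have hv : whitenedRow A p U w i ⬝ᵥ whitenedRow A p U w i = w i * (A i ⬝ᵥ (M⁻¹ *ᵥ A i)) := by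
    rw [whitenedRow, ← hM, invSqrt_mulVec_sq hMpd, Matrix.mulVec_smul, smul_dotProduct,
      dotProduct_smul, smul_eq_mul, smul_eq_mul, ← mul_assoc, Real.mul_self_sqrt (hw i)]
  have h1 := dotProduct_inv_mulVec_le hMpd hG hupp' (A i)
  have h2 := dotProduct_inv_mulVec_le hG hMpd (c := (1 - ε)⁻¹) (fun y => by
    rw [inv_mul_eq_div, le_div_iff₀ (by linarith), mul_comm]; exact hlow' y) (A i)
  rw [inv_mul_eq_div, le_div_iff₀ (by linarith)] at h2
  rw [hv, h]
  constructor
  · nlinarith [mul_le_mul_of_nonneg_left h1 (hw i)]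
  · nlinarith [mul_le_mul_of_nonneg_left h2 (hw i)]

/-- One factor κ comes from τ_i bounding the leverage score, the other from the normalizer, which is
at most κd because leverage scores sum to d. -/
theorem samplingProb_properties {κ : ℝ} (hκ : 1 ≤ κ) (hd : 0 < d) {w τ : Fin n → ℝ}
    (hw : ∀ i, 0 ≤ w i) (hG : (gram A w).PosDef)
    (hτ : ∀ i, κ⁻¹ * leverageScore (scaledRows A w) i ≤ τ i ∧
      τ i ≤ κ * leverageScore (scaledRows A w) i) :
    (∀ i, 0 ≤ samplingProb τ i) ∧ ∑ i, samplingProb τ i = 1 ∧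
      ∀ i, w i * h A w i ≤ κ ^ 2 * d * samplingProb τ i := by
  have hκ0 : 0 < κ := by linarith
  have hd' : (0 : ℝ) < d := by exact_mod_cast hd
  simp only [leverageScore_scaledRows hw] at hτ
  have hl : ∀ i, 0 ≤ w i * h A w i := fun i => mul_nonneg (hw i) (h_nonneg hG i)
  have hτ0 : ∀ i, 0 ≤ τ i := fun i =>
    (mul_nonneg (inv_nonneg.2 hκ0.le) (hl i)).trans (hτ i).1
  have hsum_le : ∑ j, τ j ≤ κ * d := by
    rw [← sum_mul_h hG, Finset.mul_sum]; exact Finset.sum_le_sum fun i _ => (hτ i).2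
  have hsum_pos : 0 < ∑ j, τ j := by
    refine lt_of_lt_of_le (mul_pos (inv_pos.2 hκ0) hd') ?_
    rw [← sum_mul_h hG, Finset.mul_sum]; exact Finset.sum_le_sum fun i _ => (hτ i).1
  refine ⟨fun i => div_nonneg (hτ0 i) hsum_pos.le, ?_, fun i => ?_⟩
  · simp only [samplingProb]; rw [← Finset.sum_div, div_self hsum_pos.ne']
  · rw [samplingProb, mul_div_assoc', le_div_iff₀ hsum_pos]
    have h1 : w i * h A w i ≤ κ * τ i := by
      have := (hτ i).1
      rwa [inv_mul_eq_div, div_le_iff₀ hκ0, mul_comm (τ i)] at this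
    calc w i * h A w i * ∑ j, τ j ≤ κ * τ i * (κ * d) :=
          mul_le_mul h1 hsum_le hsum_pos.le (mul_nonneg hκ0.le (hτ0 i))
      _ = _ := by ring

theorem isHermitian_sampleTerm_sub_one (w p : Fin n → ℝ) (i : Fin n) :
    (sampleTerm A w p i - 1).IsHermitian :=
  (isHermitian_sampleTerm w p i).sub Matrix.isHermitian_one

theorem posSemidef_of_quadForm {M : Matrix (Fin d) (Fin d) ℝ} (hM : M.IsHermitian)
    (h : ∀ x, 0 ≤ x ⬝ᵥ (M *ᵥ x)) : M.PosSemidef :=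
  Matrix.PosSemidef.of_dotProduct_mulVec_nonneg hM fun x => by simpa using h x

theorem dotProduct_sampleTerm_mulVec_mem {w p : Fin n → ℝ} (hw : ∀ i, 0 ≤ w i)
    (hp : ∀ i, 0 ≤ p i) (hG : (gram A w).PosDef) {L : ℝ} (hL0 : 0 ≤ L)
    (hL : ∀ i, w i * h A w i ≤ L * p i) (i : Fin n) (x : Fin d → ℝ) :
    0 ≤ x ⬝ᵥ (sampleTerm A w p i *ᵥ x) ∧ x ⬝ᵥ (sampleTerm A w p i *ᵥ x) ≤ L * (x ⬝ᵥ x) := by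
  have hx : 0 ≤ x ⬝ᵥ x := by
    simp only [dotProduct]; exact Finset.sum_nonneg fun i _ => mul_self_nonneg _
  rw [dotProduct_sampleTerm_mulVec]
  refine ⟨mul_nonneg (div_nonneg (hw i) (hp i)) (sq_nonneg _), ?_⟩
  set c := invSqrt (gram A w) *ᵥ A i with hc
  have h1 : c ⬝ᵥ c = h A w i := invSqrt_mulVec_sq hG (A i)
  have h2 : (c ⬝ᵥ x) ^ 2 ≤ (c ⬝ᵥ c) * (x ⬝ᵥ x) := by
    have := Finset.sum_mul_sq_le_sq_mul_sq Finset.univ c x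
    simpa only [dotProduct, pow_two] using this
  calc w i / p i * (c ⬝ᵥ x) ^ 2 ≤ w i / p i * ((c ⬝ᵥ c) * (x ⬝ᵥ x)) :=
        mul_le_mul_of_nonneg_left h2 (div_nonneg (hw i) (hp i))
    _ = w i * h A w i / p i * (x ⬝ᵥ x) := by rw [h1]; ring
    _ ≤ L * (x ⬝ᵥ x) := by
        refine mul_le_mul_of_nonneg_right ?_ hx
        rcases (hp i).eq_or_lt with h0 | h0
        · rw [← h0, div_zero]; exact hL0
        · rw [div_le_iff₀ h0]; exact hL i

open Classical in
theorem uniformLaw_not_goodSample_le_sum {w p : Fin n → ℝ} (hw : ∀ i, 0 ≤ w i)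
    (hG : (gram A w).PosDef) (hp : ∀ i, 0 ≤ p i) (hp1 : ∑ i, p i = 1) (hN : 0 < N) {ε : ℝ}
    (hε1 : ε < 1) :
    uniformLaw N {U | ¬ GoodSample A ε p U w} ≤
      ENNReal.ofReal (∑ f : Fin N → Fin n, (if ∃ x : Fin d → ℝ, ε * N * (x ⬝ᵥ x)
          < x ⬝ᵥ ((∑ t, (1 - sampleTerm A w p (f t))) *ᵥ x) then ∏ t, p (f t) else 0)
        + ∑ f : Fin N → Fin n, (if ∃ x : Fin d → ℝ, ε * N * (x ⬝ᵥ x)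
          < x ⬝ᵥ ((∑ t, (sampleTerm A w p (f t) - 1)) *ᵥ x) then ∏ t, p (f t) else 0)) := by
  refine (uniformLaw_le_sum_cells hp hp1 _ (fun f => (∃ x : Fin d → ℝ, ε * N * (x ⬝ᵥ x)
          < x ⬝ᵥ ((∑ t, (1 - sampleTerm A w p (f t))) *ᵥ x)) ∨ ∃ x : Fin d → ℝ, ε * N * (x ⬝ᵥ x)
          < x ⬝ᵥ ((∑ t, (sampleTerm A w p (f t) - 1)) *ᵥ x)) fun U hU f hf => ?_).trans ?_
  · by_contra! hcon
    exact hU (goodSample_of_quadForm hw hG hp hN hε1 hf hcon.1 hcon.2)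
  · refine ENNReal.ofReal_le_ofReal ?_
    rw [← Finset.sum_add_distrib]
    refine Finset.sum_le_sum fun f _ => ?_
    have : 0 ≤ ∏ t, p (f t) := Finset.prod_nonneg fun t _ => hp _
    split_ifs <;> first | linarith | tauto

theorem uniformLaw_not_goodSample_le {w p : Fin n → ℝ} (hd : 0 < d) (hw : ∀ i, 0 ≤ w i)
    (hG : (gram A w).PosDef) (hp : ∀ i, 0 ≤ p i) (hp1 : ∑ i, p i = 1) {L : ℝ} (hL1 : 1 ≤ L)
    (hL : ∀ i, w i * h A w i ≤ L * p i) (hN : 0 < N) {ε : ℝ} (hε0 : 0 < ε) (hε1 : ε < 1) :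
    uniformLaw N {U | ¬ GoodSample A ε p U w} ≤
      ENNReal.ofReal (2 * d * Real.exp (-(ε ^ 2 * N / (4 * L)))) := by
  classical
  have : Nonempty (Fin d) := ⟨⟨0, hd⟩⟩
  have hL0 : 0 < L := by linarith
  -- The minimizer of the exponent θ²LN - θεN, giving -ε²N/(4L).
  set θ := ε / (2 * L) with hθ
  have hθ0 : 0 < θ := by positivity
  have hθL : θ * L ≤ 1 := by
    have : θ * L = ε / 2 := by rw [hθ]; field_simp
    linarith
  have hθ1 : θ ≤ 1 := by nlinarith
  have hp0 : ∀ i, p i = 0 → w i * h A w i = 0 := fun i hi =>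
    le_antisymm (by simpa [hi] using hL i) (mul_nonneg (hw i) (h_nonneg hG i))
  have hmean := sum_smul_sampleTerm hG hp0
  have hX := isHermitian_sampleTerm (A := A) w p
  have hq := dotProduct_sampleTerm_mulVec_mem hw hp hG hL0.le hL
  have hnn : ∀ x : Fin d → ℝ, 0 ≤ x ⬝ᵥ x := fun x => by
    simp only [dotProduct]; exact Finset.sum_nonneg fun i _ => mul_self_nonneg _
  have hsq : ∑ i, p i • (sampleTerm A w p i - 1) ^ 2
      = ∑ i, p i • sampleTerm A w p i ^ 2 - 1 := by
    have e : ∀ i, p i • (sampleTerm A w p i - 1) ^ 2 = p i • sampleTerm A w p i ^ 2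
        - (2 : ℝ) • (p i • sampleTerm A w p i) + p i • (1 : Matrix (Fin d) (Fin d) ℝ) := fun i => by
      rw [smul_comm (2 : ℝ), ← smul_sub, ← smul_add, two_smul]
      congr 1
      noncomm_ring
    rw [Finset.sum_congr rfl fun i _ => e i, Finset.sum_add_distrib, Finset.sum_sub_distrib,
      ← Finset.smul_sum, hmean, ← Finset.sum_smul, hp1, one_smul, two_smul]
    abel
  -- The variance is E X² - 1, and X² ≤ LX with E X = 1 bounds it by L.
  have hV : (L • (1 : Matrix (Fin d) (Fin d) ℝ)
      - ∑ i, p i • (sampleTerm A w p i - 1) ^ 2).PosSemidef := by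
    have e : L • (1 : Matrix (Fin d) (Fin d) ℝ) - ∑ i, p i • (sampleTerm A w p i - 1) ^ 2
        = ∑ i, p i • (L • sampleTerm A w p i - sampleTerm A w p i ^ 2) + 1 := by
      rw [hsq]
      simp only [smul_sub, Finset.sum_sub_distrib]
      rw [Finset.sum_congr rfl fun i _ => smul_comm (p i) L _, ← Finset.smul_sum, hmean]
      abel
    rw [e]
    refine (Matrix.posSemidef_sum _ fun i _ => posSemidef_smul ?_ (hp i)).add Matrix.PosSemidef.one
    rw [sampleTerm_sq w p hG, ← sub_smul]
    refine posSemidef_smul (posSemidef_of_quadForm (hX i) fun x => (hq i x).1) ?_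
    rcases (hp i).eq_or_lt with h0 | h0
    · rw [← h0, div_zero]; linarith
    · rw [sub_nonneg, div_le_iff₀ h0]; exact hL i
  have hb1 := sum_prod_exists_quadForm_gt_le p hp hp1 (fun i => sampleTerm A w p i - 1)
    (isHermitian_sampleTerm_sub_one w p) (by
      simp only [smul_sub, Finset.sum_sub_distrib, hmean, ← Finset.sum_smul, hp1, one_smul,
        sub_self]) θ hθ0 (fun i => posSemidef_of_quadForm (Matrix.isHermitian_one.sub (by
          rw [Matrix.IsHermitian, Matrix.conjTranspose_smul, star_trivial,
            isHermitian_sampleTerm_sub_one])) fun x => by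
        simp only [Matrix.sub_mulVec, Matrix.smul_mulVec, Matrix.one_mulVec, dotProduct_sub,
          dotProduct_smul, smul_eq_mul]
        have h1 := hq i x
        nlinarith [hnn x, mul_le_mul_of_nonneg_left h1.2 hθ0.le,
          mul_le_mul_of_nonneg_right hθL (hnn x), mul_nonneg hθ0.le (hnn x)]) L hV N (ε * N)
  have hb2 := sum_prod_exists_quadForm_gt_le p hp hp1 (fun i => 1 - sampleTerm A w p i)
    (fun i => Matrix.isHermitian_one.sub (hX i)) (by
      simp only [smul_sub, Finset.sum_sub_distrib, hmean, ← Finset.sum_smul, hp1, one_smul,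
        sub_self]) θ hθ0 (fun i => posSemidef_of_quadForm (Matrix.isHermitian_one.sub (by
          rw [Matrix.IsHermitian, Matrix.conjTranspose_smul, star_trivial,
            (Matrix.isHermitian_one.sub (hX i))])) fun x => by
        simp only [Matrix.sub_mulVec, Matrix.smul_mulVec, Matrix.one_mulVec, dotProduct_sub,
          dotProduct_smul, smul_eq_mul]
        have h1 := hq i x
        nlinarith [hnn x, mul_nonneg hθ0.le h1.1,
          mul_le_mul_of_nonneg_right hθ1 (hnn x)]) L (by
      have e : ∀ i, (1 - sampleTerm A w p i) ^ 2 = (sampleTerm A w p i - 1) ^ 2 := fun i => by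
        noncomm_ring
      simpa only [e] using hV) N (ε * N)
  refine (uniformLaw_not_goodSample_le_sum hw hG hp hp1 hN hε1).trans (ENNReal.ofReal_le_ofReal ?_)
  have hexp : θ ^ 2 * L * N - θ * (ε * N) = -(ε ^ 2 * N / (4 * L)) := by
    rw [hθ]; field_simp; ring
  rw [hexp, Fintype.card_fin] at hb1 hb2
  calc _ ≤ d * Real.exp (-(ε ^ 2 * N / (4 * L))) + d * Real.exp (-(ε ^ 2 * N / (4 * L))) :=
        add_le_add hb2 hb1
    _ = _ := by ring

/-- With a single row, p = 1 and every sampled term is its mean, the identity. -/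
theorem uniformLaw_not_goodSample_eq_zero [Subsingleton (Fin n)] {w p : Fin n → ℝ}
    (hw : ∀ i, 0 ≤ w i) (hG : (gram A w).PosDef) (hp : ∀ i, 0 ≤ p i) (hp1 : ∑ i, p i = 1)
    (hN : 0 < N) {ε : ℝ} (hε0 : 0 < ε) (hε1 : ε < 1) :
    uniformLaw N {U | ¬ GoodSample A ε p U w} = 0 := by
  classical
  have hpi : ∀ i, p i = 1 := fun i => by
    rw [← hp1, Finset.sum_eq_single i (fun j _ hj => (hj (Subsingleton.elim j i)).elim)
      fun hi => (hi (Finset.mem_univ i)).elim]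
  have hX : ∀ i, sampleTerm A w p i = 1 := fun i => by
    have h1 := sum_smul_sampleTerm hG (p := p) fun j hj => by rw [hpi] at hj; norm_num at hj
    rwa [Finset.sum_eq_single i (fun j _ hj => (hj (Subsingleton.elim j i)).elim)
      fun hi => (hi (Finset.mem_univ i)).elim, hpi, one_smul] at h1
  refine le_antisymm ((uniformLaw_not_goodSample_le_sum hw hG hp hp1 hN hε1).trans ?_) zero_le
  have hnn : ∀ x : Fin d → ℝ, 0 ≤ ε * N * (x ⬝ᵥ x) := fun x =>
    mul_nonneg (by positivity) (by
      simp only [dotProduct]; exact Finset.sum_nonneg fun i _ => mul_self_nonneg _)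
  simp [hX, fun x => not_lt.2 (hnn x)]

end Sampling
end DPJohn

namespace DPJohn

/-! ### Products and exceptional events along a recursion driven by independent draws. -/

section RecursiveProcess

variable {Ω E V : Type*} [MeasurableSpace Ω] [MeasurableSpace E] [MeasurableSpace V]
  {P : Measure Ω} {μ : Measure E} {X : ℕ → Ω → E}

theorem indepFun_of_measurable_past (hXm : ∀ k, Measurable (X k)) (hind : iIndepFun X P) (m : ℕ)
    {Y : Ω → V}
    (hY : Measurable[⨆ k ∈ Set.Iio m, MeasurableSpace.comap (X k) inferInstance] Y) :
    IndepFun Y (X m) P := by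
  rw [IndepFun_iff_Indep]
  have h1 := indep_iSup_of_disjoint (m := fun k => MeasurableSpace.comap (X k) inferInstance)
    (fun k => (hXm k).comap_le) hind (S := Set.Iio m) (T := {m}) (by simp)
  refine indep_of_indep_of_le_left (indep_of_indep_of_le_right h1 ?_) hY.comap_le
  exact le_iSup₂_of_le m rfl le_rfl

/-- The tower property without conditional expectations: the past is independent of the m-th draw,
so the joint law is a product and Tonelli integrates the draw first, with the past frozen. -/
theorem lintegral_mul_le_of_measurable_past (hXm : ∀ k, Measurable (X k))
    (hlaw : ∀ k, P.map (X k) = μ) [IsProbabilityMeasure P] [IsProbabilityMeasure μ] (hind : iIndepFun X P) (m : ℕ)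
    {Z : Ω → ENNReal} {W : Ω → V}
    (hZ : Measurable[⨆ k ∈ Set.Iio m, MeasurableSpace.comap (X k) inferInstance] Z)
    (hW : Measurable[⨆ k ∈ Set.Iio m, MeasurableSpace.comap (X k) inferInstance] W)
    {f : E × V → ENNReal} (hf : Measurable f) {c : ENNReal}
    (hc : ∀ v, ∫⁻ x, f (x, v) ∂μ ≤ c) :
    ∫⁻ ω, Z ω * f (X m ω, W ω) ∂P ≤ c * ∫⁻ ω, Z ω ∂P := by
  have hle : (⨆ k ∈ Set.Iio m, MeasurableSpace.comap (X k) inferInstance)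
      ≤ (inferInstance : MeasurableSpace Ω) := iSup₂_le fun k _ => (hXm k).comap_le
  have hZW : Measurable[⨆ k ∈ Set.Iio m, MeasurableSpace.comap (X k) inferInstance]
      fun ω => (Z ω, W ω) := Measurable.prodMk hZ hW
  have hZW' : Measurable fun ω => (Z ω, W ω) := hZW.mono hle le_rfl
  have hI := indepFun_of_measurable_past hXm hind m hZW
  have hprod := (indepFun_iff_map_prod_eq_prod_map_map hZW'.aemeasurable
    (hXm m).aemeasurable).1 hI
  have hpm : IsProbabilityMeasure (P.map fun ω => (Z ω, W ω)) :=
    Measure.isProbabilityMeasure_map hZW'.aemeasurable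
  have hg : Measurable fun q : (ENNReal × V) × E => q.1.1 * f (q.2, q.1.2) :=
    (measurable_fst.comp measurable_fst).mul
      (hf.comp (measurable_snd.prodMk (measurable_snd.comp measurable_fst)))
  calc ∫⁻ ω, Z ω * f (X m ω, W ω) ∂P
      = ∫⁻ q, q.1.1 * f (q.2, q.1.2) ∂(P.map fun ω => ((Z ω, W ω), X m ω)) := by
        rw [lintegral_map hg (hZW'.prodMk (hXm m))]
    _ = ∫⁻ y, ∫⁻ x, y.1 * f (x, y.2) ∂μ ∂(P.map fun ω => (Z ω, W ω)) := by
        rw [hprod, hlaw, lintegral_prod _ hg.aemeasurable]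
    _ ≤ ∫⁻ y, c * y.1 ∂(P.map fun ω => (Z ω, W ω)) := by
        refine lintegral_mono fun y => ?_
        have hfm : Measurable fun x => f (x, y.2) :=
          hf.comp (measurable_id.prodMk measurable_const)
        rw [lintegral_const_mul _ hfm, mul_comm c]
        exact mul_le_mul_right (hc y.2) _
    _ = c * ∫⁻ ω, Z ω ∂P := by
        rw [lintegral_map (by fun_prop) hZW', lintegral_const_mul _ (hZ.mono hle le_rfl)]

theorem measurable_past_of_recursion {Ω E V : Type*} [MeasurableSpace E] [MeasurableSpace V]
    {X : ℕ → Ω → E} {g : ℕ → E × V → V} {w₀ : V} {W : ℕ → Ω → V} (hg : ∀ k, Measurable (g k))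
    (hW0 : ∀ ω, W 0 ω = w₀) (hWs : ∀ k ω, W (k + 1) ω = g k (X k ω, W k ω)) (m : ℕ) :
    Measurable[⨆ k ∈ Set.Iio m, MeasurableSpace.comap (X k) inferInstance] (W m) := by
  induction m with
  | zero =>
    have : W 0 = fun _ => w₀ := funext hW0
    rw [this]; exact measurable_const
  | succ m ih =>
    have : W (m + 1) = fun ω => g m (X m ω, W m ω) := funext (hWs m)
    rw [this]
    refine (hg m).comp (Measurable.prodMk ?_ (ih.mono ?_ le_rfl))
    · exact Measurable.mono (comap_measurable (X m))
        (le_iSup₂_of_le m (Set.mem_Iio.2 (Nat.lt_succ_self m)) le_rfl) le_rfl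
    · exact iSup₂_le fun k hk => le_iSup₂_of_le k
        (Set.mem_Iio.2 ((Set.mem_Iio.1 hk).trans (Nat.lt_succ_self m))) le_rfl

variable {g : ℕ → E × V → V} {w₀ : V} {W : ℕ → Ω → V}

/-- Peeling off the last factor gives c^m. The bound c is required at every state, which is why the
integrands used later vanish at bad states. -/
theorem lintegral_prod_recursion_le (hXm : ∀ k, Measurable (X k))
    (hlaw : ∀ k, P.map (X k) = μ) [IsProbabilityMeasure P] [IsProbabilityMeasure μ] (hind : iIndepFun X P)
    (hg : ∀ k, Measurable (g k))
    (hW0 : ∀ ω, W 0 ω = w₀) (hWs : ∀ k ω, W (k + 1) ω = g k (X k ω, W k ω))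
    {f : ℕ → E × V → ENNReal} (hf : ∀ k, Measurable (f k)) {c : ENNReal}
    (hc : ∀ k v, ∫⁻ x, f k (x, v) ∂μ ≤ c) (m : ℕ) :
    ∫⁻ ω, ∏ k ∈ Finset.range m, f k (X k ω, W k ω) ∂P ≤ c ^ m := by
  have hZ : ∀ m, Measurable[⨆ k ∈ Set.Iio m, MeasurableSpace.comap (X k) inferInstance]
      fun ω => ∏ k ∈ Finset.range m, f k (X k ω, W k ω) := fun m => by
    refine Finset.measurable_fun_prod _ fun k hk => ?_
    have hk' := Finset.mem_range.1 hk
    refine (hf k).comp (Measurable.prodMk ?_ ((measurable_past_of_recursion hg hW0 hWs k).mono ?_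
      le_rfl))
    · exact Measurable.mono (comap_measurable (X k)) (le_iSup₂_of_le k hk' le_rfl) le_rfl
    · exact iSup₂_le fun j hj => le_iSup₂_of_le j
        (Set.mem_Iio.2 ((Set.mem_Iio.1 hj).trans hk')) le_rfl
  induction m with
  | zero => simp
  | succ m ih =>
    simp only [Finset.prod_range_succ]
    refine (lintegral_mul_le_of_measurable_past hXm hlaw hind m (hZ m)
      (measurable_past_of_recursion hg hW0 hWs m) (hf m) (hc m)).trans ?_
    rw [pow_succ']
    exact mul_le_mul_right ih _

theorem measure_exists_recursion_le (hXm : ∀ k, Measurable (X k))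
    (hlaw : ∀ k, P.map (X k) = μ) [IsProbabilityMeasure P] [IsProbabilityMeasure μ] (hind : iIndepFun X P)
    (hg : ∀ k, Measurable (g k))
    (hW0 : ∀ ω, W 0 ω = w₀) (hWs : ∀ k ω, W (k + 1) ω = g k (X k ω, W k ω))
    {B : ℕ → Set (E × V)} (hB : ∀ k, MeasurableSet (B k)) {q : ENNReal}
    (hq : ∀ k v, μ {x | (x, v) ∈ B k} ≤ q) (m : ℕ) :
    P {ω | ∃ k < m, (X k ω, W k ω) ∈ B k} ≤ m * q := by
  have h1 : ∀ k, P {ω | (X k ω, W k ω) ∈ B k} ≤ q := fun k => by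
    have hle : (⨆ j ∈ Set.Iio k, MeasurableSpace.comap (X j) inferInstance)
        ≤ (inferInstance : MeasurableSpace Ω) := iSup₂_le fun k _ => (hXm k).comap_le
    have hWk := measurable_past_of_recursion hg hW0 hWs k
    have h2 := lintegral_mul_le_of_measurable_past hXm hlaw hind k (Z := fun _ => 1)
      measurable_const hWk (f := (B k).indicator 1)
      (measurable_const.indicator (hB k)) (c := q) fun v => by
        have e : (fun x => (B k).indicator (1 : E × V → ENNReal) (x, v))
            = {x | (x, v) ∈ B k}.indicator 1 := by
          rfl
        have hm : MeasurableSet {x | (x, v) ∈ B k} :=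
          (hB k).preimage (measurable_id.prodMk measurable_const)
        rw [e, lintegral_indicator_one hm]
        exact hq k v
    simp only [one_mul, lintegral_const, measure_univ, mul_one] at h2
    have e : (fun ω => (B k).indicator (1 : E × V → ENNReal) (X k ω, W k ω))
        = {ω | (X k ω, W k ω) ∈ B k}.indicator 1 := by
      rfl
    have hm : MeasurableSet {ω | (X k ω, W k ω) ∈ B k} :=
      (hB k).preimage ((hXm k).prodMk (hWk.mono hle le_rfl))
    rwa [e, lintegral_indicator_one hm] at h2
  have h3 : {ω | ∃ k < m, (X k ω, W k ω) ∈ B k}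
      = ⋃ k ∈ Finset.range m, {ω | (X k ω, W k ω) ∈ B k} := by ext; simp
  rw [h3]
  refine (measure_biUnion_finset_le _ _).trans ((Finset.sum_le_card_nsmul _ _ q fun k _ => h1 k).trans
    ?_)
  simp

end RecursiveProcess
end DPJohn

namespace DPJohn

/-! ### One iteration: failure probability and moment bounds. -/

section Iteration

variable {n d s N : ℕ} {A : Matrix (Fin n) (Fin d) ℝ} {R : Type*}

theorem step_eq (τ : R → (Fin n → ℝ) → Fin n → ℝ) (x : Draw R n d s N) (w : Fin n → ℝ)
    (i : Fin n) :
    step A τ x w i = 1 / (s : ℝ) *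
      sketchSq x.2.2.1 (whitenedRow A (samplingProb (τ x.1 w)) x.2.1 w i) * (1 + x.2.2.2 i) := by
  rw [step, sketchedWeight_eq]

variable [MeasurableSpace R]

theorem measurable_step {τ : R → (Fin n → ℝ) → Fin n → ℝ}
    (hτ : Measurable fun q : R × (Fin n → ℝ) => τ q.1 q.2) :
    Measurable fun q : Draw R n d s N × (Fin n → ℝ) => step A τ q.1 q.2 := by
  refine measurable_pi_lambda _ fun i => ?_
  simp only [step_eq]
  have hτ' : ∀ i, Measurable fun q : Draw R n d s N × (Fin n → ℝ) => τ q.1.1 q.2 i := fun i =>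
    (measurable_pi_apply i).comp
      (hτ.comp ((measurable_fst.comp measurable_fst).prodMk measurable_snd))
  have hv : ∀ a, Measurable fun q : Draw R n d s N × (Fin n → ℝ) =>
      whitenedRow A (samplingProb (τ q.1.1 q.2)) q.1.2.1 q.2 i a := fun a =>
    measurable_whitenedRow A (fun i => measurable_samplingProb hτ' i)
      (fun t => by fun_prop) (fun i => by fun_prop) i a
  exact ((measurable_sketchSq_comp (fun i j => by fun_prop) hv).const_mul _).mul (by fun_prop)

theorem measurableSet_admissible : MeasurableSet {w : Fin n → ℝ | Admissible A w} := by
  have : {w : Fin n → ℝ | Admissible A w}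
      = ⋂ i, ({w | 0 ≤ w i} ∩ {w | A i ≠ 0 → 0 < w i}) := by
    ext w; simp [Admissible]
  rw [this]
  refine MeasurableSet.iInter fun i => (measurableSet_le measurable_const
    (measurable_pi_apply i)).inter ?_
  by_cases h : A i = 0
  · simp [h]
  · simp only [ne_eq, h, not_false_eq_true, true_imp_iff]
    exact measurableSet_lt measurable_const (measurable_pi_apply i)

/-- The draws and weights for which the row sampling of the iteration is accurate. -/
def goodSet (A : Matrix (Fin n) (Fin d) ℝ) (ε : ℝ) (τ : R → (Fin n → ℝ) → Fin n → ℝ) :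
    Set (Draw R n d s N × (Fin n → ℝ)) :=
  {q | GoodSample A ε (samplingProb (τ q.1.1 q.2)) q.1.2.1 q.2}

theorem measurableSet_goodSet {τ : R → (Fin n → ℝ) → Fin n → ℝ} (ε : ℝ)
    (hτ : Measurable fun q : R × (Fin n → ℝ) => τ q.1 q.2) :
    MeasurableSet (goodSet (s := s) (N := N) A ε τ) := by
  have hτ' : ∀ i, Measurable fun q : Draw R n d s N × (Fin n → ℝ) => τ q.1.1 q.2 i := fun i =>
    (measurable_pi_apply i).comp
      (hτ.comp ((measurable_fst.comp measurable_fst).prodMk measurable_snd))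
  have hv : ∀ i a, Measurable fun q : Draw R n d s N × (Fin n → ℝ) =>
      whitenedRow A (samplingProb (τ q.1.1 q.2)) q.1.2.1 q.2 i a := fun i a =>
    measurable_whitenedRow A (fun i => measurable_samplingProb hτ' i)
      (fun t => by fun_prop) (fun i => by fun_prop) i a
  have hvv : ∀ i, Measurable fun q : Draw R n d s N × (Fin n → ℝ) =>
      whitenedRow A (samplingProb (τ q.1.1 q.2)) q.1.2.1 q.2 i ⬝ᵥ
        whitenedRow A (samplingProb (τ q.1.1 q.2)) q.1.2.1 q.2 i := fun i => by
    simp only [dotProduct]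
    exact Finset.measurable_fun_sum _ fun a _ => (hv i a).mul (hv i a)
  have hl : ∀ i, Measurable fun q : Draw R n d s N × (Fin n → ℝ) => q.2 i * h A q.2 i := fun i =>
    Measurable.mul (by fun_prop) (measurable_h A (fun i => by fun_prop) i)
  simp only [goodSet, GoodSample, Set.ofPred_forall, Set.ofPred_and]
  exact MeasurableSet.iInter fun i => (measurableSet_le (hl i) ((hvv i).const_mul _)).inter
    (measurableSet_le ((hvv i).const_mul _) (hl i))

variable {ν : Measure R}

theorem isProbabilityMeasure_drawLaw [IsProbabilityMeasure ν] {σ : ℝ} (hσ : σ ^ 2 ≤ 1 / 8) :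
    IsProbabilityMeasure (drawLaw ν n d s N σ) := by
  have := isProbabilityMeasure_truncGaussian hσ
  have : IsProbabilityMeasure ((volume : Measure ℝ).restrict (Set.Icc 0 1)) :=
    ⟨by simp⟩
  rw [drawLaw]
  infer_instance

theorem lintegral_drawLaw_eq {σ : ℝ} (hσ : σ ^ 2 ≤ 1 / 8) {f : Draw R n d s N → ENNReal}
    (hf : Measurable f) :
    ∫⁻ x, f x ∂(drawLaw ν n d s N σ) = ∫⁻ r, ∫⁻ U, ∫⁻ S, ∫⁻ z, f (r, U, S, z)
      ∂(noiseLaw n σ) ∂(sketchLaw s d) ∂(uniformLaw N) ∂ν := by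
  have := isProbabilityMeasure_truncGaussian hσ
  rw [drawLaw, lintegral_prod _ hf.aemeasurable]
  refine lintegral_congr fun r => ?_
  have h1 : Measurable fun y : (Fin N → ℝ) × (Fin s → Fin d → ℝ) × (Fin n → ℝ) => f (r, y) :=
    hf.comp (measurable_const.prodMk measurable_id)
  rw [lintegral_prod _ h1.aemeasurable]
  refine lintegral_congr fun U => ?_
  have h2 : Measurable fun y : (Fin s → Fin d → ℝ) × (Fin n → ℝ) => f (r, U, y) :=
    h1.comp (measurable_const.prodMk measurable_id)
  rw [lintegral_prod _ h2.aemeasurable]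

variable [IsProbabilityMeasure ν]

theorem isProbabilityMeasure_uniformLaw : IsProbabilityMeasure (uniformLaw N) := by
  have : IsProbabilityMeasure ((volume : Measure ℝ).restrict (Set.Icc 0 1)) := ⟨by simp⟩
  infer_instance

theorem lintegral_drawLaw_le {σ : ℝ} (hσ : σ ^ 2 ≤ 1 / 8) {f : Draw R n d s N → ENNReal}
    (hf : Measurable f) {c : ENNReal}
    (hc : ∀ r U, ∫⁻ S, ∫⁻ z, f (r, U, S, z) ∂(noiseLaw n σ) ∂(sketchLaw s d) ≤ c) :
    ∫⁻ x, f x ∂(drawLaw ν n d s N σ) ≤ c := by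
  have := isProbabilityMeasure_uniformLaw (N := N)
  rw [lintegral_drawLaw_eq hσ hf]
  calc _ ≤ ∫⁻ _ : R, ∫⁻ _ : Fin N → ℝ, c ∂(uniformLaw N) ∂ν :=
        lintegral_mono fun r => lintegral_mono fun U => hc r U
    _ = c := by simp

theorem GoodSample.pos {ε : ℝ} (hε0 : 0 < ε) (hA : A.rank = d) {w p : Fin n → ℝ} {U : Fin N → ℝ}
    (hw : Admissible A w) (hgood : GoodSample A ε p U w) {i : Fin n} (hi : A i ≠ 0) :
    0 < whitenedRow A p U w i ⬝ᵥ whitenedRow A p U w i := by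
  have h1 := (hgood i).1
  have h2 := mul_pos ((hw i).2 hi) (h_pos (hw.posDef_gram hA) hi)
  exact pos_of_mul_pos_right (h2.trans_le h1) (by linarith)

/-- The null set of seeds with poor leverage approximations may depend on w; it is harmless because
w is fixed here. -/
theorem drawLaw_not_goodSet_le {σ : ℝ} (hσ : σ ^ 2 ≤ 1 / 8) {ε : ℝ}
    (hd : 0 < d) {κ : ℝ} (hκ : 1 ≤ κ) {τ : R → (Fin n → ℝ) → Fin n → ℝ}
    (hτ : IsLeverageApprox ν A κ τ) {q : ENNReal} {w : Fin n → ℝ} (hw : ∀ i, 0 ≤ w i)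
    (hG : (gram A w).PosDef)
    (hq : ∀ p : Fin n → ℝ, (∀ i, 0 ≤ p i) → ∑ i, p i = 1 →
      (∀ i, w i * h A w i ≤ κ ^ 2 * d * p i) →
        uniformLaw N {U | ¬ GoodSample A ε p U w} ≤ q) :
    drawLaw ν n d s N σ {x | (x, w) ∉ goodSet A ε τ} ≤ q := by
  have := isProbabilityMeasure_truncGaussian hσ
  have hgm : MeasurableSet {x : Draw R n d s N | (x, w) ∉ goodSet A ε τ} :=
    (measurableSet_goodSet ε hτ.measurable).compl.preimage (measurable_id.prodMk measurable_const)
  rw [← lintegral_indicator_one hgm, lintegral_drawLaw_eq hσ (measurable_one.indicator hgm)]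
  calc _ = ∫⁻ r, uniformLaw N {U | ¬ GoodSample A ε (samplingProb (τ r w)) U w} ∂ν := by
        refine lintegral_congr fun r => ?_
        have hm : MeasurableSet {U : Fin N → ℝ | ¬ GoodSample A ε (samplingProb (τ r w)) U w} := by
          have h1 : Measurable fun U : Fin N → ℝ => (((r, U, 0, 0) : Draw R n d s N), w) :=
            (measurable_const.prodMk (measurable_id.prodMk measurable_const)).prodMk
              measurable_const
          exact (measurableSet_goodSet (s := s) ε hτ.measurable).compl.preimage h1
        rw [← lintegral_indicator_one hm]
        refine lintegral_congr fun U => ?_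
        have h2 : ∀ (S : Fin s → Fin d → ℝ) (z : Fin n → ℝ),
            ({x | (x, w) ∉ goodSet A ε τ} : Set (Draw R n d s N)).indicator
              (1 : Draw R n d s N → ENNReal) (r, U, S, z)
            = {U | ¬ GoodSample A ε (samplingProb (τ r w)) U w}.indicator 1 U := by
          intro S z
          by_cases hU : GoodSample A ε (samplingProb (τ r w)) U w
          · rw [Set.indicator_of_notMem (show (r, U, S, z) ∉ {x : Draw R n d s N |
              (x, w) ∉ goodSet A ε τ} from not_not.2 hU), Set.indicator_of_notMem (not_not.2 hU)]
          · rw [Set.indicator_of_mem (show (r, U, S, z) ∈ {x : Draw R n d s N |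
              (x, w) ∉ goodSet A ε τ} from hU), Set.indicator_of_mem hU]
            rfl
        simp only [h2, lintegral_const, measure_univ, mul_one]
    _ ≤ ∫⁻ _, q ∂ν := by
        refine lintegral_mono_ae ?_
        filter_upwards [hτ.bounds w hw hG] with r hr
        obtain ⟨h1, h2, h3⟩ := samplingProb_properties hκ hd hw hG hr
        exact hq _ h1 h2 h3
    _ = q := by simp

/-- After an accurate sample every nonzero row has a nonzero whitened vector, so its sketch is
almost surely positive, and the noise factor is at least 1/2. -/
theorem drawLaw_not_admissible_step_eq_zero {σ : ℝ} (hσ : σ ^ 2 ≤ 1 / 8) {ε : ℝ} (hε0 : 0 < ε)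
    (hA : A.rank = d) (hs : 0 < s) {τ : R → (Fin n → ℝ) → Fin n → ℝ}
    (hτ : Measurable fun q : R × (Fin n → ℝ) => τ q.1 q.2) {w : Fin n → ℝ}
    (hw : Admissible A w) :
    drawLaw ν n d s N σ {x | (x, w) ∈ goodSet A ε τ ∧ ¬ Admissible A (step A τ x w)} = 0 := by
  have := isProbabilityMeasure_truncGaussian hσ
  have h0 : Measurable fun x : Draw R n d s N => (x, w) := measurable_id.prodMk measurable_const
  have h1 := (measurable_step (s := s) (N := N) (A := A) hτ).comp h0
  simp only [Function.comp_def] at h1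
  have hm : MeasurableSet {x : Draw R n d s N |
      (x, w) ∈ goodSet A ε τ ∧ ¬ Admissible A (step A τ x w)} :=
    ((measurableSet_goodSet ε hτ).preimage h0).inter
      (h1 measurableSet_admissible.compl)
  set E := {x : Draw R n d s N | (x, w) ∈ goodSet A ε τ ∧ ¬ Admissible A (step A τ x w)} with hE
  rw [← nonpos_iff_eq_zero, ← lintegral_indicator_one hm]
  refine lintegral_drawLaw_le (f := E.indicator 1) hσ (measurable_one.indicator hm) fun r U => ?_
  rw [nonpos_iff_eq_zero]
  suffices hS : ∀ᵐ S ∂(sketchLaw s d), ∫⁻ z, E.indicator (1 : Draw R n d s N → ENNReal)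
      (r, U, S, z) ∂(noiseLaw n σ) = 0 by
    rw [lintegral_congr_ae hS, lintegral_zero]
  by_cases hgood : GoodSample A ε (samplingProb (τ r w)) U w
  swap
  · refine Filter.Eventually.of_forall fun S => ?_
    have h2 : ∀ z : Fin n → ℝ, E.indicator (1 : Draw R n d s N → ENNReal) (r, U, S, z) = 0 :=
      fun z => Set.indicator_of_notMem (fun hmem => hgood hmem.1) _
    simp only [h2, lintegral_zero]
  have hS : ∀ᵐ S ∂(sketchLaw s d), ∀ i, A i ≠ 0 →
      0 < sketchSq S (whitenedRow A (samplingProb (τ r w)) U w i) := by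
    rw [ae_all_iff]
    intro i
    by_cases hi : A i = 0
    · exact Filter.Eventually.of_forall fun S h => (h hi).elim
    · filter_upwards [ae_sketchSq_pos hs _ (hgood.pos hε0 hA hw hi)] with S hS _ using hS
  have hz : ∀ᵐ z ∂(noiseLaw n σ), ∀ i, z i ∈ Set.Icc (-1 / 2 : ℝ) (1 / 2) := by
    rw [ae_all_iff]
    intro i
    exact (Measure.quasiMeasurePreserving_eval (μ := fun _ : Fin n => truncGaussian 0 σ) i).ae
      (ae_mem_Icc_truncGaussian σ)
  filter_upwards [hS] with S hS
  have h3 : ∀ᵐ z ∂(noiseLaw n σ), E.indicator (1 : Draw R n d s N → ENNReal) (r, U, S, z) = 0 := by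
    filter_upwards [hz] with z hz
    refine Set.indicator_of_notMem (fun hmem => hmem.2 fun i => ?_) _
    have hz1 : 0 < 1 + z i := by linarith [(hz i).1]
    have hs' : (0 : ℝ) < s := by exact_mod_cast hs
    rw [step_eq]
    exact ⟨mul_nonneg (mul_nonneg (by positivity) (sketchSq_nonneg _ _)) hz1.le,
      fun hi => mul_pos (mul_pos (by positivity) (hS i hi)) hz1⟩
  rw [lintegral_congr_ae h3, lintegral_zero]

/-- The draws and weights for which the sampling fails or the next weight is not admissible. -/
def badSet (A : Matrix (Fin n) (Fin d) ℝ) (ε : ℝ) (τ : R → (Fin n → ℝ) → Fin n → ℝ) :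
    Set (Draw R n d s N × (Fin n → ℝ)) :=
  {y | Admissible A y.2 ∧ ¬ (y ∈ goodSet A ε τ ∧ Admissible A (step A τ y.1 y.2))}

theorem measurableSet_badSet {τ : R → (Fin n → ℝ) → Fin n → ℝ} (ε : ℝ)
    (hτ : Measurable fun q : R × (Fin n → ℝ) => τ q.1 q.2) :
    MeasurableSet (badSet (s := s) (N := N) A ε τ) :=
  (measurableSet_admissible.preimage measurable_snd).inter
    (((measurableSet_goodSet ε hτ).inter
      (measurableSet_admissible.preimage (measurable_step hτ))).compl)

theorem drawLaw_badSet_le {σ : ℝ} (hσ : σ ^ 2 ≤ 1 / 8) {ε : ℝ} (hε0 : 0 < ε) (hA : A.rank = d)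
    (hd : 0 < d) (hs : 0 < s) {κ : ℝ} (hκ : 1 ≤ κ) {τ : R → (Fin n → ℝ) → Fin n → ℝ}
    (hτ : IsLeverageApprox ν A κ τ) {q : ENNReal}
    (hq : ∀ w p : Fin n → ℝ, (∀ i, 0 ≤ w i) → (gram A w).PosDef → (∀ i, 0 ≤ p i) →
      ∑ i, p i = 1 → (∀ i, w i * h A w i ≤ κ ^ 2 * d * p i) →
        uniformLaw N {U | ¬ GoodSample A ε p U w} ≤ q) (w : Fin n → ℝ) :
    drawLaw ν n d s N σ {x | (x, w) ∈ badSet A ε τ} ≤ q := by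
  by_cases hw : Admissible A w
  swap
  · have : {x : Draw R n d s N | (x, w) ∈ badSet A ε τ} = ∅ :=
      Set.eq_empty_of_forall_notMem fun x hx => hw hx.1
    rw [this, measure_empty]
    exact zero_le
  have hsub : {x : Draw R n d s N | (x, w) ∈ badSet A ε τ} ⊆ {x | (x, w) ∉ goodSet A ε τ} ∪
      {x | (x, w) ∈ goodSet A ε τ ∧ ¬ Admissible A (step A τ x w)} := by
    intro x hx
    by_cases hxg : (x, w) ∈ goodSet A ε τ
    · exact Or.inr ⟨hxg, fun h => hx.2 ⟨hxg, h⟩⟩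
    · exact Or.inl hxg
  refine (measure_mono hsub).trans ((measure_union_le _ _).trans ?_)
  rw [drawLaw_not_admissible_step_eq_zero hσ hε0 hA hs hτ.measurable hw, add_zero]
  exact drawLaw_not_goodSet_le hσ hd hκ hτ (fun i => (hw i).1) (hw.posDef_gram hA)
    fun p => hq w p (fun i => (hw i).1) (hw.posDef_gram hA)

/-- The ratio of the leverage score to the new weight, on the event that the sampling succeeds. -/
noncomputable def ratioFn (A : Matrix (Fin n) (Fin d) ℝ) (ε : ℝ)
    (τ : R → (Fin n → ℝ) → Fin n → ℝ) (i : Fin n) (q : Draw R n d s N × (Fin n → ℝ)) : ENNReal :=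
  ({y | Admissible A y.2} ∩ goodSet A ε τ).indicator
    (fun y => ENNReal.ofReal (y.2 i * h A y.2 i * (step A τ y.1 y.2 i)⁻¹)) q

/-- The exponential of the excess of the total new weight, on the event that the sampling
succeeds. -/
noncomputable def massFn (A : Matrix (Fin n) (Fin d) ℝ) (ε : ℝ)
    (τ : R → (Fin n → ℝ) → Fin n → ℝ) (q : Draw R n d s N × (Fin n → ℝ)) : ENNReal :=
  ({y | Admissible A y.2} ∩ goodSet A ε τ).indicator
    (fun y => ENNReal.ofReal (Real.exp (1 / (2 * d) * ∑ i, step A τ y.1 y.2 i - 1 / 2))) q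

theorem measurableSet_admissible_goodSet {τ : R → (Fin n → ℝ) → Fin n → ℝ} (ε : ℝ)
    (hτ : Measurable fun q : R × (Fin n → ℝ) => τ q.1 q.2) :
    MeasurableSet ({y : Draw R n d s N × (Fin n → ℝ) | Admissible A y.2} ∩ goodSet A ε τ) :=
  (measurableSet_admissible.preimage measurable_snd).inter (measurableSet_goodSet ε hτ)

theorem measurable_ratioFn {τ : R → (Fin n → ℝ) → Fin n → ℝ} (ε : ℝ)
    (hτ : Measurable fun q : R × (Fin n → ℝ) => τ q.1 q.2) (i : Fin n) :
    Measurable (ratioFn (s := s) (N := N) A ε τ i) := by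
  refine Measurable.indicator ?_ (measurableSet_admissible_goodSet ε hτ)
  refine Measurable.ennreal_ofReal (Measurable.mul (Measurable.mul (by fun_prop)
    (measurable_h A (fun i => by fun_prop) i)) ?_)
  exact ((measurable_pi_apply i).comp (measurable_step hτ)).inv

theorem measurable_massFn {τ : R → (Fin n → ℝ) → Fin n → ℝ} (ε : ℝ)
    (hτ : Measurable fun q : R × (Fin n → ℝ) => τ q.1 q.2) :
    Measurable (massFn (s := s) (N := N) A ε τ) := by
  refine Measurable.indicator ?_ (measurableSet_admissible_goodSet ε hτ)
  have h1 : Measurable fun y : Draw R n d s N × (Fin n → ℝ) => ∑ i, step A τ y.1 y.2 i :=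
    Finset.measurable_fun_sum _ fun i _ => (measurable_pi_apply i).comp (measurable_step hτ)
  fun_prop

/-- Given seed and sample, the whitened row v is fixed, so the inverse moment applies with 1/‖v‖².
Accuracy of the sample turns w_i h_i / ‖v‖² into 1 + ε. -/
theorem lintegral_ratioFn_le {σ : ℝ} (hσ : σ ^ 2 ≤ 1 / 8) {ε : ℝ} (hε0 : 0 < ε)
    (hA : A.rank = d) (hs : 2 < s) {τ : R → (Fin n → ℝ) → Fin n → ℝ}
    (hτ : Measurable fun q : R × (Fin n → ℝ) => τ q.1 q.2) (i : Fin n) (w : Fin n → ℝ) :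
    ∫⁻ x, ratioFn (N := N) A ε τ i (x, w) ∂(drawLaw ν n d s N σ)
      ≤ ENNReal.ofReal ((1 + ε) * ((s : ℝ) / (s - 2) * (1 + 4 * σ ^ 2))) := by
  have hs' : (2 : ℝ) < s := by exact_mod_cast hs
  refine lintegral_drawLaw_le (f := fun x => ratioFn (N := N) A ε τ i (x, w)) hσ
    ((measurable_ratioFn ε hτ i).comp
    (measurable_id.prodMk measurable_const)) fun r U => ?_
  by_cases hwg : Admissible A w ∧ GoodSample A ε (samplingProb (τ r w)) U w
  swap
  · have h2 : ∀ (S : Fin s → Fin d → ℝ) (z : Fin n → ℝ),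
        ratioFn (s := s) A ε τ i ((r, U, S, z), w) = 0 := fun S z =>
      Set.indicator_of_notMem (show ((r, U, S, z), w) ∉ ({y : Draw R n d s N × (Fin n → ℝ) |
        Admissible A y.2} ∩ goodSet A ε τ) from fun hmem => hwg ⟨hmem.1, hmem.2⟩) _
    simp [h2]
  obtain ⟨hw, hgood⟩ := hwg
  have h2 : ∀ (S : Fin s → Fin d → ℝ) (z : Fin n → ℝ),
        ratioFn (s := s) A ε τ i ((r, U, S, z), w)
      = ENNReal.ofReal (w i * h A w i) * ENNReal.ofReal (1 / (s : ℝ) *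
        sketchSq S (whitenedRow A (samplingProb (τ r w)) U w i) * (1 + z i))⁻¹ := fun S z => by
    rw [← ENNReal.ofReal_mul (mul_nonneg (hw i).1 (h_nonneg (hw.posDef_gram hA) i)), ← step_eq τ
      (r, U, S, z) w i]
    exact Set.indicator_of_mem (show ((r, U, S, z), w) ∈ ({y : Draw R n d s N × (Fin n → ℝ) |
      Admissible A y.2} ∩ goodSet A ε τ) from ⟨hw, hgood⟩) _
  simp only [h2]
  by_cases hi : A i = 0
  · simp [h_eq_zero hi]
  have hv := hgood.pos hε0 hA hw hi
  set v := whitenedRow A (samplingProb (τ r w)) U w i with hvdef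
  calc _ = ENNReal.ofReal (w i * h A w i) * ∫⁻ S, ∫⁻ z, ENNReal.ofReal (1 / (s : ℝ) *
        sketchSq S v * (1 + z i))⁻¹ ∂(noiseLaw n σ) ∂(sketchLaw s d) := by
        rw [← lintegral_const_mul' _ _ ENNReal.ofReal_ne_top]
        exact lintegral_congr fun S => lintegral_const_mul' _ _ ENNReal.ofReal_ne_top
    _ ≤ ENNReal.ofReal (w i * h A w i) * ENNReal.ofReal
        ((s : ℝ) / (s - 2) * (1 + 4 * σ ^ 2) * (v ⬝ᵥ v)⁻¹) :=
        mul_le_mul_right (lintegral_inv_noisy_sketchSq_le hs hσ v hv i) _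
    _ ≤ _ := by
        rw [← ENNReal.ofReal_mul (mul_nonneg (hw i).1 (h_nonneg (hw.posDef_gram hA) i))]
        refine ENNReal.ofReal_le_ofReal ?_
        have h3 := (hgood i).1
        rw [← hvdef] at h3
        have h4 : w i * h A w i * (v ⬝ᵥ v)⁻¹ ≤ 1 + ε := by
          rw [← div_eq_mul_inv, div_le_iff₀ hv]; exact h3
        have h5 : 0 ≤ (s : ℝ) / (s - 2) * (1 + 4 * σ ^ 2) :=
          mul_nonneg (div_nonneg (by linarith) (by linarith)) (by positivity)
        calc _ = w i * h A w i * (v ⬝ᵥ v)⁻¹ * ((s : ℝ) / (s - 2) * (1 + 4 * σ ^ 2)) := by ring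
          _ ≤ _ := mul_le_mul_of_nonneg_right h4 h5

theorem lintegral_massFn_le {σ : ℝ} (hσ : σ ^ 2 ≤ 1 / 8) {ε : ℝ} (hε0 : 0 < ε) (hε1 : ε ≤ 1 / 2)
    (hA : A.rank = d) (hd : 0 < d) (hs : 6 ≤ s) {τ : R → (Fin n → ℝ) → Fin n → ℝ}
    (hτ : Measurable fun q : R × (Fin n → ℝ) => τ q.1 q.2) (w : Fin n → ℝ) :
    ∫⁻ x, massFn (N := N) A ε τ (x, w) ∂(drawLaw ν n d s N σ)
      ≤ ENNReal.ofReal (Real.exp (ε + 5 / s + 2 * σ ^ 2)) := by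
  have hs' : (6 : ℝ) ≤ s := by exact_mod_cast hs
  have hd' : (0 : ℝ) < d := by exact_mod_cast hd
  refine lintegral_drawLaw_le (f := fun x => massFn (N := N) A ε τ (x, w)) hσ
    ((measurable_massFn ε hτ).comp
    (measurable_id.prodMk measurable_const)) fun r U => ?_
  by_cases hwg : Admissible A w ∧ GoodSample A ε (samplingProb (τ r w)) U w
  swap
  · have h2 : ∀ (S : Fin s → Fin d → ℝ) (z : Fin n → ℝ),
        massFn (s := s) A ε τ ((r, U, S, z), w) = 0 := fun S z =>
      Set.indicator_of_notMem (show ((r, U, S, z), w) ∉ ({y : Draw R n d s N × (Fin n → ℝ) |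
        Admissible A y.2} ∩ goodSet A ε τ) from fun hmem => hwg ⟨hmem.1, hmem.2⟩) _
    simp [h2]
  obtain ⟨hw, hgood⟩ := hwg
  set v := whitenedRow A (samplingProb (τ r w)) U w with hvdef
  have h2 : ∀ (S : Fin s → Fin d → ℝ) (z : Fin n → ℝ),
        massFn (s := s) A ε τ ((r, U, S, z), w)
      = ENNReal.ofReal (Real.exp (-(1 / 2))) * ENNReal.ofReal (Real.exp (1 / (2 * d) *
        ∑ i, 1 / (s : ℝ) * sketchSq S (v i) * (1 + z i))) := fun S z => by
    rw [← ENNReal.ofReal_mul (Real.exp_pos _).le, ← Real.exp_add]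
    refine (Set.indicator_of_mem (show ((r, U, S, z), w) ∈ ({y : Draw R n d s N × (Fin n → ℝ) |
      Admissible A y.2} ∩ goodSet A ε τ) from ⟨hw, hgood⟩) _).trans ?_
    simp only [step_eq]
    congr 2
    ring
  have hsum1 : (d : ℝ) ≤ (1 + ε) * ∑ i, v i ⬝ᵥ v i := by
    rw [← sum_mul_h (hw.posDef_gram hA), Finset.mul_sum]
    exact Finset.sum_le_sum fun i _ => (hgood i).1
  have hsum2 : (1 - ε) * ∑ i, v i ⬝ᵥ v i ≤ d := by
    rw [← sum_mul_h (hw.posDef_gram hA), Finset.mul_sum]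
    exact Finset.sum_le_sum fun i _ => (hgood i).2
  have hQ : 0 < ∑ i, v i ⬝ᵥ v i := pos_of_mul_pos_right (hd'.trans_le hsum1) (by linarith)
  set Q := ∑ i, v i ⬝ᵥ v i with hQdef
  -- Accuracy and ∑ w_i h_i = d put Q within a factor of about 1 ± ε of d, so a is near 1/2. The
  -- scale 1/(2d) leaves room for a ≤ 1, as the exponential moment requires, and the -1/2 in
  -- `massFn` centres it.
  set a := 1 / (2 * d) * Q with ha
  have ha0 : 0 ≤ a := by positivity
  have hda : 2 * d * a = Q := by rw [ha]; field_simp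
  have ha2 : (1 - ε) * a ≤ 1 / 2 := by
    rw [← hda] at hsum2
    nlinarith
  have ha1 : a ≤ 1 := by nlinarith
  have ha3 : a - 1 / 2 ≤ ε := by nlinarith
  simp only [h2]
  calc _ = ENNReal.ofReal (Real.exp (-(1 / 2))) * ∫⁻ S, ∫⁻ z, ENNReal.ofReal (Real.exp
        (1 / (2 * d) * ∑ i, 1 / (s : ℝ) * sketchSq S (v i) * (1 + z i)))
          ∂(noiseLaw n σ) ∂(sketchLaw s d) := by
        rw [← lintegral_const_mul' _ _ ENNReal.ofReal_ne_top]
        exact lintegral_congr fun S => lintegral_const_mul' _ _ ENNReal.ofReal_ne_top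
    _ ≤ ENNReal.ofReal (Real.exp (-(1 / 2))) * ENNReal.ofReal
        (Real.exp (a + 5 * a ^ 2 / s + 2 * a ^ 2 * σ ^ 2)) :=
        mul_le_mul_right (lintegral_exp_sum_noisy_sketchSq_le hσ (by positivity) hs v hQ ha1) _
    _ ≤ _ := by
        rw [← ENNReal.ofReal_mul (Real.exp_pos _).le, ← Real.exp_add]
        refine ENNReal.ofReal_le_ofReal (Real.exp_le_exp.2 ?_)
        have h3 : a ^ 2 ≤ 1 := by nlinarith
        have h4 : 5 * a ^ 2 / s ≤ 5 / s := by
          rw [div_le_div_iff_of_pos_right (by linarith)]; linarith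
        have h5 : 2 * a ^ 2 * σ ^ 2 ≤ 2 * σ ^ 2 := by nlinarith [sq_nonneg σ]
        linarith

end Iteration
end DPJohn

namespace DPJohn

/-! ### The deterministic argument: telescoping and normalization. -/

section Deterministic

variable {n d s N : ℕ} {A : Matrix (Fin n) (Fin d) ℝ} {R : Type*}

theorem prod_h_mul_eq (w : ℕ → Fin n → ℝ) (i : Fin n) (m : ℕ) (hpos : ∀ k ≤ m, 0 < w k i) :
    (∏ k ∈ Finset.range m, h A (w k) i) * w 0 i
      = w m i * ∏ k ∈ Finset.range m, w k i * h A (w k) i * (w (k + 1) i)⁻¹ := by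
  induction m with
  | zero => simp
  | succ m ih =>
    have h1 := (hpos (m + 1) le_rfl).ne'
    rw [Finset.prod_range_succ, Finset.prod_range_succ, mul_right_comm,
      ih fun k hk => hpos k (by omega)]
    field_simp

/-- There are m + 1 weights but only m steps. Telescoping over the steps leaves w_m h(w_m) ≤ 1 and
the initial weight. -/
theorem h_average_pow_le_mul (hA : A.rank = d) (w : ℕ → Fin n → ℝ) {m : ℕ}
    (hw : ∀ k ≤ m, Admissible A (w k)) {i : Fin n} (hi : A i ≠ 0) {E : ℝ}
    (hE : ∏ k ∈ Finset.range m, w k i * h A (w k) i * (w (k + 1) i)⁻¹ ≤ E) :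
    h A (fun j => 1 / ((m + 1 : ℕ) : ℝ) * ∑ k ∈ Finset.range (m + 1), w k j) i ^ (m + 1)
      ≤ (w 0 i)⁻¹ * E := by
  refine (h_average_pow_le hA m.succ_pos w (fun k hk => hw k (by omega)) i).2.trans ?_
  have h0 : 0 < w 0 i := (hw 0 (by omega) i).2 hi
  have h1 := prod_h_mul_eq (A := A) w i m fun k hk => (hw k hk i).2 hi
  have hm := (hw m le_rfl)
  have h2 := mul_h_le_one (fun i => (hm i).1) (hm.posDef_gram hA) i
  have h3 : 0 ≤ ∏ k ∈ Finset.range m, w k i * h A (w k) i * (w (k + 1) i)⁻¹ :=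
    Finset.prod_nonneg fun k hk => by
      have hk' := Finset.mem_range.1 hk
      exact mul_nonneg (mul_nonneg (hw k (by omega) i).1
        (h_nonneg ((hw k (by omega)).posDef_gram hA) i)) (inv_nonneg.2 (hw (k + 1) (by omega) i).1)
  rw [Finset.prod_range_succ, inv_mul_eq_div, le_div_iff₀ h0]
  calc _ = (∏ k ∈ Finset.range m, h A (w k) i) * w 0 i * h A (w m) i := by ring
    _ = w m i * h A (w m) i * ∏ k ∈ Finset.range m, w k i * h A (w k) i * (w (k + 1) i)⁻¹ := by
      rw [h1]; ring
    _ ≤ 1 * E := mul_le_mul h2 hE h3 zero_le_one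
    _ = E := one_mul E

theorem exp_half_le {ξ : ℝ} (h0 : 0 ≤ ξ) (h1 : ξ ≤ 1) : Real.exp (ξ / 2) ≤ 1 + ξ := by
  have := real_exp_le_one_add_add_sq (x := ξ / 2) (by linarith)
  nlinarith

/-- The output of the algorithm has the properties claimed in the main theorem. -/
def Succeeds (A : Matrix (Fin n) (Fin d) ℝ) (ξ : ℝ) (τ : ℕ → R → (Fin n → ℝ) → Fin n → ℝ)
    (x : ℕ → Draw R n d s N) (T : ℕ) : Prop :=
  (gram A (average A τ x T)).PosDef ∧ (∀ i, h A (average A τ x T) i ≤ 1 + ξ) ∧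
    IsApproxJohn A ξ (output A τ x T)

theorem sum_output (τ : ℕ → R → (Fin n → ℝ) → Fin n → ℝ) (x : ℕ → Draw R n d s N) (T : ℕ)
    (hpos : 0 < ∑ j, average A τ x T j) : ∑ i, output A τ x T i = d := by
  simp only [output]
  rw [← Finset.mul_sum, div_mul_cancel₀ _ hpos.ne']

theorem exists_row_ne_zero (hd : 0 < d) (hA : A.rank = d) : ∃ i, A i ≠ 0 := by
  by_contra! hcon
  have : A = 0 := funext hcon
  rw [this, Matrix.rank_zero] at hA
  omega

theorem succeeds_of_bounds (hd : 0 < d) (hA : A.rank = d) {ξ : ℝ} (hξ0 : 0 < ξ) (hξ1 : ξ ≤ 1)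
    (τ : ℕ → R → (Fin n → ℝ) → Fin n → ℝ) (x : ℕ → Draw R n d s N) {m : ℕ}
    (hw : ∀ k ≤ m, Admissible A (weights A τ x k))
    (hnd : (n : ℝ) / d ≤ Real.exp (ξ * (m + 1 : ℕ) / 8))
    (hratio : ∀ i, ∏ k ∈ Finset.range m, weights A τ x k i * h A (weights A τ x k) i *
      (weights A τ x (k + 1) i)⁻¹ ≤ Real.exp (ξ * (m + 1 : ℕ) / 8))
    (hmass : n ≠ 1 → ∏ k ∈ Finset.range m, Real.exp (1 / (2 * d) *
      ∑ i, weights A τ x (k + 1) i - 1 / 2) ≤ Real.exp (ξ * (m + 1 : ℕ) / 8)) :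
    Succeeds A ξ τ x (m + 1) := by
  have hd' : (0 : ℝ) < d := by exact_mod_cast hd
  obtain ⟨i₀, hi₀⟩ := exists_row_ne_zero hd hA
  have hn : 0 < n := i₀.pos
  have hn' : (0 : ℝ) < n := by exact_mod_cast hn
  have hm' : (0 : ℝ) < (m + 1 : ℕ) := by positivity
  set u := average A τ x (m + 1) with hu
  have hadm : Admissible A u :=
    (h_average_pow_le hA m.succ_pos (weights A τ x) (fun k hk => hw k (by omega)) i₀).1
  have hG := hadm.posDef_gram hA
  have hhu : ∀ i, h A u i ≤ Real.exp (ξ / 4) := by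
    intro i
    by_cases hi : A i = 0
    · rw [h_eq_zero hi]; positivity
    have h1 : h A u i ^ (m + 1) ≤ (weights A τ x 0 i)⁻¹ * Real.exp (ξ * (m + 1 : ℕ) / 8) :=
      h_average_pow_le_mul hA (weights A τ x) hw hi (hratio i)
    have h2 : (weights A τ x 0 i)⁻¹ = (n : ℝ) / d := inv_div _ _
    have h3 : h A u i ^ (m + 1) ≤ Real.exp (ξ / 4) ^ (m + 1) := by
      rw [h2] at h1
      calc _ ≤ _ := h1
        _ ≤ Real.exp (ξ * (m + 1 : ℕ) / 8) * Real.exp (ξ * (m + 1 : ℕ) / 8) :=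
          mul_le_mul_of_nonneg_right hnd (Real.exp_pos _).le
        _ = Real.exp (ξ / 4) ^ (m + 1) := by
          rw [← Real.exp_add, ← Real.exp_nat_mul]; congr 1; ring
    exact le_of_pow_le_pow_left₀ (by omega) (Real.exp_pos _).le h3
  have hsumpos : 0 < ∑ j, u j :=
    Finset.sum_pos' (fun j _ => (hadm j).1) ⟨i₀, Finset.mem_univ _, (hadm i₀).2 hi₀⟩
  have hc : 0 < (d : ℝ) / ∑ j, u j := div_pos hd' hsumpos
  have hvadm : Admissible A (output A τ x (m + 1)) := fun i =>
    ⟨mul_nonneg hc.le (hadm i).1, fun hi => mul_pos hc ((hadm i).2 hi)⟩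
  have hvsum : ∑ i, output A τ x (m + 1) i = d := sum_output τ x (m + 1) hsumpos
  refine ⟨hG, fun i => (hhu i).trans ((Real.exp_le_exp.2 (by linarith)).trans
    (exp_half_le hξ0.le hξ1)), fun i => (hvadm i).1, hvadm.posDef_gram hA, hvsum, fun i => ?_⟩
  -- With one row, the weight v equals d and v h(v) = d, so h = 1 without any control of the mass.
  by_cases hn1 : n = 1
  · subst hn1
    have h1 := sum_mul_h (hvadm.posDef_gram hA)
    have h2 : (d : ℝ) * h A (output A τ x (m + 1)) i = d := by
      rw [Fintype.sum_subsingleton _ i] at h1 hvsum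
      rwa [hvsum] at h1
    have h3 : h A (output A τ x (m + 1)) i = 1 := by
      field_simp at h2; exact h2
    linarith
  have h1 : h A (output A τ x (m + 1)) i = (∑ j, u j) / d * h A u i := by
    rw [← inv_div]; exact h_smul _ u i
  have h2 : ∑ j, u j ≤ d * (1 + ξ / 4) := by
    have h3 := hmass hn1
    rw [← Real.exp_sum, Real.exp_le_exp, Finset.sum_sub_distrib, ← Finset.mul_sum] at h3
    simp only [Finset.sum_const, Finset.card_range, nsmul_eq_mul] at h3
    have h4 : ∑ j, u j = 1 / ((m + 1 : ℕ) : ℝ) * (∑ k ∈ Finset.range m,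
        ∑ j, weights A τ x (k + 1) j + d) := by
      have h5 : ∑ j, weights A τ x 0 j = d := by
        simp only [weights, Finset.sum_const, Finset.card_univ, Fintype.card_fin, nsmul_eq_mul]
        field_simp
      rw [← h5, ← Finset.sum_range_succ' (fun k => ∑ j, weights A τ x k j), Finset.sum_comm,
        Finset.mul_sum]
      rfl
    rw [h4, one_div, inv_mul_le_iff₀ hm']
    set Q := ∑ k ∈ Finset.range m, ∑ j, weights A τ x (k + 1) j
    have h6 : Q = 2 * d * (1 / (2 * d) * Q) := by field_simp
    -- The mass bound gives Q ≤ md + dξ(m+1)/4. Adding the initial mass d and dividing by m + 1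
    -- gives d(1 + ξ/4).
    have h7 : 1 / (2 * d) * Q ≤ ξ * (m + 1 : ℕ) / 8 + m * (1 / 2) := by linarith
    have h8 := mul_le_mul_of_nonneg_left h7 (by positivity : (0 : ℝ) ≤ 2 * d)
    rw [← h6] at h8
    push_cast at h8 ⊢
    linarith
  have h3 : (∑ j, u j) / d ≤ Real.exp (ξ / 4) := by
    rw [div_le_iff₀ hd']
    have := Real.add_one_le_exp (ξ / 4)
    nlinarith
  rw [h1]
  calc _ ≤ Real.exp (ξ / 4) * Real.exp (ξ / 4) :=
        mul_le_mul h3 (hhu i) (h_nonneg hG i) (Real.exp_pos _).le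
    _ = Real.exp (ξ / 2) := by rw [← Real.exp_add]; congr 1; ring
    _ ≤ 1 + ξ := exp_half_le hξ0.le hξ1

end Deterministic

/-! ### Reduction to exceptional events. -/

section Exceptional

variable {n d s N : ℕ} {A : Matrix (Fin n) (Fin d) ℝ} {R : Type*}

/-- `badSet` blames only the first step that leaves the admissible weights, so avoiding it at each
step propagates admissibility from the positive starting point. -/
theorem admissible_of_notMem_badSet {ε : ℝ} {τ : ℕ → R → (Fin n → ℝ) → Fin n → ℝ}
    {x : ℕ → Draw R n d s N} {m : ℕ} (hd : 0 < d)
    (hx : ∀ k < m, (x k, weights A τ x k) ∉ badSet A ε (τ k)) :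
    ∀ k ≤ m, Admissible A (weights A τ x k) := by
  intro k
  induction k with
  | zero =>
    intro _ i
    have hn : (0 : ℝ) < n := by exact_mod_cast i.pos
    have hd' : (0 : ℝ) < d := by exact_mod_cast hd
    have : 0 < weights A τ x 0 i := div_pos hd' hn
    exact ⟨this.le, fun _ => this⟩
  | succ k ih =>
    intro hk
    have h1 := hx k (by omega)
    by_contra hcon
    exact h1 ⟨ih (by omega), fun h2 => hcon h2.2⟩

theorem mem_goodSet_of_notMem_badSet {ε : ℝ} {τ : ℕ → R → (Fin n → ℝ) → Fin n → ℝ}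
    {x : ℕ → Draw R n d s N} {m : ℕ} (hd : 0 < d)
    (hx : ∀ k < m, (x k, weights A τ x k) ∉ badSet A ε (τ k)) {k : ℕ} (hk : k < m) :
    (x k, weights A τ x k) ∈
      ({y : Draw R n d s N × (Fin n → ℝ) | Admissible A y.2} ∩ goodSet A ε (τ k)) := by
  have h0 := admissible_of_notMem_badSet hd hx k hk.le
  refine ⟨h0, ?_⟩
  by_contra hcon
  exact hx k hk ⟨h0, fun h2 => hcon h2.1⟩

theorem succeeds_of_notMem (hd : 0 < d) (hA : A.rank = d) {ξ : ℝ} (hξ0 : 0 < ξ) (hξ1 : ξ ≤ 1)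
    {ε : ℝ} {τ : ℕ → R → (Fin n → ℝ) → Fin n → ℝ} {x : ℕ → Draw R n d s N} {m : ℕ}
    (hnd : (n : ℝ) / d ≤ Real.exp (ξ * (m + 1 : ℕ) / 8))
    (hx : ∀ k < m, (x k, weights A τ x k) ∉ badSet A ε (τ k))
    (hratio : ∀ i, ∏ k ∈ Finset.range m, ratioFn A ε (τ k) i (x k, weights A τ x k)
      < ENNReal.ofReal (Real.exp (ξ * (m + 1 : ℕ) / 8)))
    (hmass : n ≠ 1 → ∏ k ∈ Finset.range m, massFn A ε (τ k) (x k, weights A τ x k)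
      < ENNReal.ofReal (Real.exp (ξ * (m + 1 : ℕ) / 8))) :
    Succeeds A ξ τ x (m + 1) := by
  have hadm := admissible_of_notMem_badSet hd hx
  refine succeeds_of_bounds hd hA hξ0 hξ1 τ x hadm hnd (fun i => ?_) fun hn => ?_
  · have h1 := hratio i
    simp only [ratioFn] at h1
    rw [Finset.prod_congr rfl fun k hk => Set.indicator_of_mem
      (mem_goodSet_of_notMem_badSet hd hx (Finset.mem_range.1 hk)) _,
      ← ENNReal.ofReal_prod_of_nonneg, ENNReal.ofReal_lt_ofReal_iff (Real.exp_pos _)] at h1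
    · exact h1.le
    · intro k hk
      have hk' := Finset.mem_range.1 hk
      exact mul_nonneg (mul_nonneg (hadm k (by omega) i).1
        (h_nonneg ((hadm k (by omega)).posDef_gram hA) i))
        (inv_nonneg.2 (hadm (k + 1) (by omega) i).1)
  · have h1 := hmass hn
    simp only [massFn] at h1
    rw [Finset.prod_congr rfl fun k hk => Set.indicator_of_mem
      (mem_goodSet_of_notMem_badSet hd hx (Finset.mem_range.1 hk)) _,
      ← ENNReal.ofReal_prod_of_nonneg, ENNReal.ofReal_lt_ofReal_iff (Real.exp_pos _)] at h1
    · exact h1.le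
    · exact fun k _ => (Real.exp_pos _).le

theorem measure_exp_le_of_lintegral_le {Ω : Type*} [MeasurableSpace Ω] {P : Measure Ω}
    {f : Ω → ENNReal} (hf : Measurable f) {a b : ℝ} {m : ℕ}
    (hint : ∫⁻ ω, f ω ∂P ≤ ENNReal.ofReal (Real.exp a) ^ m) :
    P {ω | ENNReal.ofReal (Real.exp b) ≤ f ω} ≤ ENNReal.ofReal (Real.exp (m * a - b)) := by
  refine (meas_ge_le_lintegral_div hf.aemeasurable (by simp [Real.exp_pos])
    ENNReal.ofReal_ne_top).trans ?_
  refine (ENNReal.div_le_div_right hint _).trans (le_of_eq ?_)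
  rw [← ENNReal.ofReal_pow (Real.exp_pos _).le, ← ENNReal.ofReal_div_of_pos (Real.exp_pos _),
    ← Real.exp_nat_mul, Real.exp_sub]

end Exceptional
end DPJohn


namespace DPJohn

/-! ### Union bound and choice of constants. -/

section Probability

variable {n d s N : ℕ} {A : Matrix (Fin n) (Fin d) ℝ} {R : Type*}

/-- Needs neither accurate sampling nor full rank: the first weight is positive, and all later ones
are nonnegative because 1 + z ≥ 1/2. Hence the normalization holds almost surely. -/
theorem sum_average_pos_of_noise {τ : ℕ → R → (Fin n → ℝ) → Fin n → ℝ} {x : ℕ → Draw R n d s N}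
    (hd : 0 < d) (hn : 0 < n) {T : ℕ} (hT : 0 < T)
    (hx : ∀ k i, (x k).2.2.2 i ∈ Set.Icc (-1 / 2 : ℝ) (1 / 2)) :
    0 < ∑ j, average A τ x T j := by
  have hw0 : ∀ j, 0 < weights A τ x 0 j := fun j =>
    div_pos (by exact_mod_cast hd) (by exact_mod_cast hn)
  have hw : ∀ k j, 0 ≤ weights A τ x k j := by
    intro k j
    cases k with
    | zero => exact (hw0 j).le
    | succ k =>
      have h1 : 0 ≤ 1 + (x k).2.2.2 j := by linarith [(hx k j).1]
      exact mul_nonneg (mul_nonneg (by positivity) (Finset.sum_nonneg fun _ _ => sq_nonneg _)) h1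
  have : Nonempty (Fin n) := ⟨⟨0, hn⟩⟩
  have hT' : (0 : ℝ) < T := by exact_mod_cast hT
  exact Finset.sum_pos (fun j _ => mul_pos (by positivity) (Finset.sum_pos' (fun k _ => hw k j)
    ⟨0, Finset.mem_range.2 hT, hw0 j⟩)) Finset.univ_nonempty

variable [MeasurableSpace R]

/-- The budget ξ/32 is split into ξ/64 for the sampling and ξ/256 each for sketch and noise. -/
theorem ratio_constant_le {ξ σ s : ℝ} (hξ0 : 0 < ξ) (hξ1 : ξ ≤ 1) (hσ0 : 0 < σ) (hσ : σ ≤ ξ / 32)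
    (hs : 65536 * ξ⁻¹ ≤ s) :
    (1 + ξ / 64) * (s / (s - 2) * (1 + 4 * σ ^ 2)) ≤ Real.exp (ξ / 32) := by
  have hs1 : 65536 ≤ ξ * s := by
    rw [← div_eq_mul_inv, div_le_iff₀ hξ0] at hs; linarith
  have hs2 : 2 < s := by nlinarith
  have h1 : 1 + ξ / 64 ≤ Real.exp (ξ / 64) := by linarith [Real.add_one_le_exp (ξ / 64)]
  have h2 : s / (s - 2) ≤ Real.exp (ξ / 256) := by
    refine le_trans ?_ (Real.add_one_le_exp _)
    rw [div_le_iff₀ (by linarith)]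
    nlinarith
  have h3 : 1 + 4 * σ ^ 2 ≤ Real.exp (ξ / 256) := by
    refine le_trans ?_ (Real.add_one_le_exp _)
    nlinarith
  have h4 : 0 ≤ s / (s - 2) := div_nonneg (by linarith) (by linarith)
  calc _ ≤ Real.exp (ξ / 64) * (Real.exp (ξ / 256) * Real.exp (ξ / 256)) := by gcongr
    _ = Real.exp (ξ / 64 + (ξ / 256 + ξ / 256)) := by rw [Real.exp_add, Real.exp_add]
    _ ≤ _ := Real.exp_le_exp.2 (by linarith)

theorem mass_constant_le {ξ σ s : ℝ} (hξ0 : 0 < ξ) (hξ1 : ξ ≤ 1) (hσ0 : 0 < σ) (hσ : σ ≤ ξ / 32)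
    (hs : 65536 * ξ⁻¹ ≤ s) : ξ / 64 + 5 / s + 2 * σ ^ 2 ≤ ξ / 32 := by
  have hs1 : 65536 ≤ ξ * s := by
    rw [← div_eq_mul_inv, div_le_iff₀ hξ0] at hs; linarith
  have hs2 : 0 < s := by nlinarith
  have h1 : 5 / s ≤ ξ / 256 := by rw [div_le_iff₀ hs2]; linarith
  nlinarith

variable {ν : Measure R}

theorem ae_noise_mem_Icc {σ : ℝ} (hσ : σ ^ 2 ≤ 1 / 8) :
    ∀ᵐ x ∂(drawLaw ν n d s N σ), ∀ i, x.2.2.2 i ∈ Set.Icc (-1 / 2 : ℝ) (1 / 2) := by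
  have := isProbabilityMeasure_truncGaussian hσ
  rw [ae_all_iff]
  intro i
  have hz : ∀ᵐ z ∂(noiseLaw n σ), z i ∈ Set.Icc (-1 / 2 : ℝ) (1 / 2) :=
    (Measure.quasiMeasurePreserving_eval (μ := fun _ : Fin n => truncGaussian 0 σ) i).ae
      (ae_mem_Icc_truncGaussian σ)
  exact ((Measure.quasiMeasurePreserving_snd.comp (Measure.quasiMeasurePreserving_snd.comp
    Measure.quasiMeasurePreserving_snd))).ae hz

variable [IsProbabilityMeasure ν] {Ω : Type*} [MeasurableSpace Ω] {P : Measure Ω}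
  [IsProbabilityMeasure P]

/-- The three terms account for a bad step, for a large error product of some row, and for excess
mass; the last is not needed when n = 1. -/
theorem measure_not_succeeds_le (hd : 0 < d) (hA : A.rank = d) {κ : ℝ} (hκ : 1 ≤ κ) {ξ : ℝ}
    (hξ0 : 0 < ξ) (hξ1 : ξ ≤ 1) {σ : ℝ} (hσ0 : 0 < σ) (hσ : σ ≤ ξ / 32)
    (hs : 65536 * ξ⁻¹ ≤ s) {m : ℕ} (hnd : (n : ℝ) / d ≤ Real.exp (ξ * (m + 1 : ℕ) / 8))
    {τ : ℕ → R → (Fin n → ℝ) → Fin n → ℝ} (hτ : ∀ k, IsLeverageApprox ν A κ (τ k))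
    {X : ℕ → Ω → Draw R n d s N} (hXm : ∀ k, Measurable (X k))
    (hlaw : ∀ k, P.map (X k) = drawLaw ν n d s N σ) (hind : iIndepFun X P) {q : ENNReal}
    (hq : ∀ w p : Fin n → ℝ, (∀ i, 0 ≤ w i) → (gram A w).PosDef → (∀ i, 0 ≤ p i) →
      ∑ i, p i = 1 → (∀ i, w i * h A w i ≤ κ ^ 2 * d * p i) →
        uniformLaw N {U | ¬ GoodSample A (ξ / 64) p U w} ≤ q) :
    P {ω | ¬ Succeeds A ξ τ (fun k => X k ω) (m + 1)} ≤
      m * q + n * ENNReal.ofReal (Real.exp (-(ξ * (m + 1 : ℕ) / 16))) +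
        if n = 1 then 0 else ENNReal.ofReal (Real.exp (-(ξ * (m + 1 : ℕ) / 16))) := by
  have hσ2 : σ ^ 2 ≤ 1 / 8 := by nlinarith
  have hs6 : 6 ≤ s := by
    have h1 : 65536 ≤ ξ * s := by
      rw [← div_eq_mul_inv, div_le_iff₀ hξ0] at hs; linarith
    have : (6 : ℝ) ≤ s := by nlinarith
    exact_mod_cast this
  have := isProbabilityMeasure_drawLaw (ν := ν) (n := n) (d := d) (s := s) (N := N) hσ2
  set W : ℕ → Ω → Fin n → ℝ := fun k ω => weights A τ (fun k => X k ω) k with hW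
  set g : ℕ → Draw R n d s N × (Fin n → ℝ) → Fin n → ℝ := fun k y => step A (τ k) y.1 y.2 with hg
  have hgm : ∀ k, Measurable (g k) := fun k => measurable_step (hτ k).measurable
  have hW0 : ∀ ω, W 0 ω = fun _ => (d : ℝ) / n := fun ω => rfl
  have hWs : ∀ k ω, W (k + 1) ω = g k (X k ω, W k ω) := fun k ω => rfl
  have hWm : ∀ k, Measurable (W k) := fun k =>
    (measurable_past_of_recursion hgm hW0 hWs k).mono
      (iSup₂_le fun j _ => (hXm j).comap_le) le_rfl
  set e := ENNReal.ofReal (Real.exp (-(ξ * (m + 1 : ℕ) / 16))) with he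
  set b := ξ * (m + 1 : ℕ) / 8 with hb
  -- Markov's bound is exp(mξ/32 - ξ(m+1)/8), which is at most exp(-ξ(m+1)/16).
  have hexp : ENNReal.ofReal (Real.exp (m * (ξ / 32) - b)) ≤ e := by
    refine ENNReal.ofReal_le_ofReal (Real.exp_le_exp.2 ?_)
    rw [hb]; push_cast
    have : 0 ≤ ξ * m := by positivity
    linarith
  set E1 : Set Ω := {ω | ∃ k < m, (X k ω, W k ω) ∈ badSet A (ξ / 64) (τ k)} with hE1
  set E2 : Fin n → Set Ω := fun i => {ω | ENNReal.ofReal (Real.exp b) ≤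
    ∏ k ∈ Finset.range m, ratioFn A (ξ / 64) (τ k) i (X k ω, W k ω)} with hE2
  set E3 : Set Ω := {ω | ENNReal.ofReal (Real.exp b) ≤
    ∏ k ∈ Finset.range m, massFn A (ξ / 64) (τ k) (X k ω, W k ω)} with hE3
  have h1 : P E1 ≤ m * q :=
    measure_exists_recursion_le hXm hlaw hind hgm hW0 hWs
      (fun k => measurableSet_badSet _ (hτ k).measurable)
      (fun k w => drawLaw_badSet_le hσ2 (by positivity) hA hd (by omega) hκ (hτ k) hq w) m
  have h2 : ∀ i, P (E2 i) ≤ e := fun i => by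
    refine (measure_exp_le_of_lintegral_le (Finset.measurable_fun_prod _ fun k _ =>
      (measurable_ratioFn _ (hτ k).measurable i).comp ((hXm k).prodMk (hWm k)))
      (lintegral_prod_recursion_le hXm hlaw hind hgm hW0 hWs
        (fun k => measurable_ratioFn _ (hτ k).measurable i) (fun k w =>
          (lintegral_ratioFn_le hσ2 (by positivity) hA (by omega) (hτ k).measurable i w).trans
            (ENNReal.ofReal_le_ofReal (ratio_constant_le hξ0 hξ1 hσ0 hσ hs))) m)).trans hexp
  have h3 : P E3 ≤ e := by
    refine (measure_exp_le_of_lintegral_le (Finset.measurable_fun_prod _ fun k _ =>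
      (measurable_massFn _ (hτ k).measurable).comp ((hXm k).prodMk (hWm k)))
      (lintegral_prod_recursion_le hXm hlaw hind hgm hW0 hWs
        (fun k => measurable_massFn _ (hτ k).measurable) (fun k w =>
          (lintegral_massFn_le hσ2 (by positivity) (by linarith) hA hd hs6
            (hτ k).measurable w).trans
            (ENNReal.ofReal_le_ofReal (Real.exp_le_exp.2
              (mass_constant_le hξ0 hξ1 hσ0 hσ hs)))) m)).trans hexp
  have hsub : {ω | ¬ Succeeds A ξ τ (fun k => X k ω) (m + 1)} ⊆
      (E1 ∪ ⋃ i, E2 i) ∪ (if n = 1 then ∅ else E3) := by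
    intro ω hω
    by_contra hcon
    simp only [Set.mem_union, Set.mem_iUnion, not_or, not_exists] at hcon
    refine hω (succeeds_of_notMem hd hA hξ0 hξ1 (ε := ξ / 64) hnd
      (fun k hk hmem => hcon.1.1 ⟨k, hk, hmem⟩) (fun i => not_le.1 (hcon.1.2 i)) fun hn => ?_)
    have h4 := hcon.2
    rw [if_neg hn] at h4
    exact not_le.1 h4
  refine (measure_mono hsub).trans ((measure_union_le _ _).trans (add_le_add
    ((measure_union_le _ _).trans (add_le_add h1 ((measure_iUnion_fintype_le _ _).trans
      ((Finset.sum_le_card_nsmul _ _ e fun i _ => h2 i).trans ?_)))) ?_))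
  · simp
  · split_ifs
    · simp
    · exact h3

/-- One power of each cube pays for its union bound. What remains is at most 1/4 in each term
because n ≥ 2, which also gives δ ≤ 1/2. -/
theorem failure_bound_le {n d T : ℕ} (hn : 2 ≤ n) (hd : 0 < d) {δ₀ δ δ₁ : ℝ}
    (h0 : 0 < δ₀) (h1 : δ₀ ≤ 1) (hδ : 0 < δ) (hδn : δ ≤ δ₀ / n) (hδ1 : 0 < δ₁)
    (hT : 0 < T) (hδ1T : δ₁ ≤ δ₀ / T) :
    T * (2 * d * (δ₁ / (n * d)) ^ 3) + n * δ ^ 3 + δ ^ 3 ≤ δ₀ := by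
  have hn' : (2 : ℝ) ≤ n := by exact_mod_cast hn
  have hd' : (1 : ℝ) ≤ d := by exact_mod_cast hd
  have hT' : (1 : ℝ) ≤ T := by exact_mod_cast hT
  rw [le_div_iff₀ (by linarith)] at hδn hδ1T
  have hδle : δ ≤ 1 / 2 := by nlinarith
  have hδ1le : δ₁ ≤ 1 := by nlinarith
  have e1 : n * δ ^ 3 ≤ δ₀ * (1 / 4) := by
    calc n * δ ^ 3 = (δ * n) * δ ^ 2 := by ring
      _ ≤ δ₀ * (1 / 4) := mul_le_mul hδn (by nlinarith) (by positivity) h0.le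
  have e2 : δ ^ 3 ≤ δ₀ * (1 / 4) := by nlinarith [pow_pos hδ 3]
  have e3 : T * (2 * d * (δ₁ / (n * d)) ^ 3) ≤ δ₀ * (1 / 4) := by
    have e4 : 2 * d * (1 / (n * d : ℝ)) ^ 3 ≤ 1 / 4 := by
      have e5 : 2 * d * (1 / (n * d : ℝ)) ^ 3 = 2 / (n ^ 3 * d ^ 2) := by field_simp
      rw [e5, div_le_div_iff₀ (by positivity) (by norm_num)]
      have e6 : (8 : ℝ) ≤ n ^ 3 := by
        calc (8 : ℝ) = 2 ^ 3 := by norm_num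
          _ ≤ _ := by gcongr
      have e7 : (1 : ℝ) ≤ d ^ 2 := one_le_pow₀ hd'
      nlinarith
    calc T * (2 * d * (δ₁ / (n * d)) ^ 3)
        = (δ₁ * T) * (δ₁ ^ 2 * (2 * d * (1 / (n * d : ℝ)) ^ 3)) := by ring
      _ ≤ δ₀ * (1 * (1 / 4)) := by
        refine mul_le_mul hδ1T (mul_le_mul (pow_le_one₀ hδ1.le hδ1le) e4 (by positivity)
          zero_le_one) (by positivity) h0.le
      _ = _ := by ring
  linarith

end Probability
end DPJohn

/-! ### The main theorem. -/

theorem mainTheorem3 (κ : ℝ) (hκ : 1 ≤ κ) :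
    ∃ C : ℝ, 0 < C ∧
      ∀ (n d : ℕ) (_hd : 0 < d)
        (A : Matrix (Fin n) (Fin d) ℝ) (_hA : A.rank = d)
        (ξ : ℝ) (_hξ : ξ ∈ Set.Ioo (0 : ℝ) 1)
        (δ₀ : ℝ) (_hδ₀ : δ₀ ∈ Set.Ioo (0 : ℝ) 1)
        (σ : ℝ) (_hσ : 0 < σ) (_hσξ : σ ≤ ξ / 32)
        (T s N : ℕ)
        (δ : ℝ) (_hδ : 0 < δ) (_hδn : δ ≤ δ₀ / n)
        (_hT : C * (ξ⁻¹ * Real.log ((n : ℝ) / d) + (ξ ^ 2)⁻¹ * Real.log (1 / δ)) ≤ T)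
        (_hs : C * ξ⁻¹ ≤ s)
        (δ₁ : ℝ) (_hδ₁ : 0 < δ₁) (_hδ₁T : δ₁ ≤ δ₀ / T)
        (_hN : C * ((ξ ^ 2)⁻¹ * d * Real.log ((n : ℝ) * d / δ₁)) ≤ N)
        (R : Type*) [MeasurableSpace R] (ν : Measure R) [IsProbabilityMeasure ν]
        (τ : ℕ → R → (Fin n → ℝ) → Fin n → ℝ)
        (_hτ : ∀ k, DPJohn.IsLeverageApprox ν A κ (τ k))
        (Ω : Type*) [MeasurableSpace Ω] (P : Measure Ω) [IsProbabilityMeasure P]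
        (X : ℕ → Ω → DPJohn.Draw R n d s N)
        (_hX : ∀ k, HasLaw (X k) (DPJohn.drawLaw ν n d s N σ) P)
        (_hindep : iIndepFun X P),
        ENNReal.ofReal (1 - δ₀) ≤
            P {ω |
              (DPJohn.gram A (DPJohn.average A τ (fun k => X k ω) T)).PosDef ∧
              (∀ i, DPJohn.h A (DPJohn.average A τ (fun k => X k ω) T) i ≤ 1 + ξ) ∧
              DPJohn.IsApproxJohn A ξ (DPJohn.output A τ (fun k => X k ω) T)} ∧
          ∀ᵐ ω ∂P, ∑ i, DPJohn.output A τ (fun k => X k ω) T i = d := by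
  -- With ε = ξ/64 and L = κ²d, the Bernstein exponent is ξ²N/(4 · 64² · κ²d), and 65536 = 4 · 4 ·
  -- 64² makes it four times the logarithm. The same number leaves ample slack for s and T.
  refine ⟨65536 * κ ^ 2, by positivity, ?_⟩
  intro n d hd A hA ξ ⟨hξ0, hξ1⟩ δ₀ ⟨hδ₀0, hδ₀1⟩ σ hσ hσξ T s N δ hδ hδn hT hs δ₁ hδ₁ hδ₁T hN
    R _ ν _ τ hτ Ω _ P _ X hX hindep
  have hκ2 : 1 ≤ κ ^ 2 := one_le_pow₀ hκ
  have hσ2 : σ ^ 2 ≤ 1 / 8 := by nlinarith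
  obtain ⟨i₀, -⟩ := DPJohn.exists_row_ne_zero hd hA
  have hn : 0 < n := i₀.pos
  have hdn : d ≤ n := by
    have := A.rank_le_card_height
    rwa [hA, Fintype.card_fin] at this
  have hn' : (1 : ℝ) ≤ n := by exact_mod_cast hn
  have hd' : (1 : ℝ) ≤ d := by exact_mod_cast hd
  have hdn' : (d : ℝ) ≤ n := by exact_mod_cast hdn
  have hTpos : 0 < T := by
    rcases Nat.eq_zero_or_pos T with h | h
    -- For T = 0 the quotient δ₀/T is zero by convention, which contradicts δ₁ > 0.
    · rw [h, Nat.cast_zero, div_zero] at hδ₁T; linarith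
    · exact h
  have hT1 : (1 : ℝ) ≤ T := by exact_mod_cast hTpos
  refine ⟨?_, ?_⟩
  swap
  · have hnoise : ∀ᵐ ω ∂P, ∀ k i, (X k ω).2.2.2 i ∈ Set.Icc (-1 / 2 : ℝ) (1 / 2) := by
      rw [ae_all_iff]
      intro k
      have h1 := DPJohn.ae_noise_mem_Icc (ν := ν) (n := n) (d := d) (s := s) (N := N) hσ2
      rw [← (hX k).map_eq] at h1
      exact ae_of_ae_map (hX k).aemeasurable h1
    filter_upwards [hnoise] with ω hω
    exact DPJohn.sum_output τ _ T (DPJohn.sum_average_pos_of_noise hd hn hTpos hω)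
  obtain ⟨m, rfl⟩ : ∃ m, T = m + 1 := ⟨T - 1, by omega⟩
  have hδ₁le : δ₁ ≤ δ₀ := hδ₁T.trans (div_le_self hδ₀0.le hT1)
  have hδle : δ ≤ δ₀ := hδn.trans (div_le_self hδ₀0.le hn')
  have hlog1 : 0 ≤ Real.log ((n : ℝ) / d) :=
    Real.log_nonneg (by rw [le_div_iff₀ (by linarith)]; linarith)
  have hlog2 : 0 ≤ Real.log (1 / δ) :=
    Real.log_nonneg (by rw [le_div_iff₀ hδ]; linarith)
  have hlog3 : 0 < Real.log ((n : ℝ) * d / δ₁) :=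
    Real.log_pos (by rw [lt_div_iff₀ hδ₁]; nlinarith)
  have hNpos : 0 < N := by
    have : (0 : ℝ) < N := lt_of_lt_of_le (by positivity) hN
    exact_mod_cast this
  have hs' : 65536 * ξ⁻¹ ≤ s := le_trans (by
    have : 0 < ξ⁻¹ := inv_pos.2 hξ0
    nlinarith) hs
  have hTξ : 65536 * (Real.log ((n : ℝ) / d) + Real.log (1 / δ)) ≤ ξ * (m + 1 : ℕ) := by
    have h1 := mul_le_mul_of_nonneg_left hT hξ0.le
    have h2 : ξ * (65536 * κ ^ 2 * (ξ⁻¹ * Real.log ((n : ℝ) / d) + (ξ ^ 2)⁻¹ * Real.log (1 / δ)))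
        = 65536 * κ ^ 2 * (Real.log ((n : ℝ) / d) + ξ⁻¹ * Real.log (1 / δ)) := by field_simp
    rw [h2] at h1
    have h3 : Real.log (1 / δ) ≤ ξ⁻¹ * Real.log (1 / δ) :=
      le_mul_of_one_le_left hlog2 ((one_le_inv₀ hξ0).2 hξ1.le)
    nlinarith
  have hnd : (n : ℝ) / d ≤ Real.exp (ξ * (m + 1 : ℕ) / 8) := by
    rw [← Real.log_le_iff_le_exp (by positivity)]
    linarith
  have hexpδ : Real.exp (-(ξ * (m + 1 : ℕ) / 16)) ≤ δ ^ 3 := by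
    rw [← Real.exp_log hδ, ← Real.exp_nat_mul, Real.exp_le_exp]
    rw [one_div, Real.log_inv] at hTξ hlog2
    push_cast at hTξ ⊢
    linarith
  have hexpN : Real.exp (-((ξ / 64) ^ 2 * N / (4 * (κ ^ 2 * d)))) ≤ (δ₁ / (n * d)) ^ 3 := by
    have h1 : 0 < δ₁ / (n * d) := by positivity
    rw [← Real.exp_log h1, ← Real.exp_nat_mul, Real.exp_le_exp]
    have h2 : Real.log (δ₁ / (n * d)) = - Real.log ((n : ℝ) * d / δ₁) := by
      rw [← Real.log_inv, inv_div]
    rw [h2]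
    have h3 : 4 * Real.log ((n : ℝ) * d / δ₁) ≤ (ξ / 64) ^ 2 * N / (4 * (κ ^ 2 * d)) := by
      rw [le_div_iff₀ (by positivity)]
      have h4 := mul_le_mul_of_nonneg_left hN (by positivity : 0 ≤ (ξ / 64) ^ 2)
      refine le_trans (le_of_eq ?_) h4
      field_simp
      ring
    push_cast
    linarith
  -- `HasLaw` gives only almost everywhere measurability; passing to measurable versions changes
  -- neither the laws, nor independence, nor the probability of success.
  set X' : ℕ → Ω → DPJohn.Draw R n d s N := fun k => (hX k).aemeasurable.mk (X k) with hX'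
  have hae : ∀ k, X k =ᵐ[P] X' k := fun k => (hX k).aemeasurable.ae_eq_mk
  have hXm : ∀ k, Measurable (X' k) := fun k => (hX k).aemeasurable.measurable_mk
  have hlaw : ∀ k, P.map (X' k) = DPJohn.drawLaw ν n d s N σ := fun k => by
    rw [← (hX k).map_eq, Measure.map_congr (hae k)]
  have hind : iIndepFun X' P := hindep.congr hae
  have hbad : P {ω | ¬ DPJohn.Succeeds A ξ τ (fun k => X' k ω) (m + 1)} ≤ ENNReal.ofReal δ₀ := by
    by_cases hn1 : n = 1
    · have : Subsingleton (Fin n) := by subst hn1; infer_instance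
      refine (DPJohn.measure_not_succeeds_le hd hA hκ hξ0 hξ1.le hσ hσξ hs' hnd hτ hXm hlaw hind
        (q := 0) fun w p hw hG hp hp1 _ => (DPJohn.uniformLaw_not_goodSample_eq_zero hw hG hp hp1
          hNpos (by positivity) (by linarith)).le).trans ?_
      rw [if_pos hn1, hn1, mul_zero, zero_add, add_zero, Nat.cast_one, one_mul]
      refine ENNReal.ofReal_le_ofReal (hexpδ.trans ?_)
      calc δ ^ 3 = δ * δ ^ 2 := by ring
        _ ≤ δ₀ * 1 := mul_le_mul hδle (pow_le_one₀ hδ.le (by linarith)) (by positivity) hδ₀0.le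
        _ = δ₀ := mul_one _
    · refine (DPJohn.measure_not_succeeds_le hd hA hκ hξ0 hξ1.le hσ hσξ hs' hnd hτ hXm hlaw hind
        fun w p hw hG hp hp1 hL => DPJohn.uniformLaw_not_goodSample_le hd hw hG hp hp1
          (by nlinarith) hL hNpos (ε := ξ / 64) (by positivity) (by linarith)).trans ?_
      rw [if_neg hn1]
      have h1 := DPJohn.failure_bound_le (T := m + 1) (show 2 ≤ n by omega) hd hδ₀0 hδ₀1.le hδ hδn
        hδ₁ hTpos hδ₁T
      rw [← ENNReal.ofReal_natCast, ← ENNReal.ofReal_natCast, ← ENNReal.ofReal_mul (by positivity),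
        ← ENNReal.ofReal_mul (by positivity), ← ENNReal.ofReal_add (by positivity) (by positivity),
        ← ENNReal.ofReal_add (by positivity) (by positivity)]
      refine ENNReal.ofReal_le_ofReal (le_trans ?_ h1)
      have h2 : (m : ℝ) ≤ (m + 1 : ℕ) := by push_cast; linarith
      gcongr
  have hset : P {ω | DPJohn.Succeeds A ξ τ (fun k => X k ω) (m + 1)}
      = P {ω | DPJohn.Succeeds A ξ τ (fun k => X' k ω) (m + 1)} := by
    refine measure_congr ?_
    filter_upwards [ae_all_iff.2 hae] with ω hω
    have : (fun k => X k ω) = fun k => X' k ω := funext hω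
    exact congrArg (fun x => DPJohn.Succeeds A ξ τ x (m + 1)) this
  change ENNReal.ofReal (1 - δ₀) ≤ P {ω | DPJohn.Succeeds A ξ τ (fun k => X k ω) (m + 1)}
  rw [hset, ENNReal.ofReal_sub _ hδ₀0.le, ENNReal.ofReal_one, tsub_le_iff_right]
  calc (1 : ENNReal) = P Set.univ := measure_univ.symm
    _ ≤ P ({ω | DPJohn.Succeeds A ξ τ (fun k => X' k ω) (m + 1)} ∪
        {ω | ¬ DPJohn.Succeeds A ξ τ (fun k => X' k ω) (m + 1)}) :=
      measure_mono fun ω _ => em _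
    _ ≤ _ := (measure_union_le _ _).trans (add_le_add le_rfl hbad)
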